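/- **Setting.** Let $q,e\in\mathbb R$ with $|qe|<\tfrac12$ and put $\alpha_0=\tfrac12\sqrt{1-4(qe)^2}>0$. Let $\Sigma=(0,\infty)_R\times\mathbb S^2$ with the measure $R\,d\sigma_{\mathbb S^2}\,dR$, where $\mathbb S^2$ is the unit round sphere with gradient $\nabla_{\mathbb S^2}$ and Laplacian $\Delta_{\mathbb S^2}$. Let $\underline L^2=L^2(\Sigma;R\,d\sigma_{\mathbb S^2}dR;\mathbb C)$ and $\langle f,g\rangle=\int_\Sigma f\,\overline g\,R\,d\sigma_{\mathbb S^2}dR$. For $\alpha\in\mathbb R$ let $\partial_R^\alpha f=R^{-\alpha}\partial_R(R^\alpha f)$, in the weak sense: $w=\partial_R^\alpha f$ if $\langle w,v\rangle=-\langle f,\partial_R^{1-\alpha}v\rangle$ for all $v\in C_c^\infty(\Sigma)$. Let $\underline H^1$ be the Hilbert space of all $f$ with $R^{-1}f,\ \partial_Rf,\ R^{-1}\nabla_{\mathbb S^2}f\in \underline L^2$ (weak derivatives), with $$\|f\|_{\underline H^1}^2=\int_\Sigma\big(R^{-2}|f|^2+|\partial_Rf|^2+R^{-2}|\nabla_{\mathbb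 S^2}f|^2\big)R\,d\sigma_{\mathbb S^2}dR ,$$ and let $\underline H^{-1}$ be the space of bounded conjugate-linear functionals on $\underline H^1$, with the dual norm. For $f,w\in\underline H^1$ let $$B[f,w]=\int_\Sigma\big(\partial_R^{\alpha_0}f\;\overline{\partial_R^{\alpha_0}w}+R^{-2}\,\nabla_{\mathbb S^2}f\cdot\overline{\nabla_{\mathbb S^2}w}\big)R\,d\sigma_{\mathbb S^2}dR .$$ Let $H^1_{\rm data}=\underline H^1\times\underline L^2$ with $\|(\Phi_0,\dot\Phi_0)\|_{H^1_{\rm data}}^2=\|\Phi_0\|_{\underline H^1}^2+\|\dot\Phi_0\|_{\underline L^2}^2$. Let $H^1_{\rm sol}$ be the space of all $\Phi\in L^\infty([-1,0];\underline H^1)$ whose weak time derivatives satisfy $\partial_T\Phi\in L^\infty([-1,0];\underline L^2)$ and $\partial_T^2\Phi\in L^\infty([-1,0];\underline H^{-1})$, where elements of $\underline L^2$ act on the dense subspace $\underline H^1\cap \underline L^2$ of $\underline H^1$ through $\langle\cdot,\cdot\rangle$; its norm is $$\|\Phi\|_{H^1_{\rm sol}}=\operatorname*{ess\,sup}_{T\in[-1,0]}\big[\|\Phi(T)\|_{\underline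 H^1}+\|\partial_T\Phi(T)\|_{\underline L^2}+\|\partial_T^2\Phi(T)\|_{\underline H^{-1}}\big].$$ A weak solution of the twisted Klein–Gordon equation $$\partial_T^2\Phi-\partial_R^{1-\alpha_0}\partial_R^{\alpha_0}\Phi+\frac{2iqe}{R}\,\partial_T\Phi=R^{-2}\Delta_{\mathbb S^2}\Phi$$ on $[-1,0]_T\times\Sigma$ (a region of $AdS_2\times\mathbb S^2$) with Dirichlet boundary conditions at $R=0$ and initial data $(\Phi_0,\dot\Phi_0)\in H^1_{\rm data}$ is a $\Phi\in H^1_{\rm sol}$ such that 1. for all $w\in\underline H^1$ and almost every $T\in[-1,0]$: $\ \langle\partial_T^2\Phi(T),w\rangle_{\underline H^{-1}/\underline H^1}+\langle 2iqe\,\partial_T\Phi(T),R^{-1}w\rangle+B[\Phi(T),w]=0$; 2. $(\Phi,\partial_T\Phi)|_{T=-1}=(\Phi_0,\dot\Phi_0)$, that is, as $T\to-1$ outside a null set, $\Phi(T)-\Phi_0\to0$ in $\underline L^2$ and $\partial_T\Phi(T)-\dot\Phi_0\to0$ in $\underline H^{-1}$, i.e. $\sup\{|\langle\partial_T\Phi(T)-\dot\Phi_0,w\rangle|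 : w\in\underline H^1\cap\underline L^2,\ \|w\|_{\underline H^1}\le1\}\to0$. **Proposition.** There is a constant $C>0$, depending only on $q$ and $e$, such that for every $(\Phi_0,\dot\Phi_0)\in H^1_{\rm data}$ there is a unique weak solution $\Phi\in H^1_{\rm sol}$ with initial data $(\Phi_0,\dot\Phi_0)$, and $$\|\Phi\|_{H^1_{\rm sol}}\le C\,\|(\Phi_0,\dot\Phi_0)\|_{H^1_{\rm data}}.$$ If moreover $\Phi_0\in\underline L^2$, then also $\Phi\in L^\infty([-1,0];\underline L^2)$, so that $\Phi\in W^{1,\infty}([-1,0];\underline L^2)$. -/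

import Mathlib

open MeasureTheory Set Filter Topology
open scoped Manifold ContDiff ENNReal ComplexConjugate

noncomputable section

namespace TwistedWave

/-! ### The time slices `Σ_T ≅ (0,∞)_R × S²` -/

/-- Euclidean three-space. -/
abbrev E3 : Type := EuclideanSpace ℝ (Fin 3)

instance factFinrankE3 : Fact (Module.finrank ℝ E3 = 2 + 1) := ⟨by simp⟩

/-- The unit round sphere, with the smooth structure of Mathlib. -/
abbrev S2 : Type := Metric.sphere (0 : E3) 1

/-- Points `(R, ω)`. Only `R > 0` matters: `sliceMeasure` is carried by `R > 0` and test
functions are supported there. All slices `Σ_T` are identified with this one space. -/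
abbrev Slice : Type := ℝ × S2

/-- The measure `R dR` on `(0,∞)`. -/
def radialMeasure : Measure ℝ :=
  (volume.restrict (Ioi (0 : ℝ))).withDensity fun R => ENNReal.ofReal R

/-- The measure `R dσ dR` on `(0,∞) × S²`, where `σ` is the surface measure of the sphere. -/
def sliceMeasure : Measure Slice := radialMeasure.prod (volume : Measure E3).toSphere

/-- The space `L²(Σ)` with respect to `R dσ dR`. -/
abbrev L2 : Type := Lp ℂ 2 sliceMeasure

/-- Square integrable fields with values in `ℂ³`; they contain the (complexified) fields tangent
to the spheres, the sphere being embedded in `ℝ³`. -/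
abbrev L2Field : Type := Lp (EuclideanSpace ℂ (Fin 3)) 2 sliceMeasure

/-- The inner product `⟨f, g⟩ = ∫ f \bar g R dσ dR` of `L²(Σ)` (Mathlib's inner product is
conjugate-linear in its first argument). -/
def l2Pairing (f g : L2) : ℂ := inner ℂ g f

/-! ### Differential operators on smooth functions -/

/-- Smooth functions `Σ → ℂ` with compact support in `(0,∞) × S²`. -/
def IsTest (v : Slice → ℂ) : Prop :=
  ContMDiff (𝓘(ℝ, ℝ).prod (𝓡 2)) 𝓘(ℝ, ℂ) ∞ v ∧ HasCompactSupport v ∧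
    tsupport v ⊆ Ioi 0 ×ˢ univ

/-- Smooth fields `X` on `(0,∞) × S²` with compact support, tangent to the spheres. -/
def IsTestField (X : Slice → EuclideanSpace ℂ (Fin 3)) : Prop :=
  ContMDiff (𝓘(ℝ, ℝ).prod (𝓡 2)) 𝓘(ℝ, EuclideanSpace ℂ (Fin 3)) ∞ X ∧ HasCompactSupport X ∧
    tsupport X ⊆ Ioi 0 ×ˢ univ ∧ ∀ p, ∑ k, ((p.2 : E3) k : ℂ) * X p k = 0

/-- The twisted derivative `R^{-α} ∂_R (R^α v)`. -/
def twistedDeriv (α : ℝ) (v : Slice → ℂ) (p : Slice) : ℂ :=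
  ((p.1 ^ (-α) : ℝ) : ℂ) * deriv (fun R : ℝ => ((R ^ α : ℝ) : ℂ) * v (R, p.2)) p.1

/-- The radial projection `x ↦ x / |x|` onto the sphere (with a junk value at `x = 0`). -/
def radialProj (x : E3) : S2 :=
  if h : x ≠ 0 then ⟨‖x‖⁻¹ • x, by simp [norm_smul, h]⟩
  else ⟨EuclideanSpace.single 0 1, by simp⟩

/-- The divergence on the unit round sphere of a field tangent to the spheres, as the trace of its
tangential derivative in `ℝ³`. The tangential derivative of a function on the sphere is the
derivative of its extension that is constant along rays. -/
def sphereDiv (X : Slice → EuclideanSpace ℂ (Fin 3)) (p : Slice) : ℂ :=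
  ∑ k, fderiv ℝ (fun x : E3 => X (p.1, radialProj x) k) (p.2 : E3) (EuclideanSpace.single k 1)

/-! ### Weak derivatives -/

/-- `w` is the weak `α`-twisted derivative of `f`:
`∫ w \bar v R dσ dR = - ∫ f ∂_R^{1-α} \bar v R dσ dR` for all `v ∈ C_c^∞(Σ)`. -/
def IsWeakTwistedDeriv (α : ℝ) (f w : Slice → ℂ) : Prop :=
  ∀ v, IsTest v → ∫ p, w p * conj (v p) ∂sliceMeasure =
    -∫ p, f p * conj (twistedDeriv (1 - α) v p) ∂sliceMeasure

/-- `W` is the weak gradient of `f` along the unit round spheres `S²`: it is tangent to the spheres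
and `∫ W · \bar X = - ∫ f div_{S²} \bar X` for all smooth compactly supported tangential `X`. -/
def IsWeakSphereGrad (f : Slice → ℂ) (W : Slice → EuclideanSpace ℂ (Fin 3)) : Prop :=
  (∀ᵐ p ∂sliceMeasure, ∑ k, ((p.2 : E3) k : ℂ) * W p k = 0) ∧
  ∀ X, IsTestField X → ∫ p, ∑ k, W p k * conj (X p k) ∂sliceMeasure =
    -∫ p, f p * conj (sphereDiv X p) ∂sliceMeasure

/-! ### Auxiliary facts: products of square integrable functions with test functions -/

lemma contMDiffAt_radialProj {x : E3} (hx : x ≠ 0) :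
    ContMDiffAt 𝓘(ℝ, E3) (𝓡 2) ∞ radialProj x := by
  let U : TopologicalSpace.Opens E3 := ⟨{0}ᶜ, isOpen_compl_singleton⟩
  have h1 : ContMDiff 𝓘(ℝ, E3) 𝓘(ℝ, E3) ∞ (fun y : U => ‖(y : E3)‖⁻¹ • (y : E3)) := by
    intro y
    have hy : (y : E3) ≠ 0 := y.2
    have : ContMDiffAt 𝓘(ℝ, E3) 𝓘(ℝ, E3) ∞ (fun z : E3 => ‖z‖⁻¹ • z) (y : E3) := by
      apply ContDiffAt.contMDiffAt
      exact ((contDiffAt_norm ℝ hy).inv (norm_ne_zero_iff.2 hy)).smul contDiffAt_id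
    exact contMDiffAt_subtype_iff.2 this
  have h2 : ∀ y : U, ‖(y : E3)‖⁻¹ • (y : E3) ∈ Metric.sphere (0 : E3) 1 := by
    intro y
    have hy : (y : E3) ≠ 0 := y.2
    simp [norm_smul, hy]
  have h3 := ContMDiff.codRestrict_sphere (n := 2) h1 h2
  have h4 : (fun y : U => radialProj (y : E3)) = codRestrict _ _ h2 := by
    funext y
    have hy : (y : E3) ≠ 0 := y.2
    apply Subtype.ext
    simp [radialProj, hy]
  rw [← h4] at h3
  exact contMDiffAt_subtype_iff.1 (h3 ⟨x, hx⟩)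

lemma radialProj_coe (z : S2) : radialProj (z : E3) = z := by
  have h : ‖(z : E3)‖ = 1 := norm_eq_of_mem_sphere z
  have h0 : (z : E3) ≠ 0 := by
    intro h'
    simp [h'] at h
  apply Subtype.ext
  simp [radialProj, h0, h]

/-- The extension of a smooth function, constant along rays in the sphere variable, is smooth. -/
lemma contDiffAt_extend {F : Type*} [NormedAddCommGroup F] [NormedSpace ℝ F] {v : Slice → F}
    (hv : ContMDiff (𝓘(ℝ, ℝ).prod (𝓡 2)) 𝓘(ℝ, F) ∞ v) {q : ℝ × E3} (hq : q.2 ≠ 0) :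
    ContDiffAt ℝ ∞ (fun q : ℝ × E3 => v (q.1, radialProj q.2)) q := by
  apply ContMDiffAt.contDiffAt
  have h1 : ContMDiffAt 𝓘(ℝ, ℝ × E3) 𝓘(ℝ, ℝ) ∞ (Prod.fst : ℝ × E3 → ℝ) q :=
    contDiffAt_fst.contMDiffAt
  have h2 : ContMDiffAt 𝓘(ℝ, ℝ × E3) 𝓘(ℝ, E3) ∞ (Prod.snd : ℝ × E3 → E3) q :=
    contDiffAt_snd.contMDiffAt
  have h3 : ContMDiffAt 𝓘(ℝ, ℝ × E3) (𝓡 2) ∞ (fun q : ℝ × E3 => radialProj q.2) q :=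
    ContMDiffAt.comp q (contMDiffAt_radialProj hq) h2
  exact ContMDiffAt.comp q (hv.contMDiffAt) (h1.prodMk h3)

lemma coe_ne_zero (z : S2) : (z : E3) ≠ 0 := by
  intro h'
  have h : ‖(z : E3)‖ = 1 := norm_eq_of_mem_sphere z
  simp [h'] at h

lemma hasDerivAt_radial {v : Slice → ℂ}
    (hv : ContMDiff (𝓘(ℝ, ℝ).prod (𝓡 2)) 𝓘(ℝ, ℂ) ∞ v) (p : Slice) :
    HasDerivAt (fun R : ℝ => v (R, p.2))
      (fderiv ℝ (fun q : ℝ × E3 => v (q.1, radialProj q.2)) (p.1, (p.2 : E3)) (1, 0)) p.1 := by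
  have h := ((contDiffAt_extend hv (q := (p.1, (p.2 : E3))) (coe_ne_zero p.2)).differentiableAt
    (by simp)).hasFDerivAt
  have h2 : HasDerivAt (fun R : ℝ => ((R, (p.2 : E3)) : ℝ × E3)) (1, 0) p.1 :=
    (hasDerivAt_id p.1).prodMk (hasDerivAt_const p.1 (p.2 : E3))
  have h3 := h.comp_hasDerivAt p.1 h2
  simpa [Function.comp_def, radialProj_coe] using h3

lemma continuous_fderiv_extend {F : Type*} [NormedAddCommGroup F] [NormedSpace ℝ F]
    {v : Slice → F} (hv : ContMDiff (𝓘(ℝ, ℝ).prod (𝓡 2)) 𝓘(ℝ, F) ∞ v) :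
    Continuous fun p : Slice =>
      fderiv ℝ (fun q : ℝ × E3 => v (q.1, radialProj q.2)) (p.1, (p.2 : E3)) := by
  rw [continuous_iff_continuousAt]
  intro p
  have h := ((contDiffAt_extend hv (q := (p.1, (p.2 : E3))) (coe_ne_zero p.2)).fderiv_right
    (m := 0) (by simp)).continuousAt
  have h2 : Continuous fun p : Slice => ((p.1, (p.2 : E3)) : ℝ × E3) := by fun_prop
  exact ContinuousAt.comp (f := fun p : Slice => ((p.1, (p.2 : E3)) : ℝ × E3)) h h2.continuousAt

lemma continuous_radialDeriv {v : Slice → ℂ}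
    (hv : ContMDiff (𝓘(ℝ, ℝ).prod (𝓡 2)) 𝓘(ℝ, ℂ) ∞ v) :
    Continuous fun p : Slice => deriv (fun R : ℝ => v (R, p.2)) p.1 := by
  have : (fun p : Slice => deriv (fun R : ℝ => v (R, p.2)) p.1) = fun p =>
      fderiv ℝ (fun q : ℝ × E3 => v (q.1, radialProj q.2)) (p.1, (p.2 : E3)) (1, 0) :=
    funext fun p => (hasDerivAt_radial hv p).deriv
  rw [this]
  exact (continuous_fderiv_extend hv).clm_apply continuous_const

/-- For `R > 0`, the twisted derivative is `∂_R v + (α / R) v`. -/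
lemma twistedDeriv_eq {v : Slice → ℂ}
    (hv : ContMDiff (𝓘(ℝ, ℝ).prod (𝓡 2)) 𝓘(ℝ, ℂ) ∞ v) (α : ℝ) {p : Slice} (hp : 0 < p.1) :
    twistedDeriv α v p = deriv (fun R : ℝ => v (R, p.2)) p.1 + ((α / p.1 : ℝ) : ℂ) * v p := by
  have h1 := hasDerivAt_radial hv p
  have h2 : HasDerivAt (fun R : ℝ => ((R ^ α : ℝ) : ℂ)) ((α * p.1 ^ (α - 1) : ℝ) : ℂ) p.1 :=
    (Real.hasDerivAt_rpow_const (Or.inl hp.ne')).ofReal_comp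
  have h3 := h2.mul h1
  have h4 : p.1 ^ (-α) * p.1 ^ α = 1 := by
    rw [← Real.rpow_add hp]; simp
  have h5 : p.1 ^ (-α) * (α * p.1 ^ (α - 1)) = α / p.1 := by
    rw [Real.rpow_sub_one hp.ne']
    calc p.1 ^ (-α) * (α * (p.1 ^ α / p.1)) = (p.1 ^ (-α) * p.1 ^ α) * (α / p.1) := by ring
      _ = α / p.1 := by rw [h4, one_mul]
  have h4' : ((p.1 ^ (-α) : ℝ) : ℂ) * ((p.1 ^ α : ℝ) : ℂ) = 1 := by exact_mod_cast h4
  have h6 : twistedDeriv α v p = ((p.1 ^ (-α) : ℝ) : ℂ) *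
      (((α * p.1 ^ (α - 1) : ℝ) : ℂ) * v (p.1, p.2) + ((p.1 ^ α : ℝ) : ℂ) *
        deriv (fun R : ℝ => v (R, p.2)) p.1) := by
    rw [twistedDeriv, h1.deriv]
    congr 1
    exact h3.deriv
  rw [h6, ← h5, Complex.ofReal_mul (p.1 ^ (-α))]
  calc _ = ((p.1 ^ (-α) : ℝ) : ℂ) * ((α * p.1 ^ (α - 1) : ℝ) : ℂ) * v (p.1, p.2)
        + (((p.1 ^ (-α) : ℝ) : ℂ) * ((p.1 ^ α : ℝ) : ℂ)) *
          deriv (fun R : ℝ => v (R, p.2)) p.1 := by ring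
    _ = _ := by rw [h4', one_mul, add_comm]

instance isFiniteMeasureOnCompacts_radialMeasure : IsFiniteMeasureOnCompacts radialMeasure := by
  constructor
  intro K hK
  obtain ⟨M, hM⟩ := hK.isBounded.subset_closedBall 0
  rw [radialMeasure, withDensity_apply _ hK.measurableSet]
  calc ∫⁻ R in K, ENNReal.ofReal R ∂(volume.restrict (Ioi 0))
      ≤ ∫⁻ _ in K, ENNReal.ofReal M ∂(volume.restrict (Ioi 0)) := by
        apply setLIntegral_mono' hK.measurableSet
        intro R hR
        apply ENNReal.ofReal_le_ofReal
        have := hM hR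
        rw [Metric.mem_closedBall, dist_zero_right] at this
        exact (le_abs_self R).trans this
    _ = ENNReal.ofReal M * (volume.restrict (Ioi 0)) K := by simp
    _ < ⊤ := by
        apply ENNReal.mul_lt_top ENNReal.ofReal_lt_top
        exact hK.measure_lt_top

instance sFinite_radialMeasure : SFinite radialMeasure := by
  unfold radialMeasure; infer_instance

instance sFinite_sliceMeasure : SFinite sliceMeasure := by
  unfold sliceMeasure; infer_instance

instance isFiniteMeasureOnCompacts_sliceMeasure : IsFiniteMeasureOnCompacts sliceMeasure := by
  unfold sliceMeasure; infer_instance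

lemma ae_radialMeasure_pos : ∀ᵐ R ∂radialMeasure, 0 < R := by
  have h : radialMeasure ≪ volume.restrict (Ioi (0 : ℝ)) := withDensity_absolutelyContinuous _ _
  exact h.ae_le (ae_restrict_mem measurableSet_Ioi)

lemma ae_pos : ∀ᵐ p ∂sliceMeasure, 0 < p.1 :=
  Measure.quasiMeasurePreserving_fst.ae ae_radialMeasure_pos

/-- A function that is continuous on `R > 0` and vanishes where a test function does is square
integrable. -/
lemma memLp_of_tsupport {F : Type*} [NormedAddCommGroup F] {G : Type*} [Zero G] {v : Slice → G}
    (hc : HasCompactSupport v) (hs : tsupport v ⊆ Ioi 0 ×ˢ univ) {g : Slice → F}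
    (hg : ∀ p : Slice, 0 < p.1 → ContinuousAt g p) (h0 : ∀ p ∉ tsupport v, g p = 0) :
    MemLp g 2 sliceMeasure := by
  have hsub : tsupport g ⊆ tsupport v :=
    closure_minimal (fun p hp => by_contra fun h => hp (h0 p h)) (isClosed_tsupport v)
  have hcont : Continuous g := continuous_of_tsupport fun p hp => hg p (hs (hsub hp)).1
  have hcomp : HasCompactSupport g := hc.of_isClosed_subset (isClosed_tsupport g) hsub
  exact hcont.memLp_of_hasCompactSupport hcomp

lemma IsTest.memLp {v : Slice → ℂ} (hv : IsTest v) : MemLp v 2 sliceMeasure :=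
  hv.1.continuous.memLp_of_hasCompactSupport hv.2.1

lemma IsTest.integrable_mul {v : Slice → ℂ} (hv : IsTest v) (w : L2) :
    Integrable (fun p => w p * conj (v p)) sliceMeasure :=
  (Lp.memLp w).integrable_mul hv.memLp.star

lemma IsTest.deriv_eq_zero {v : Slice → ℂ} {p : Slice} (hp : p ∉ tsupport v) :
    deriv (fun R : ℝ => v (R, p.2)) p.1 = 0 := by
  have h : v =ᶠ[𝓝 p] 0 := notMem_tsupport_iff_eventuallyEq.1 hp
  have h2 : Tendsto (fun R : ℝ => ((R, p.2) : Slice)) (𝓝 p.1) (𝓝 p) := by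
    have : Continuous (fun R : ℝ => ((R, p.2) : Slice)) := by fun_prop
    exact this.tendsto p.1
  have h3 : (fun R : ℝ => v (R, p.2)) =ᶠ[𝓝 p.1] fun _ => 0 := h2.eventually h
  rw [h3.deriv_eq]; simp

lemma IsTest.integrable_twisted {v : Slice → ℂ} (hv : IsTest v) (α : ℝ) (a : L2) :
    Integrable (fun p => (p.1 : ℂ) * a p * conj (twistedDeriv α v p)) sliceMeasure := by
  set g : Slice → ℂ := fun p =>
    (p.1 : ℂ) * (deriv (fun R : ℝ => v (R, p.2)) p.1 + ((α / p.1 : ℝ) : ℂ) * v p) with hg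
  have hmem : MemLp g 2 sliceMeasure := by
    refine memLp_of_tsupport hv.2.1 hv.2.2 (fun p hp => ?_) (fun p hp => ?_)
    · have h1 := (continuous_radialDeriv hv.1).continuousAt (x := p)
      have h2 := hv.1.continuous.continuousAt (x := p)
      have h3 : ContinuousAt (fun p : Slice => ((α / p.1 : ℝ) : ℂ)) p :=
        Complex.continuous_ofReal.continuousAt.comp
          (continuousAt_const.div continuousAt_fst hp.ne')
      have h4 : ContinuousAt (fun p : Slice => (p.1 : ℂ)) p :=
        Complex.continuous_ofReal.continuousAt.comp continuousAt_fst
      exact h4.mul (h1.add (h3.mul h2))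
    · have h1 : v p = 0 := image_eq_zero_of_notMem_tsupport hp
      simp [hg, h1, IsTest.deriv_eq_zero hp]
  refine ((Lp.memLp a).integrable_mul hmem.star).congr ?_
  filter_upwards [ae_pos] with p hp
  simp only [Pi.mul_apply, Pi.star_apply, hg, twistedDeriv_eq hv.1 α hp, RCLike.star_def, map_mul,
    Complex.conj_ofReal]
  ring

lemma continuous_sphereDiv {X : Slice → EuclideanSpace ℂ (Fin 3)} (hX : IsTestField X) :
    Continuous (sphereDiv X) := by
  unfold sphereDiv
  refine continuous_finsetSum _ fun k _ => ?_
  have hk : ContMDiff (𝓘(ℝ, ℝ).prod (𝓡 2)) 𝓘(ℝ, ℂ) ∞ fun p => X p k := by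
    have : ContDiff ℝ ∞ fun y : EuclideanSpace ℂ (Fin 3) => y k := by fun_prop
    exact this.contMDiff.comp hX.1
  have h := continuous_fderiv_extend hk
  have : (fun p : Slice => fderiv ℝ (fun x : E3 => X (p.1, radialProj x) k) (p.2 : E3)
      (EuclideanSpace.single k 1)) = fun p =>
      fderiv ℝ (fun q : ℝ × E3 => X (q.1, radialProj q.2) k) (p.1, (p.2 : E3))
        (0, EuclideanSpace.single k 1) := by
    funext p
    have h1 := ((contDiffAt_extend hk (q := (p.1, (p.2 : E3))) (coe_ne_zero p.2)).differentiableAt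
      (by simp)).hasFDerivAt
    have h2 : HasFDerivAt (fun x : E3 => ((p.1, x) : ℝ × E3)) (ContinuousLinearMap.inr ℝ ℝ E3)
        (p.2 : E3) := hasFDerivAt_prodMk_right p.1 (p.2 : E3)
    have h3 := HasFDerivAt.comp (p.2 : E3) h1 h2
    have h4 := h3.fderiv
    simp only [Function.comp_def] at h4
    rw [h4]
    simp
  rw [this]
  exact h.clm_apply continuous_const

lemma sphereDiv_eq_zero {X : Slice → EuclideanSpace ℂ (Fin 3)} {p : Slice}
    (hp : p ∉ tsupport X) : sphereDiv X p = 0 := by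
  have h : X =ᶠ[𝓝 p] 0 := notMem_tsupport_iff_eventuallyEq.1 hp
  refine Finset.sum_eq_zero fun k _ => ?_
  have h2 : Tendsto (fun x : E3 => ((p.1, radialProj x) : Slice)) (𝓝 (p.2 : E3)) (𝓝 p) := by
    have h3 : ContinuousAt (fun x : E3 => ((p.1, radialProj x) : Slice)) (p.2 : E3) :=
      continuousAt_const.prodMk (contMDiffAt_radialProj (coe_ne_zero p.2)).continuousAt
    have h4 := h3.tendsto
    rwa [radialProj_coe] at h4
  have h3 : (fun x : E3 => X (p.1, radialProj x) k) =ᶠ[𝓝 (p.2 : E3)] fun _ => 0 := by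
    filter_upwards [h2.eventually h] with x hx
    simp [hx]
  rw [h3.fderiv_eq]; simp

lemma IsTestField.integrable_sphereDiv {X : Slice → EuclideanSpace ℂ (Fin 3)}
    (hX : IsTestField X) (a : L2) :
    Integrable (fun p => (p.1 : ℂ) * a p * conj (sphereDiv X p)) sliceMeasure := by
  have hmem : MemLp (fun p : Slice => (p.1 : ℂ) * sphereDiv X p) 2 sliceMeasure := by
    refine memLp_of_tsupport hX.2.1 hX.2.2.1 (fun p _ => ?_) (fun p hp => ?_)
    · have h4 : ContinuousAt (fun p : Slice => (p.1 : ℂ)) p :=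
        Complex.continuous_ofReal.continuousAt.comp continuousAt_fst
      exact h4.mul (continuous_sphereDiv hX).continuousAt
    · simp [sphereDiv_eq_zero hp]
  refine ((Lp.memLp a).integrable_mul hmem.star).congr (Eventually.of_forall fun p => ?_)
  simp only [Pi.mul_apply, Pi.star_apply, RCLike.star_def, map_mul, Complex.conj_ofReal]
  ring

lemma IsTestField.integrable_mul {X : Slice → EuclideanSpace ℂ (Fin 3)}
    (hX : IsTestField X) (G : L2Field) :
    Integrable (fun p => ∑ k, ((p.1 : ℂ) • G p) k * conj (X p k)) sliceMeasure := by
  refine integrable_finsetSum _ fun k _ => ?_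
  have h1 : MemLp (fun p => G p k) 2 sliceMeasure := by
    have := (EuclideanSpace.proj k : EuclideanSpace ℂ (Fin 3) →L[ℂ] ℂ).comp_memLp' (Lp.memLp G)
    exact this
  have hmem : MemLp (fun p : Slice => (p.1 : ℂ) * X p k) 2 sliceMeasure := by
    refine memLp_of_tsupport hX.2.1 hX.2.2.1 (fun p _ => ?_) (fun p hp => ?_)
    · have h4 : ContinuousAt (fun p : Slice => (p.1 : ℂ)) p :=
        Complex.continuous_ofReal.continuousAt.comp continuousAt_fst
      have h5 : Continuous fun y : EuclideanSpace ℂ (Fin 3) => y k := by fun_prop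
      exact h4.mul (h5.comp hX.1.continuous).continuousAt
    · simp [image_eq_zero_of_notMem_tsupport hp]
  refine (h1.integrable_mul hmem.star).congr (Eventually.of_forall fun p => ?_)
  simp only [Pi.mul_apply, Pi.star_apply, RCLike.star_def, map_mul, Complex.conj_ofReal,
    PiLp.smul_apply, smul_eq_mul]
  ring

/-! ### The twisted Sobolev spaces -/

/-- The Hilbert space of triples `(a, g, G)`, with squared norm `‖a‖² + ‖g‖² + ‖G‖²`. -/
abbrev Triple : Type := WithLp 2 (L2 × WithLp 2 (L2 × L2Field))

/-- The space `H¹_α(Σ)` of all `f` with `R⁻¹ f`, `∂_R^α f` and `(1/R) ∇_{S²} f` in `L²(Σ)`. An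
element is recorded as the triple `(R⁻¹ f, ∂_R^α f, (1/R) ∇_{S²} f)`, whose last two entries are
determined by the first, so that the norm is
`‖f‖² = ∫ (R⁻² |f|² + |∂_R^α f|² + |(1/R) ∇_{S²} f|²) R dσ dR`. -/
def twistedH1 (α : ℝ) : Submodule ℂ Triple where
  carrier := {u | IsWeakTwistedDeriv α (fun p => (p.1 : ℂ) * u.fst p) u.snd.fst ∧
    IsWeakSphereGrad (fun p => (p.1 : ℂ) * u.fst p) (fun p => (p.1 : ℂ) • u.snd.snd p)}
  zero_mem' := by
    have h1 : ∀ᵐ p ∂sliceMeasure, (0 : Triple).fst p = 0 := Lp.coeFn_zero _ _ _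
    have h2 : ∀ᵐ p ∂sliceMeasure, (0 : Triple).snd.fst p = 0 := Lp.coeFn_zero _ _ _
    have h3 : ∀ᵐ p ∂sliceMeasure, (0 : Triple).snd.snd p = 0 := Lp.coeFn_zero _ _ _
    refine ⟨fun v _ => ?_, ?_, fun X _ => ?_⟩
    · rw [integral_eq_zero_of_ae, integral_eq_zero_of_ae, neg_zero]
      · filter_upwards [h1] with p hp
        simp only [hp, mul_zero, zero_mul, Pi.zero_apply]
      · filter_upwards [h2] with p hp
        simp only [hp, zero_mul, Pi.zero_apply]
    · filter_upwards [h3] with p hp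
      simp only [hp, smul_zero, PiLp.zero_apply, mul_zero, Finset.sum_const_zero]
    · rw [integral_eq_zero_of_ae, integral_eq_zero_of_ae, neg_zero]
      · filter_upwards [h1] with p hp
        simp only [hp, mul_zero, zero_mul, Pi.zero_apply]
      · filter_upwards [h3] with p hp
        simp only [hp, smul_zero, PiLp.zero_apply, zero_mul, Finset.sum_const_zero, Pi.zero_apply]
  add_mem' := by
    rintro u w ⟨hu1, hu2, hu3⟩ ⟨hw1, hw2, hw3⟩
    have h1 : ∀ᵐ p ∂sliceMeasure, (u + w).fst p = u.fst p + w.fst p := Lp.coeFn_add _ _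
    have h2 : ∀ᵐ p ∂sliceMeasure, (u + w).snd.fst p = u.snd.fst p + w.snd.fst p :=
      Lp.coeFn_add _ _
    have h3 : ∀ᵐ p ∂sliceMeasure, (u + w).snd.snd p = u.snd.snd p + w.snd.snd p :=
      Lp.coeFn_add _ _
    refine ⟨fun v hv => ?_, ?_, fun X hX => ?_⟩
    · calc _ = ∫ p, (u.snd.fst p * conj (v p) + w.snd.fst p * conj (v p)) ∂sliceMeasure := by
            apply integral_congr_ae
            filter_upwards [h2] with p hp
            rw [hp]; ring
        _ = -∫ p, ((p.1 : ℂ) * u.fst p * conj (twistedDeriv (1 - α) v p) +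
              (p.1 : ℂ) * w.fst p * conj (twistedDeriv (1 - α) v p)) ∂sliceMeasure := by
            rw [integral_add (hv.integrable_mul _) (hv.integrable_mul _),
              integral_add (hv.integrable_twisted _ _) (hv.integrable_twisted _ _),
              hu1 v hv, hw1 v hv, neg_add]
        _ = _ := by
            congr 1
            apply integral_congr_ae
            filter_upwards [h1] with p hp
            rw [hp]; ring
    · filter_upwards [h3, hu2, hw2] with p hp hup hwp
      simp only [hp, smul_add, PiLp.add_apply, mul_add, Finset.sum_add_distrib, hup, hwp, add_zero]
    · calc _ = ∫ p, (∑ k, ((p.1 : ℂ) • u.snd.snd p) k * conj (X p k) +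
              ∑ k, ((p.1 : ℂ) • w.snd.snd p) k * conj (X p k)) ∂sliceMeasure := by
            apply integral_congr_ae
            filter_upwards [h3] with p hp
            simp only [hp, smul_add, PiLp.add_apply, add_mul, Finset.sum_add_distrib]
        _ = -∫ p, ((p.1 : ℂ) * u.fst p * conj (sphereDiv X p) +
              (p.1 : ℂ) * w.fst p * conj (sphereDiv X p)) ∂sliceMeasure := by
            rw [integral_add (hX.integrable_mul _) (hX.integrable_mul _),
              integral_add (hX.integrable_sphereDiv _) (hX.integrable_sphereDiv _),
              hu3 X hX, hw3 X hX, neg_add]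
        _ = _ := by
            congr 1
            apply integral_congr_ae
            filter_upwards [h1] with p hp
            rw [hp]; ring
  smul_mem' := by
    rintro c u ⟨hu1, hu2, hu3⟩
    have h1 : ∀ᵐ p ∂sliceMeasure, (c • u).fst p = c * u.fst p := Lp.coeFn_smul _ _
    have h2 : ∀ᵐ p ∂sliceMeasure, (c • u).snd.fst p = c * u.snd.fst p := Lp.coeFn_smul _ _
    have h3 : ∀ᵐ p ∂sliceMeasure, (c • u).snd.snd p = c • u.snd.snd p := Lp.coeFn_smul _ _
    refine ⟨fun v hv => ?_, ?_, fun X hX => ?_⟩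
    · calc _ = ∫ p, c * (u.snd.fst p * conj (v p)) ∂sliceMeasure := by
            apply integral_congr_ae
            filter_upwards [h2] with p hp
            rw [hp]; ring
        _ = -∫ p, c * ((p.1 : ℂ) * u.fst p * conj (twistedDeriv (1 - α) v p)) ∂sliceMeasure := by
            rw [integral_const_mul, integral_const_mul, hu1 v hv, mul_neg]
        _ = _ := by
            congr 1
            apply integral_congr_ae
            filter_upwards [h1] with p hp
            rw [hp]; ring
    · filter_upwards [h3, hu2] with p hp hup
      have : ∀ k, ((p.2 : E3) k : ℂ) * ((p.1 : ℂ) • c • u.snd.snd p) k =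
          c * (((p.2 : E3) k : ℂ) * ((p.1 : ℂ) • u.snd.snd p) k) := by
        intro k
        simp only [PiLp.smul_apply, smul_eq_mul]; ring
      simp only [hp, this, ← Finset.mul_sum, hup, mul_zero]
    · calc _ = ∫ p, c * ∑ k, ((p.1 : ℂ) • u.snd.snd p) k * conj (X p k) ∂sliceMeasure := by
            apply integral_congr_ae
            filter_upwards [h3] with p hp
            rw [hp, Finset.mul_sum]
            refine Finset.sum_congr rfl fun k _ => ?_
            simp only [PiLp.smul_apply, smul_eq_mul]; ring
        _ = -∫ p, c * ((p.1 : ℂ) * u.fst p * conj (sphereDiv X p)) ∂sliceMeasure := by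
            rw [integral_const_mul, integral_const_mul, hu3 X hX, mul_neg]
        _ = _ := by
            congr 1
            apply integral_congr_ae
            filter_upwards [h1] with p hp
            rw [hp]; ring

/-- The space `H¹(Σ) = H¹_0(Σ)`. -/
abbrev H1 : Type := twistedH1 0

/-- The function `R⁻¹ f` for `f ∈ H¹(Σ)`. -/
def H1.invR (f : H1) : L2 := f.1.fst

/-- The derivative `∂_R f` of `f ∈ H¹(Σ)`. -/
def H1.radial (f : H1) : L2 := f.1.snd.fst

/-- The angular gradient `(1/R) ∇_{S²} f` of `f ∈ H¹(Σ)`. -/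
def H1.angular (f : H1) : L2Field := f.1.snd.snd

/-- The function `f` underlying an element of `H¹(Σ)`. -/
def H1.toFun (f : H1) (p : Slice) : ℂ := (p.1 : ℂ) * f.invR p

/-- The `α`-twisted derivative `∂_R^α f = ∂_R f + α R⁻¹ f ∈ L²(Σ)` of `f ∈ H¹(Σ)`. -/
def H1.twisted (α : ℝ) (f : H1) : L2 := f.radial + (α : ℂ) • f.invR

/-- `H1.twisted α f` is the weak `α`-twisted derivative of `f`. -/
theorem H1.isWeakTwistedDeriv_twisted (α : ℝ) (f : H1) :
    IsWeakTwistedDeriv α f.toFun (f.twisted α) := by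
  intro v hv
  have h0 : ∫ p, f.radial p * conj (v p) ∂sliceMeasure =
    -∫ p, f.toFun p * conj (twistedDeriv (1 - 0) v p) ∂sliceMeasure := f.2.1 v hv
  have h1 : ∀ᵐ p ∂sliceMeasure, f.twisted α p = f.radial p + (α : ℂ) * f.invR p := by
    filter_upwards [Lp.coeFn_add f.radial ((α : ℂ) • f.invR),
      Lp.coeFn_smul (α : ℂ) f.invR] with p hp hp'
    rw [H1.twisted, hp, Pi.add_apply, hp', Pi.smul_apply, smul_eq_mul]
  have hi : Integrable (fun p => f.toFun p * conj (twistedDeriv (1 - 0) v p)) sliceMeasure :=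
    hv.integrable_twisted _ _
  calc _ = ∫ p, (f.radial p * conj (v p) + (α : ℂ) * (f.invR p * conj (v p))) ∂sliceMeasure := by
        apply integral_congr_ae
        filter_upwards [h1] with p hp
        rw [hp]; ring
    _ = -∫ p, (f.toFun p * conj (twistedDeriv (1 - 0) v p) -
          (α : ℂ) * (f.invR p * conj (v p))) ∂sliceMeasure := by
        rw [integral_add (hv.integrable_mul _) ((hv.integrable_mul _).const_mul _),
          integral_sub hi ((hv.integrable_mul _).const_mul _), h0]
        ring
    _ = _ := by
        congr 1
        apply integral_congr_ae
        filter_upwards [ae_pos] with p hp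
        have hp' : (p.1 : ℂ) ≠ 0 := by exact_mod_cast hp.ne'
        rw [twistedDeriv_eq hv.1 _ hp, twistedDeriv_eq hv.1 _ hp]
        simp only [H1.toFun, map_add, map_mul, Complex.conj_ofReal]
        push_cast
        field_simp
        ring

/-- The dual space `H⁻¹(Σ)` of `H¹(Σ)`. Its elements `F` are conjugate-linear, so that the duality
bracket `⟨F, w⟩ = F w` extends `⟨F, w⟩ = ∫ F \bar w R dσ dR`. -/
abbrev Hm1 : Type := H1 →SL[starRingEnd ℂ] ℂ

/-- The form `B[f, w] = ∫ (∂_R^α f · ∂_R^α \bar w + R⁻² ∇_{S²} f · ∇_{S²} \bar w) R dσ dR`. -/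
def energyForm (α : ℝ) (f w : H1) : ℂ :=
  l2Pairing (f.twisted α) (w.twisted α) + inner ℂ w.angular f.angular

/-! ### The solution space -/

/-- Lebesgue measure on the time interval `[-1, 0]`. -/
def timeMeasure : Measure ℝ := volume.restrict (Icc (-1 : ℝ) 0)

/-- Smooth functions of time with compact support in `(-1, 0)`. -/
def IsTimeTest (η : ℝ → ℝ) : Prop :=
  ContDiff ℝ ∞ η ∧ HasCompactSupport η ∧ tsupport η ⊆ Ioo (-1) 0

/-- `∫ f \bar w R dσ dR` for functions `f`, `w` on the slice. -/
def slicePairing (f w : Slice → ℂ) : ℂ := ∫ p, f p * conj (w p) ∂sliceMeasure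

/-- An element of `H¹_sol`: a function `Φ ∈ L^∞([-1,0]; H¹(Σ))` whose weak time derivatives satisfy
`∂_T Φ ∈ L^∞([-1,0]; L²(Σ))` and `∂_T² Φ ∈ L^∞([-1,0]; H⁻¹(Σ))`. The weak derivatives are
recorded along with `Φ`, by which they are determined. Functions of time are identified when they
agree for almost every `T ∈ [-1,0]`. -/
@[ext]
structure H1Sol where
  /-- The function `Φ`. -/
  val : Lp H1 ⊤ timeMeasure
  /-- The derivative `∂_T Φ`. -/
  dt : Lp L2 ⊤ timeMeasure
  /-- The derivative `∂_T² Φ`. -/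
  dtt : Lp Hm1 ⊤ timeMeasure
  /-- `dt` is the weak derivative of `val`, in the sense of distributions on `(-1,0) × Σ`. -/
  hasWeakDeriv_val : ∀ η, IsTimeTest η → ∀ v, IsTest v →
    ∫ T, ((deriv η T : ℝ) : ℂ) * slicePairing (val T).toFun v ∂timeMeasure =
      -∫ T, (η T : ℂ) * slicePairing (dt T) v ∂timeMeasure
  /-- `dtt` is the weak derivative of `dt` with values in `H⁻¹(Σ)`: an element of `L²(Σ)` acts on
  the dense subspace `H¹(Σ) ∩ L²(Σ)` of `H¹(Σ)` by the inner product of `L²(Σ)`. -/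
  hasWeakDeriv_dt : ∀ η, IsTimeTest η → ∀ w : H1, MemLp w.toFun 2 sliceMeasure →
    ∫ T, ((deriv η T : ℝ) : ℂ) * slicePairing (dt T) w.toFun ∂timeMeasure =
      -∫ T, (η T : ℂ) * dtt T w ∂timeMeasure

/-- The norm of `H¹_sol`: the essential supremum over `T ∈ [-1,0]` of
`‖Φ(T)‖_{H¹} + ‖∂_T Φ(T)‖_{L²} + ‖∂_T² Φ(T)‖_{H⁻¹}`. -/
def H1Sol.norm (Φ : H1Sol) : ℝ≥0∞ :=
  essSup (fun T => ‖Φ.val T‖ₑ + ‖Φ.dt T‖ₑ + ‖Φ.dtt T‖ₑ) timeMeasure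

/-- The additional property `Φ ∈ L^∞([-1,0]; L²(Σ))` of an element `Φ` of `H¹_sol`. It is not part
of the norm of `H¹_sol`, and functions in `H¹(Σ)` need not lie in `L²(Σ)`. -/
def H1Sol.IsBoundedInL2 (Φ : H1Sol) : Prop :=
  ∃ Ψ : Lp L2 ⊤ timeMeasure, ∀ᵐ T ∂timeMeasure, Ψ T =ᵐ[sliceMeasure] (Φ.val T).toFun

/-- The norm of the initial data in `H¹_data = H¹(Σ) × L²(Σ)`. -/
def dataNorm (Φ₀ : H1) (Φ₁ : L2) : ℝ := Real.sqrt (‖Φ₀‖ ^ 2 + ‖Φ₁‖ ^ 2)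

/-- The filter of essential limits `T → -1` in `[-1,0]`: sets of the form
`{T ∈ [-1,0] | T close to -1}` up to null sets. -/
def initialTime : Filter ℝ := 𝓝 (-1) ⊓ ae timeMeasure

/-- Attainment of the initial data: `Φ(T) → Φ₀` in `L²(Σ)` and `∂_T Φ(T) → Φ₁` in `H⁻¹(Σ)` as
`T → -1` (essential limits, that is, limits of the continuous representatives). -/
def HasInitialData (Φ : H1Sol) (Φ₀ : H1) (Φ₁ : L2) : Prop :=
  Tendsto (fun T => eLpNorm (fun p => (Φ.val T).toFun p - Φ₀.toFun p) 2 sliceMeasure)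
    initialTime (𝓝 0) ∧
  ∀ ε > 0, ∀ᶠ T in initialTime, ∀ w : H1, MemLp w.toFun 2 sliceMeasure →
    ‖slicePairing (Φ.dt T - Φ₁ : L2) w.toFun‖ ≤ ε * ‖w‖

/-- The number `α₀ = √(1 - 4 (qe)²) / 2`. -/
def alphaZero (q e : ℝ) : ℝ := Real.sqrt (1 - 4 * (q * e) ^ 2) / 2

/-- Weak solutions, with Dirichlet boundary conditions at `R = 0` and initial data `(Φ₀, Φ₁)` at
`T = -1`, of
`∂_T² Φ - ∂_R^{1-α₀} ∂_R^{α₀} Φ + (2 i q e / R) ∂_T Φ = R⁻² Δ_{S²} Φ`: for all `w ∈ H¹(Σ)` and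
almost every `T ∈ [-1,0]`,
`⟨∂_T² Φ, w⟩ + ⟨2 i q e ∂_T Φ, R⁻¹ w⟩ + B[Φ, w] = 0`. -/
def IsWeakSolution (q e : ℝ) (Φ₀ : H1) (Φ₁ : L2) (Φ : H1Sol) : Prop :=
  (∀ w : H1, ∀ᵐ T ∂timeMeasure,
    Φ.dtt T w + l2Pairing ((2 * Complex.I * ((q * e : ℝ) : ℂ)) • Φ.dt T) w.invR +
      energyForm (alphaZero q e) (Φ.val T) w = 0) ∧
  HasInitialData Φ Φ₀ Φ₁

end TwistedWave

end

/-! The formal energy ‖∂_R^{α₀} Φ‖² + ‖R⁻¹ ∇Φ‖² + ‖∂_T Φ‖² is conserved: multiplication by R⁻¹ is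
symmetric, so the charge term contributes the real part of an imaginary number. The proof needs
three things: that this energy controls the H¹ norm, a construction of solutions in the energy
space, and a uniqueness argument for solutions of low regularity.

Coercivity. With a = R⁻¹ f, the derivative ∂_R f = ∂_R (R a) = a + R ∂_R a is the generator of the
unitary dilations a ↦ eˢ a(eˢ R, ω) of L²(R dR dσ), so Re ⟨R⁻¹ f, ∂_R f⟩ = 0
(`re_inner_eq_zero_of_isWeakTwistedDeriv`). Hence ‖∂_R^α f‖² = ‖∂_R f‖² + α² ‖R⁻¹ f‖²
(`H1.norm_twisted_sq`), and since α₀ > 0 the form B dominates α₀² ‖f‖² on H¹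
(`le_norm_energyMap_sq`). This is where |qe| < 1/2 enters.

Existence. H¹ is not contained in L², so the unknown is Φ - Φ₀, which lies in W = H¹ ∩ L²; W is the
closed subspace `H1L2` of H¹ × L². With i the energy map, the pair (i Φ, ∂_T Φ) solves a first order
system whose generator is treated as a linear relation (`waveRelation`). It is skew by the symmetry
of R⁻¹, and its resolvent exists by Lax-Milgram (`IsWaveSystem.exists_resolvent`). Yosida
approximation with Kōmura's estimate (`IsSkewRelation.exists_evolution`) gives a contractive
evolution that satisfies the equation tested against the relation. Contractivity is the energy
bound, and `accel` reads ∂_T² Φ off the equation.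

Uniqueness. The velocity of a weak solution is only in L² and cannot serve as a test function. The
difference of two solutions is therefore integrated twice in time: the velocity of the twice
integrated difference lies in W, its energy is constant and starts at zero
(`IsWaveSystem.wave_unique`). Weak time derivatives are first turned into primitives with the right
initial value (`ae_eq_add_integral_of_tendsto`, from du Bois-Reymond's lemma). -/

noncomputable section

namespace TwistedWave

/-! ### Skew linear relations and the evolutions they generate -/

section SkewRelation

variable {X : Type*} [NormedAddCommGroup X] [InnerProductSpace ℂ X]

/-- A linear relation `G` (the graph of a possibly multivalued, unbounded operator) that is
skew-symmetric and such that `1 - ε G` is surjective for all `ε > 0`. -/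
structure IsSkewRelation (G : Submodule ℂ (X × X)) : Prop where
  re_inner : ∀ p ∈ G, (inner ℂ p.1 p.2).re = 0
  exists_sub_smul : ∀ ε : ℝ, 0 < ε → ∀ f : X, ∃ p ∈ G, p.1 - (ε : ℂ) • p.2 = f

lemma re_inner_smul_self_right (r : ℝ) (x : X) : (inner ℂ x ((r : ℂ) • x)).re = r * ‖x‖ ^ 2 := by
  rw [inner_smul_right, Complex.re_ofReal_mul, inner_self_eq_norm_sq_to_K]
  norm_cast

namespace IsSkewRelation

variable {G : Submodule ℂ (X × X)}

/-- Polarization: skewness at p + r gives the real part, and replacing r by i r gives the imaginary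
part. -/
lemma inner_add_inner (hG : IsSkewRelation G) {p r : X × X} (hp : p ∈ G) (hr : r ∈ G) :
    inner ℂ p.1 r.2 + inner ℂ p.2 r.1 = 0 := by
  have key : ∀ s ∈ G, (inner ℂ p.1 s.2 + inner ℂ p.2 s.1 : ℂ).re = 0 := by
    intro s hs
    have h1 := hG.re_inner _ (G.add_mem hp hs)
    have h2 := hG.re_inner _ hp
    have h3 := hG.re_inner _ hs
    simp only [Prod.fst_add, Prod.snd_add, inner_add_left, inner_add_right, Complex.add_re] at h1
    have h4 : (inner ℂ p.2 s.1 : ℂ).re = (inner ℂ s.1 p.2).re := inner_re_symm (𝕜 := ℂ) _ _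
    rw [Complex.add_re, h4]
    linarith
  apply Complex.ext
  · exact key r hr
  · have h := key _ (G.smul_mem Complex.I hr)
    simp only [Prod.smul_fst, Prod.smul_snd, inner_smul_right, ← mul_add] at h
    simp only [Complex.mul_re, Complex.I_re, Complex.I_im, zero_mul, one_mul, zero_sub,
      neg_eq_zero] at h
    exact h

/-- The cross term vanishes by skewness. This Pythagorean identity makes 1 - ε G injective and
bounds (1 - ε G)⁻¹ by 1 and the Yosida approximation by ε⁻¹. -/
lemma norm_sq_sub_smul (hG : IsSkewRelation G) (ε : ℝ) {p : X × X} (hp : p ∈ G) :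
    ‖p.1 - (ε : ℂ) • p.2‖ ^ 2 = ‖p.1‖ ^ 2 + ε ^ 2 * ‖p.2‖ ^ 2 := by
  rw [@norm_sub_sq ℂ, inner_smul_right, norm_smul, mul_pow]
  have h : RCLike.re ((ε : ℂ) * inner ℂ p.1 p.2) = 0 := by
    have := hG.re_inner p hp
    simp [this]
  rw [h]
  simp

/-- The resolvent `P = (1 - ε G)⁻¹` and the Yosida approximation `A = G P` of a skew relation. -/
lemma exists_yosida (hG : IsSkewRelation G) {ε : ℝ} (hε : 0 < ε) :
    ∃ P A : X →L[ℂ] X, (∀ f, (P f, A f) ∈ G) ∧ (∀ f, P f - (ε : ℂ) • A f = f) ∧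
      (∀ f, ‖P f‖ ≤ ‖f‖) ∧ ∀ p ∈ G, A p.1 = P p.2 := by
  let T : G →ₗ[ℂ] X :=
    ((LinearMap.fst ℂ X X) - (ε : ℂ) • (LinearMap.snd ℂ X X)).comp G.subtype
  have hT : ∀ p : G, T p = p.1.1 - (ε : ℂ) • p.1.2 := fun p => rfl
  have hn : ∀ p : G, ‖T p‖ ^ 2 = ‖p.1.1‖ ^ 2 + ε ^ 2 * ‖p.1.2‖ ^ 2 := fun p => by
    rw [hT, hG.norm_sq_sub_smul ε p.2]
  have hinj : Function.Injective T := by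
    rw [injective_iff_map_eq_zero]
    intro p hp
    have h := hn p
    rw [hp, norm_zero] at h
    have h1 : ‖p.1.1‖ = 0 := by nlinarith [sq_nonneg ‖p.1.1‖, sq_nonneg (ε * ‖p.1.2‖)]
    have h2 : ε * ‖p.1.2‖ = 0 := by nlinarith [sq_nonneg ‖p.1.1‖, sq_nonneg (ε * ‖p.1.2‖)]
    have h3 : ‖p.1.2‖ = 0 := (mul_eq_zero.1 h2).resolve_left hε.ne'
    exact Subtype.ext (Prod.ext (norm_eq_zero.1 h1) (norm_eq_zero.1 h3))
  have hsurj : Function.Surjective T := by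
    intro f
    obtain ⟨p, hp, h⟩ := hG.exists_sub_smul ε hε f
    exact ⟨⟨p, hp⟩, h⟩
  let E := LinearEquiv.ofBijective T ⟨hinj, hsurj⟩
  let S := E.symm
  have hS : ∀ f, T (S f) = f := fun f => E.apply_symm_apply f
  have hS' : ∀ p, S (T p) = p := fun p => E.symm_apply_apply p
  have hn1 : ∀ f, ‖(S f).1.1‖ ≤ ‖f‖ := fun f => by
    have h := hn (S f)
    rw [hS] at h
    exact le_of_sq_le_sq (by nlinarith [sq_nonneg (ε * ‖(S f).1.2‖)]) (norm_nonneg _)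
  have hn2 : ∀ f, ‖(S f).1.2‖ ≤ ε⁻¹ * ‖f‖ := fun f => by
    have h := hn (S f)
    rw [hS] at h
    have h1 : ε * ‖(S f).1.2‖ ≤ ‖f‖ :=
      le_of_sq_le_sq (by nlinarith [sq_nonneg ‖(S f).1.1‖]) (norm_nonneg _)
    rw [inv_mul_eq_div, le_div_iff₀ hε]
    linarith
  let P : X →L[ℂ] X := LinearMap.mkContinuous
    ((LinearMap.fst ℂ X X).comp (G.subtype.comp S.toLinearMap)) 1
    (fun f => by simpa using hn1 f)
  let A : X →L[ℂ] X := LinearMap.mkContinuous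
    ((LinearMap.snd ℂ X X).comp (G.subtype.comp S.toLinearMap)) ε⁻¹
    (fun f => hn2 f)
  have hsub : ∀ f, P f - (ε : ℂ) • A f = f := fun f => (hT (S f)).symm.trans (hS f)
  refine ⟨P, A, fun f => (S f).2, hsub, hn1, fun p hp => ?_⟩
  -- A pair p in G is its own preimage under 1 - ε G. Comparing with the resolvent identity at p.1
  -- shows ε A p.1 = ε P p.2.
  have h1 : P (p.1 - (ε : ℂ) • p.2) = p.1 :=
    congrArg (fun x : G => x.1.1) (hS' ⟨p, hp⟩)
  have h2 := hsub p.1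
  rw [map_sub, map_smul] at h1
  have h3 : (ε : ℂ) • A p.1 = (ε : ℂ) • P p.2 := by
    rw [← sub_eq_zero]
    have : P p.1 - (ε : ℂ) • A p.1 = P p.1 - (ε : ℂ) • P p.2 := by rw [h1, h2]
    have h4 := sub_right_injective this
    rw [h4, sub_self]
  exact smul_right_injective X (by exact_mod_cast hε.ne' : (ε : ℂ) ≠ 0) h3

end IsSkewRelation

variable [CompleteSpace X]

lemma hasDerivAt_exp_smul_apply (A : X →L[ℂ] X) (x : X) (t : ℝ) :
    HasDerivAt (fun t : ℝ => NormedSpace.exp (t • A) x) (A (NormedSpace.exp (t • A) x)) t := by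
  have h := hasDerivAt_exp_smul_const' A t
  exact (((ContinuousLinearMap.apply ℂ X x).restrictScalars ℝ).hasFDerivAt.comp_hasDerivAt t h)

lemma exp_smul_apply_comm {A B : X →L[ℂ] X} (h : Commute A B) (t : ℝ) (x : X) :
    B (NormedSpace.exp (t • A) x) = NormedSpace.exp (t • A) (B x) := by
  have := ((h.symm.smul_right t).exp_right).eq
  exact DFunLike.congr_fun this x

omit [CompleteSpace X] in
lemma hasDerivAt_norm_sq {u : ℝ → X} {u' : X} {t : ℝ} (h : HasDerivAt u u' t) :
    HasDerivAt (fun t => ‖u t‖ ^ 2) (2 * (inner ℂ (u t) u').re) t := by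
  let := InnerProductSpace.rclikeToReal ℂ X
  exact h.norm_sq

/-- The derivative of the squared norm along the flow is 2 Re ⟨u, A u⟩ ≤ 0. -/
lemma norm_exp_smul_apply_le {A : X →L[ℂ] X} (hA : ∀ f, (inner ℂ f (A f)).re ≤ 0) {t : ℝ}
    (ht : 0 ≤ t) (x : X) : ‖NormedSpace.exp (t • A) x‖ ≤ ‖x‖ := by
  have h := fun s => hasDerivAt_norm_sq (hasDerivAt_exp_smul_apply A x s)
  have hanti : Antitone fun s : ℝ => ‖NormedSpace.exp (s • A) x‖ ^ 2 :=
    antitone_of_deriv_nonpos (fun s => (h s).differentiableAt) fun s => by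
      rw [(h s).deriv]; linarith [hA (NormedSpace.exp (s • A) x)]
  have := hanti ht
  simp only [zero_smul, NormedSpace.exp_zero, one_apply_eq_self] at this
  exact le_of_sq_le_sq this (norm_nonneg _)

namespace IsSkewRelation

variable {G : Submodule ℂ (X × X)}

omit [CompleteSpace X] in
/-- Kōmura's estimate for the difference of two Yosida approximations. -/
lemma norm_sub_sq_le (hG : IsSkewRelation G) {ε δ : ℝ} (hε : 0 < ε) (hδ : 0 < δ)
    {P A Q B : X →L[ℂ] X} (hA : ∀ f, (P f, A f) ∈ G) (hA' : ∀ f, P f - (ε : ℂ) • A f = f)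
    (hB : ∀ f, (Q f, B f) ∈ G) (hB' : ∀ f, Q f - (δ : ℂ) • B f = f) {u v : X} {K : ℝ}
    (hu : ‖A u‖ ≤ K) (hv : ‖B v‖ ≤ K) :
    (inner ℂ (u - v) (A u - B v)).re ≤ 2 * (ε + δ) * K ^ 2 := by
  have hK : 0 ≤ K := (norm_nonneg _).trans hu
  have h1 : u - v = (P u - Q v) - ((ε : ℂ) • A u - (δ : ℂ) • B v) := by
    conv_lhs => rw [← hA' u, ← hB' v]
    abel
  have h2 : (inner ℂ (P u - Q v) (A u - B v)).re = 0 := hG.re_inner _ (G.sub_mem (hA u) (hB v))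
  rw [h1, inner_sub_left, Complex.sub_re, h2, zero_sub]
  have h3 : ‖(ε : ℂ) • A u - (δ : ℂ) • B v‖ ≤ (ε + δ) * K := by
    refine (norm_sub_le _ _).trans ?_
    rw [norm_smul, norm_smul, Complex.norm_of_nonneg hε.le, Complex.norm_of_nonneg hδ.le, add_mul]
    gcongr
  have h4 : ‖A u - B v‖ ≤ 2 * K := by
    refine (norm_sub_le _ _).trans (by linarith)
  have h5 := (Complex.abs_re_le_norm (inner ℂ ((ε : ℂ) • A u - (δ : ℂ) • B v) (A u - B v))).trans
    (norm_inner_le_norm _ _)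
  have h6 := (neg_le_abs _).trans h5
  refine h6.trans ?_
  calc _ ≤ ((ε + δ) * K) * (2 * K) := by gcongr
    _ = _ := by ring

/-- The evolution generated by a skew relation: for initial data in the closure of the domain, there
is a continuous contractive solution, in the weak sense. -/
theorem exists_evolution (hG : IsSkewRelation G) {x₀ : X}
    (hx₀ : x₀ ∈ closure {x | ∃ y, (x, y) ∈ G}) :
    ∃ u : ℝ → X, ContinuousOn u (Icc 0 1) ∧ u 0 = x₀ ∧ (∀ t ∈ Icc (0 : ℝ) 1, ‖u t‖ ≤ ‖x₀‖) ∧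
      ∀ p ∈ G, ∀ t ∈ Icc (0 : ℝ) 1,
        inner ℂ p.1 (u t) = inner ℂ p.1 x₀ - ∫ s in (0 : ℝ)..t, inner ℂ p.2 (u s) := by
  have hpos : ∀ n : ℕ, 0 < 1 / ((n : ℝ) + 1) := fun n => Nat.one_div_pos_of_nat
  choose P A hmem hsub hP hAP using fun n : ℕ => hG.exists_yosida (hpos n)
  have hdiss : ∀ n f, (inner ℂ f (A n f)).re ≤ 0 := by
    intro n f
    have h1 : inner ℂ f (A n f) = inner ℂ (P n f - ((1 / ((n : ℝ) + 1) : ℝ) : ℂ) • A n f) (A n f) := by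
      rw [hsub]
    have h2 : (inner ℂ (((1 / ((n : ℝ) + 1) : ℝ) : ℂ) • A n f) (A n f)).re =
        1 / ((n : ℝ) + 1) * ‖A n f‖ ^ 2 := by
      rw [← re_inner_smul_self_right]; exact inner_re_symm (𝕜 := ℂ) _ _
    rw [h1, inner_sub_left, Complex.sub_re, h2, hG.re_inner _ (hmem n f), zero_sub,
      neg_nonpos]
    have := hpos n
    positivity
  have hcomm : ∀ n, Commute (A n) (P n) := fun n =>
    ContinuousLinearMap.ext fun f => hAP n _ (hmem n f)
  set U : ℕ → X → ℝ → X := fun n x t => NormedSpace.exp (t • A n) x with hU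
  have hUd : ∀ n x t, HasDerivAt (U n x) (A n (U n x t)) t :=
    fun n x t => hasDerivAt_exp_smul_apply (A n) x t
  have hUc : ∀ n x, Continuous (U n x) := fun n x =>
    continuous_iff_continuousAt.2 fun t => (hUd n x t).continuousAt
  have hUle : ∀ n x t, 0 ≤ t → ‖U n x t‖ ≤ ‖x‖ := fun n x t ht =>
    norm_exp_smul_apply_le (hdiss n) ht x
  have hU0 : ∀ n x, U n x 0 = x := fun n x => by simp [hU]
  have hUsub : ∀ n x y t, U n (x - y) t = U n x t - U n y t := fun n x y t => map_sub _ _ _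
  have hdom : ∀ p ∈ G, ∀ n m, ∀ t ∈ Icc (0 : ℝ) 1, ‖U n p.1 t - U m p.1 t‖ ^ 2 ≤
      4 * (1 / ((n : ℝ) + 1) + 1 / ((m : ℝ) + 1)) * ‖p.2‖ ^ 2 := by
    intro p hp n m t ht
    -- For data in the domain the velocities are bounded uniformly in n: A commutes with its own
    -- exponential, and A p.1 = P p.2 has norm at most ‖p.2‖.
    have hK : ∀ n s, 0 ≤ s → ‖A n (U n p.1 s)‖ ≤ ‖p.2‖ := by
      intro n s hs
      have h1 : A n (U n p.1 s) = U n (A n p.1) s := exp_smul_apply_comm (Commute.refl _) s _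
      rw [h1, hAP n p hp]
      exact (hUle n _ s hs).trans (hP n _)
    set c := 4 * (1 / ((n : ℝ) + 1) + 1 / ((m : ℝ) + 1)) * ‖p.2‖ ^ 2 with hc
    have hc0 : 0 ≤ c := by
      have := hpos n; have := hpos m; positivity
    have hd : ∀ s, HasDerivAt (fun s => ‖U n p.1 s - U m p.1 s‖ ^ 2 - c * s)
        (2 * (inner ℂ (U n p.1 s - U m p.1 s) (A n (U n p.1 s) - A m (U m p.1 s))).re - c) s := by
      intro s
      have := (hasDerivAt_norm_sq ((hUd n p.1 s).sub (hUd m p.1 s))).sub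
        ((hasDerivAt_id s).const_mul c)
      rw [mul_one] at this
      exact this
    have hanti : AntitoneOn (fun s => ‖U n p.1 s - U m p.1 s‖ ^ 2 - c * s) (Ici 0) := by
      refine antitoneOn_of_deriv_nonpos (convex_Ici 0)
        (fun s _ => (hd s).continuousAt.continuousWithinAt)
        (fun s _ => (hd s).differentiableAt.differentiableWithinAt) fun s hs => ?_
      rw [interior_Ici] at hs
      rw [(hd s).deriv]
      have := hG.norm_sub_sq_le (hpos n) (hpos m) (hmem n) (hsub n) (hmem m) (hsub m)
        (hK n s (le_of_lt hs)) (hK m s (le_of_lt hs))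
      linarith
    have h := hanti (mem_Ici.2 le_rfl) (mem_Ici.2 ht.1) ht.1
    simp only [hU0, sub_self, norm_zero, mul_zero] at h
    have h2 : c * t ≤ c := mul_le_of_le_one_right hc0 ht.2
    linarith
  have happrox : ∀ η > 0, ∃ p ∈ G, ‖x₀ - p.1‖ < η := by
    intro η hη
    obtain ⟨x, ⟨y, hy⟩, hx⟩ := Metric.mem_closure_iff.1 hx₀ η hη
    exact ⟨(x, y), hy, by rwa [dist_eq_norm] at hx⟩
  have htend : Tendsto (fun n : ℕ => 1 / ((n : ℝ) + 1)) atTop (𝓝 0) :=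
    tendsto_one_div_add_atTop_nhds_zero_nat
  have hcauchy : UniformCauchySeqOn (fun n => U n x₀) atTop (Icc 0 1) := by
    rw [Metric.uniformCauchySeqOn_iff]
    intro η hη
    obtain ⟨p, hp, hpx⟩ := happrox (η / 4) (by positivity)
    -- With the factor 8, the bound in `hdom` is the average of two terms, each below (η / 2)².
    have h1 : Tendsto (fun n : ℕ => 8 * (1 / ((n : ℝ) + 1)) * ‖p.2‖ ^ 2) atTop (𝓝 0) := by
      simpa using (htend.const_mul 8).mul_const (‖p.2‖ ^ 2)
    obtain ⟨N, hN⟩ := eventually_atTop.1 (h1.eventually (gt_mem_nhds (show 0 < (η / 2) ^ 2 by positivity)))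
    refine ⟨N, fun m hm n hn t ht => ?_⟩
    have h2 : ‖U m p.1 t - U n p.1 t‖ < η / 2 := by
      refine lt_of_pow_lt_pow_left₀ 2 (by positivity) ((hdom p hp m n t ht).trans_lt ?_)
      have := hN m hm
      have := hN n hn
      linarith
    have h3 : ∀ k, ‖U k x₀ t - U k p.1 t‖ < η / 4 := fun k => by
      rw [← hUsub]
      exact (hUle k _ t ht.1).trans_lt hpx
    have h4 : U m x₀ t - U n x₀ t = (U m x₀ t - U m p.1 t) + (U m p.1 t - U n p.1 t) -
      (U n x₀ t - U n p.1 t) := by abel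
    rw [dist_eq_norm, h4]
    have := norm_sub_le ((U m x₀ t - U m p.1 t) + (U m p.1 t - U n p.1 t)) (U n x₀ t - U n p.1 t)
    have := norm_add_le (U m x₀ t - U m p.1 t) (U m p.1 t - U n p.1 t)
    linarith [h3 m, h3 n]
  have hPtend : Tendsto (fun n => P n x₀) atTop (𝓝 x₀) := by
    rw [Metric.tendsto_atTop]
    intro η hη
    obtain ⟨p, hp, hpx⟩ := happrox (η / 4) (by positivity)
    have h1 : Tendsto (fun n : ℕ => 1 / ((n : ℝ) + 1) * ‖p.2‖) atTop (𝓝 0) := by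
      simpa using htend.mul_const ‖p.2‖
    obtain ⟨N, hN⟩ := eventually_atTop.1 (h1.eventually (gt_mem_nhds (show 0 < η / 2 by positivity)))
    refine ⟨N, fun n hn => ?_⟩
    have h2 : P n p.1 - p.1 = ((1 / ((n : ℝ) + 1) : ℝ) : ℂ) • P n p.2 := by
      rw [← hAP n p hp, sub_eq_iff_eq_add', ← sub_eq_iff_eq_add, hsub]
    have h3 : ‖P n p.1 - p.1‖ < η / 2 := by
      rw [h2, norm_smul, Complex.norm_of_nonneg (hpos n).le]
      refine lt_of_le_of_lt ?_ (hN n hn)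
      gcongr
      exact hP n _
    have h4 : P n x₀ - x₀ = P n (x₀ - p.1) + (P n p.1 - p.1) - (x₀ - p.1) := by
      rw [map_sub]; abel
    rw [dist_eq_norm, h4]
    have := norm_sub_le (P n (x₀ - p.1) + (P n p.1 - p.1)) (x₀ - p.1)
    have := norm_add_le (P n (x₀ - p.1)) (P n p.1 - p.1)
    have := hP n (x₀ - p.1)
    linarith
  set u : ℝ → X := fun t => limUnder atTop fun n => U n x₀ t with hu
  have hlim : ∀ t ∈ Icc (0 : ℝ) 1, Tendsto (fun n => U n x₀ t) atTop (𝓝 (u t)) :=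
    fun t ht => (hcauchy.cauchySeq ht).tendsto_limUnder
  have hunif : TendstoUniformlyOn (fun n => U n x₀) u atTop (Icc 0 1) :=
    hcauchy.tendstoUniformlyOn_of_tendsto hlim
  -- The resolvent commutes with the flow, and the flow is contractive, so P U x₀ - U x₀ = U (P x₀ -
  -- x₀) tends to zero uniformly in time.
  have hPlim : ∀ t ∈ Icc (0 : ℝ) 1, Tendsto (fun n => P n (U n x₀ t)) atTop (𝓝 (u t)) := by
    intro t ht
    refine (hlim t ht).congr_dist ?_
    refine squeeze_zero (fun _ => dist_nonneg) (fun n => ?_)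
      (tendsto_iff_dist_tendsto_zero.1 hPtend)
    have h1 : P n (U n x₀ t) = U n (P n x₀) t := exp_smul_apply_comm (hcomm n) t _
    rw [h1, dist_comm, dist_eq_norm, ← hUsub, dist_eq_norm]
    exact hUle n _ t ht.1
  refine ⟨u, hunif.continuousOn (Eventually.of_forall fun n => (hUc n x₀).continuousOn).frequently,
    ?_, fun t ht => ?_, fun p hp t ht => ?_⟩
  · refine tendsto_nhds_unique (hlim 0 ⟨le_rfl, zero_le_one⟩) ?_
    simp only [hU0, tendsto_const_nhds]
  · exact le_of_tendsto (hlim t ht).norm (Eventually.of_forall fun n => hUle n x₀ t ht.1)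
  · have h1 : ∀ n, inner ℂ p.1 (U n x₀ t) =
        inner ℂ p.1 x₀ - ∫ s in (0 : ℝ)..t, inner ℂ p.2 (P n (U n x₀ s)) := by
      intro n
      -- Since (P U, A U) lies in G, the polarized skew relation moves the generator onto the fixed
      -- pair p: ⟨p.1, A U⟩ = -⟨p.2, P U⟩. Only bounded quantities remain, so the limit in n can be
      -- taken.
      have hd : ∀ s, HasDerivAt (fun s => inner ℂ p.1 (U n x₀ s))
          (-inner ℂ p.2 (P n (U n x₀ s))) s := by
        intro s
        have h2 := hG.inner_add_inner hp (hmem n (U n x₀ s))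
        rw [← eq_neg_of_add_eq_zero_left h2]
        exact ((innerSL ℂ p.1).restrictScalars ℝ).hasFDerivAt.comp_hasDerivAt s (hUd n x₀ s)
      have hcont : Continuous fun s => inner ℂ p.2 (P n (U n x₀ s)) :=
        continuous_const.inner ((P n).continuous.comp (hUc n x₀))
      have h3 := intervalIntegral.integral_eq_sub_of_hasDerivAt (fun s _ => hd s)
        (hcont.neg.intervalIntegrable 0 t)
      rw [intervalIntegral.integral_neg, hU0] at h3
      rw [sub_eq_add_neg, h3]; ring
    have h2 : Tendsto (fun n => ∫ s in (0 : ℝ)..t, inner ℂ p.2 (P n (U n x₀ s))) atTop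
        (𝓝 (∫ s in (0 : ℝ)..t, inner ℂ p.2 (u s))) := by
      refine intervalIntegral.tendsto_integral_filter_of_dominated_convergence
        (fun _ => ‖p.2‖ * ‖x₀‖) (Eventually.of_forall fun n => ?_)
        (Eventually.of_forall fun n => Eventually.of_forall fun s hs => ?_)
        intervalIntegrable_const (Eventually.of_forall fun s hs => ?_)
      · exact (continuous_const.inner ((P n).continuous.comp (hUc n x₀))).aestronglyMeasurable
      · rw [uIoc_of_le ht.1] at hs
        refine (norm_inner_le_norm _ _).trans ?_
        gcongr
        exact (hP n _).trans (hUle n x₀ s hs.1.le)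
      · rw [uIoc_of_le ht.1] at hs
        exact tendsto_const_nhds.inner (hPlim s ⟨hs.1.le, hs.2.trans ht.2⟩)
    refine tendsto_nhds_unique (tendsto_const_nhds.inner (hlim t ht)) ?_
    simp only [h1]
    exact tendsto_const_nhds.sub h2

end IsSkewRelation
end SkewRelation

/-! ### Abstract wave equations in the energy space -/

section AbstractWave

variable {W V H : Type*} [NormedAddCommGroup W] [InnerProductSpace ℂ W]
  [NormedAddCommGroup V] [InnerProductSpace ℂ V] [NormedAddCommGroup H] [InnerProductSpace ℂ H]

/-- The operators of an abstract wave equation `j* j w'' + 2 i c N* j w' + i* i w = 0`. -/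
structure IsWaveSystem (i : W →L[ℂ] V) (j N : W →L[ℂ] H) : Prop where
  symm : ∀ z w, (inner ℂ (N z) (j w) : ℂ) = inner ℂ (j z) (N w)
  injective : Function.Injective j
  coercive : ∃ κ : ℝ, 0 < κ ∧ ∀ w, κ * ‖w‖ ^ 2 ≤ ‖i w‖ ^ 2 + ‖j w‖ ^ 2

/-- The generator `(φ, j ξ) ↦ (i ξ, χ)` of the abstract wave equation, as a linear relation. -/
def waveRelation (i : W →L[ℂ] V) (j N : W →L[ℂ] H) (c : ℝ) :
    Submodule ℂ (WithLp 2 (V × H) × WithLp 2 (V × H)) where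
  carrier := {p | ∃ ξ : W, p.2.fst = i ξ ∧ p.1.snd = j ξ ∧ ∀ z : W,
    (inner ℂ (i z) p.1.fst : ℂ) + 2 * Complex.I * c * inner ℂ (N z) p.1.snd +
      inner ℂ (j z) p.2.snd = 0}
  zero_mem' := ⟨0, by simp, by simp, by simp⟩
  add_mem' := by
    rintro p r ⟨ξ, h1, h2, h3⟩ ⟨η, h4, h5, h6⟩
    refine ⟨ξ + η, by simp [h1, h4], by simp [h2, h5], fun z => ?_⟩
    simp only [Prod.fst_add, Prod.snd_add, WithLp.add_fst, WithLp.add_snd, inner_add_right]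
    linear_combination h3 z + h6 z
  smul_mem' := by
    rintro a p ⟨ξ, h1, h2, h3⟩
    refine ⟨a • ξ, by simp [h1], by simp [h2], fun z => ?_⟩
    simp only [Prod.smul_fst, Prod.smul_snd, WithLp.smul_fst, WithLp.smul_snd, inner_smul_right]
    linear_combination a * h3 z

/-- The map `w ↦ (i w, j w)`. -/
def graphMap (i : W →L[ℂ] V) (j : W →L[ℂ] H) : W →L[ℂ] WithLp 2 (V × H) :=
  (WithLp.prodContinuousLinearEquiv 2 ℂ V H).symm.toContinuousLinearMap ∘L (i.prod j)

namespace IsWaveSystem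

variable {i : W →L[ℂ] V} {j N : W →L[ℂ] H}

lemma im_inner (h : IsWaveSystem i j N) (w : W) : (inner ℂ (N w) (j w) : ℂ).im = 0 := by
  have h1 := h.symm w w
  rw [← inner_conj_symm (j w) (N w)] at h1
  exact Complex.conj_eq_iff_im.1 h1.symm

lemma re_I_mul_inner (h : IsWaveSystem i j N) (c : ℝ) (w : W) :
    (2 * Complex.I * c * inner ℂ (N w) (j w) : ℂ).re = 0 := by
  simp [h.im_inner w]

variable [CompleteSpace W] [CompleteSpace V] [CompleteSpace H]

/-- This is the resolvent equation after elimination: for p.1 - ε p.2 = (f, g) the components must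
be p.1.fst = f + ε i ξ and p.2.snd = ε⁻¹ (j ξ - g), leaving one variational equation for ξ in W. It
is solved by Lax-Milgram, the charge term being invisible in the real part. -/
lemma exists_resolvent (h : IsWaveSystem i j N) (c : ℝ) {ε : ℝ} (hε : 0 < ε) (f : V) (g : H) :
    ∃ ξ : W, ∀ z : W, (inner ℂ (i z) f : ℂ) + ε * inner ℂ (i z) (i ξ) +
      2 * Complex.I * c * inner ℂ (N z) (j ξ) + (ε⁻¹ : ℝ) * inner ℂ (j z) (j ξ - g) = 0 := by
  obtain ⟨κ, hκ, hcoer⟩ := h.coercive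
  set T : W →L[ℂ] W := (ε : ℂ) • (i.adjoint ∘L i) + (2 * Complex.I * c) • (N.adjoint ∘L j) +
    ((ε⁻¹ : ℝ) : ℂ) • (j.adjoint ∘L j) with hT
  have hTz : ∀ z ξ, inner ℂ z (T ξ) = (ε : ℂ) * inner ℂ (i z) (i ξ) +
      2 * Complex.I * c * inner ℂ (N z) (j ξ) + (ε⁻¹ : ℝ) * inner ℂ (j z) (j ξ) := by
    intro z ξ
    simp only [hT, add_apply, smul_apply, ContinuousLinearMap.comp_apply,
      inner_add_right, inner_smul_right, ContinuousLinearMap.adjoint_inner_right]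
  have hpos : 0 < min ε ε⁻¹ := lt_min hε (inv_pos.2 hε)
  have hunit : IsUnit T := by
    refine ContinuousLinearMap.isUnit_of_forall_le_norm_inner_map T
      (c := Real.toNNReal (min ε ε⁻¹ * κ)) (Real.toNNReal_pos.2 (by positivity)) fun x => ?_
    have h1 : (inner ℂ x (T x) : ℂ).re = ε * ‖i x‖ ^ 2 + ε⁻¹ * ‖j x‖ ^ 2 := by
      have h2 := h.re_I_mul_inner c x
      rw [hTz, Complex.add_re, Complex.add_re, h2, Complex.re_ofReal_mul, Complex.re_ofReal_mul,
        inner_self_eq_norm_sq_to_K, inner_self_eq_norm_sq_to_K, add_zero]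
      simp only [Complex.coe_algebraMap, ← Complex.ofReal_pow, Complex.ofReal_re]
    rw [norm_inner_symm, Real.coe_toNNReal _ (by positivity)]
    refine le_trans ?_ (Complex.re_le_norm _)
    rw [h1]
    calc ‖x‖ ^ 2 * (min ε ε⁻¹ * κ) = min ε ε⁻¹ * (κ * ‖x‖ ^ 2) := by ring
      _ ≤ min ε ε⁻¹ * (‖i x‖ ^ 2 + ‖j x‖ ^ 2) := by gcongr; exact hcoer x
      _ = min ε ε⁻¹ * ‖i x‖ ^ 2 + min ε ε⁻¹ * ‖j x‖ ^ 2 := by ring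
      _ ≤ _ := by
        gcongr
        · exact min_le_left _ _
        · exact min_le_right _ _
  obtain ⟨S, hS⟩ := hunit
  set r : W := ((ε⁻¹ : ℝ) : ℂ) • j.adjoint g - i.adjoint f with hr
  refine ⟨S.inv r, fun z => ?_⟩
  have h1 : T (S.inv r) = r := by
    have h2 := S.val_inv
    rw [hS] at h2
    exact DFunLike.congr_fun h2 r
  have h3 := hTz z (S.inv r)
  rw [h1, hr, inner_sub_right, inner_smul_right, ContinuousLinearMap.adjoint_inner_right,
    ContinuousLinearMap.adjoint_inner_right] at h3
  rw [inner_sub_right]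
  linear_combination -h3

/-- Testing the defining identity of the relation with z = ξ gives skewness, because `symm` makes
the charge term purely imaginary. -/
lemma isSkewRelation (h : IsWaveSystem i j N) (c : ℝ) : IsSkewRelation (waveRelation i j N c) where
  re_inner := by
    rintro p ⟨ξ, h1, h2, h3⟩
    have h4 := congrArg Complex.re (h3 ξ)
    rw [h2, Complex.add_re, Complex.add_re, h.re_I_mul_inner] at h4
    rw [WithLp.prod_inner_apply, Complex.add_re]
    change (inner ℂ p.1.fst p.2.fst).re + (inner ℂ p.1.snd p.2.snd).re = 0
    rw [h1, h2]
    have h5 : (inner ℂ p.1.fst (i ξ)).re = (inner ℂ (i ξ) p.1.fst).re :=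
      inner_re_symm (𝕜 := ℂ) _ _
    rw [h5]
    simpa using h4
  exists_sub_smul := by
    intro ε hε f
    obtain ⟨ξ, hξ⟩ := h.exists_resolvent c hε f.fst f.snd
    refine ⟨(WithLp.toLp 2 (f.fst + (ε : ℂ) • i ξ, j ξ),
      WithLp.toLp 2 (i ξ, ((ε⁻¹ : ℝ) : ℂ) • (j ξ - f.snd))), ⟨ξ, rfl, rfl, fun z => ?_⟩, ?_⟩
    · change inner ℂ (i z) (f.fst + (ε : ℂ) • i ξ) + 2 * Complex.I * c * inner ℂ (N z) (j ξ) +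
        inner ℂ (j z) (((ε⁻¹ : ℝ) : ℂ) • (j ξ - f.snd)) = 0
      rw [inner_add_right, inner_smul_right, inner_smul_right]
      exact hξ z
    · have hε' : (ε : ℂ) ≠ 0 := by exact_mod_cast hε.ne'
      apply (WithLp.equiv 2 (V × H)).injective
      refine Prod.ext ?_ ?_
      · change f.fst + (ε : ℂ) • i ξ - (ε : ℂ) • i ξ = f.fst
        abel
      · change j ξ - (ε : ℂ) • ((ε⁻¹ : ℝ) : ℂ) • (j ξ - f.snd) = f.snd
        rw [smul_smul, Complex.ofReal_inv, mul_inv_cancel₀ hε', one_smul]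
        abel

-- Coercivity bounds `graphMap` below by √κ. So its range is closed, and membership in the range can
-- be tested by orthogonality; continuity of w can be read off from that of (i w, j w).
omit [CompleteSpace V] [CompleteSpace H] in
lemma isClosedEmbedding_graphMap (h : IsWaveSystem i j N) :
    IsClosedEmbedding (graphMap i j) := by
  obtain ⟨κ, hκ, hcoer⟩ := h.coercive
  have : AntilipschitzWith (Real.toNNReal (Real.sqrt κ)⁻¹) (graphMap i j) := by
    refine ContinuousLinearMap.antilipschitz_of_bound _ fun x => ?_
    have hs := Real.sqrt_pos.2 hκ
    rw [Real.coe_toNNReal _ (by positivity), inv_mul_eq_div, le_div_iff₀ hs]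
    refine le_of_sq_le_sq ?_ (norm_nonneg _)
    rw [mul_pow, Real.sq_sqrt hκ.le, WithLp.prod_norm_sq_eq_of_L2, mul_comm]
    exact hcoer x
  exact this.isClosedEmbedding (graphMap i j).uniformContinuous

/-- The closure of the domain is its double orthogonal complement. A vector orthogonal to the domain
is, by solvability of the resolvent equation, minus a value of the relation at 0; injectivity of j
makes its first component zero, and the second is orthogonal to the range of j. -/
lemma mem_closure_domain (h : IsWaveSystem i j N) (c : ℝ) (φ₀ : V) {ψ₀ : H}
    (hψ₀ : ψ₀ ∈ (LinearMap.range j.toLinearMap).topologicalClosure) :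
    WithLp.toLp 2 (φ₀, ψ₀) ∈ closure {x | ∃ y, (x, y) ∈ waveRelation i j N c} := by
  set D : Submodule ℂ (WithLp 2 (V × H)) :=
    (waveRelation i j N c).map (LinearMap.fst ℂ _ _) with hD
  have hD' : (D : Set (WithLp 2 (V × H))) = {x | ∃ y, (x, y) ∈ waveRelation i j N c} := by
    ext x
    simp [hD]
  rw [← hD', ← Submodule.topologicalClosure_coe, ← Submodule.orthogonal_orthogonal_eq_closure,
    SetLike.mem_coe, Submodule.mem_orthogonal]
  intro y hy
  obtain ⟨p, hp, hpy⟩ := (h.isSkewRelation c).exists_sub_smul 1 one_pos y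
  rw [Complex.ofReal_one, one_smul] at hpy
  have h1 : p.1 = 0 := by
    have h2 : inner ℂ p.1 y = 0 :=
      (Submodule.mem_orthogonal _ _).1 hy p.1 (Submodule.mem_map_of_mem hp)
    have h3 := (h.isSkewRelation c).re_inner p hp
    rw [← hpy, inner_sub_right] at h2
    have h4 := congrArg Complex.re h2
    rw [Complex.sub_re, h3, sub_zero, inner_self_eq_norm_sq_to_K] at h4
    have h5 : ‖p.1‖ ^ 2 = 0 := by
      simpa only [Complex.coe_algebraMap, ← Complex.ofReal_pow, Complex.ofReal_re,
        Complex.zero_re] using h4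
    exact norm_eq_zero.1 (pow_eq_zero_iff two_ne_zero |>.1 h5)
  obtain ⟨ξ, hξ1, hξ2, hξ3⟩ := hp
  rw [h1] at hξ2 hξ3 hpy
  have hξ : ξ = 0 := h.injective (by rw [← hξ2, map_zero]; rfl)
  rw [hξ, map_zero] at hξ1
  have hy' : y = -p.2 := by rw [← hpy, zero_sub]
  have h6 : ∀ z, inner ℂ p.2.snd (j z) = 0 := by
    intro z
    have := hξ3 z
    simp only [WithLp.zero_fst, WithLp.zero_snd, inner_zero_right, mul_zero, zero_add] at this
    rw [← inner_conj_symm, this, map_zero]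
  have h7 : inner ℂ p.2.snd ψ₀ = 0 := by
    have h8 : (LinearMap.range j.toLinearMap).topologicalClosure ≤ (innerSL ℂ p.2.snd).ker := by
      refine Submodule.topologicalClosure_minimal _ ?_ (innerSL ℂ p.2.snd).isClosed_ker
      rintro _ ⟨z, rfl⟩
      exact h6 z
    exact h8 hψ₀
  rw [hy', inner_neg_left, WithLp.prod_inner_apply]
  change -(inner ℂ p.2.fst φ₀ + inner ℂ p.2.snd ψ₀) = 0
  rw [h7, hξ1, inner_zero_left, add_zero, neg_zero]

/-- Existence for the abstract wave equation. -/
theorem exists_wave (h : IsWaveSystem i j N) (c : ℝ) (φ₀ : V) (ψ₀ : H) :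
    ∃ (w : ℝ → W) (ψ : ℝ → H), ContinuousOn w (Icc 0 1) ∧ ContinuousOn ψ (Icc 0 1) ∧
      ∀ t ∈ Icc (0 : ℝ) 1, (j (w t) = ∫ s in (0 : ℝ)..t, ψ s) ∧
        ‖φ₀ + i (w t)‖ ^ 2 + ‖ψ t‖ ^ 2 ≤ ‖φ₀‖ ^ 2 + ‖ψ₀‖ ^ 2 ∧
        ∀ z : W, (inner ℂ (j z) (ψ t) : ℂ) = inner ℂ (j z) ψ₀ - ∫ s in (0 : ℝ)..t,
          ((inner ℂ (i z) (φ₀ + i (w s)) : ℂ) + 2 * Complex.I * c * inner ℂ (N z) (ψ s)) := by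
  -- The initial velocity is only ever tested against vectors j z, so it may be projected onto the
  -- closure of the range of j. The projection does not increase the norm, and the range of j need
  -- not be dense.
  set K := (LinearMap.range j.toLinearMap).topologicalClosure with hK
  have : CompleteSpace K := (Submodule.isClosed_topologicalClosure _).completeSpace_coe
  set ψ₁ : H := K.starProjection ψ₀ with hψ₁
  have hψ₁K : ψ₁ ∈ K := K.starProjection_apply_mem ψ₀
  have hψ₁le : ‖ψ₁‖ ≤ ‖ψ₀‖ := K.norm_starProjection_apply_le ψ₀
  have hψ₁j : ∀ z, (inner ℂ (j z) ψ₁ : ℂ) = inner ℂ (j z) ψ₀ := by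
    intro z
    have h1 : j z ∈ K := Submodule.le_topologicalClosure _ ⟨z, rfl⟩
    have h2 := inner_eq_zero_symm.1 (K.starProjection_inner_eq_zero ψ₀ (j z) h1)
    rw [inner_sub_right, sub_eq_zero] at h2
    exact h2.symm
  obtain ⟨u, hu, hu0, hule, hueq⟩ :=
    (h.isSkewRelation c).exists_evolution (h.mem_closure_domain c φ₀ hψ₁K)
  have hfst : ContinuousOn (fun t => (u t).fst) (Icc 0 1) :=
    (WithLp.prod_continuous_ofLp 2 V H).fst.comp_continuousOn hu
  have hsnd : ContinuousOn (fun t => (u t).snd) (Icc 0 1) :=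
    (WithLp.prod_continuous_ofLp 2 V H).snd.comp_continuousOn hu
  have hint : ∀ {E : Type _} [NormedAddCommGroup E] {f : ℝ → E}, ContinuousOn f (Icc 0 1) →
      ∀ t ∈ Icc (0 : ℝ) 1, IntervalIntegrable f volume 0 t := by
    intro E _ f hf t ht
    refine (hf.mono ?_).intervalIntegrable
    rw [uIcc_of_le ht.1]
    exact Icc_subset_Icc_right ht.2
  have hrange : ∀ t ∈ Icc (0 : ℝ) 1, ∃ w : W,
      graphMap i j w = WithLp.toLp 2 ((u t).fst - φ₀, ∫ s in (0 : ℝ)..t, (u s).snd) := by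
    intro t ht
    set R := LinearMap.range (graphMap i j).toLinearMap with hR
    have hcl : IsClosed (R : Set (WithLp 2 (V × H))) := h.isClosedEmbedding_graphMap.isClosed_range
    have : CompleteSpace R := hcl.completeSpace_coe
    suffices hmem : WithLp.toLp 2 ((u t).fst - φ₀, ∫ s in (0 : ℝ)..t, (u s).snd) ∈ R from hmem
    rw [← R.orthogonal_orthogonal, Submodule.mem_orthogonal]
    intro y hy
    have hy' : ∀ z, (inner ℂ (i z) y.fst : ℂ) + inner ℂ (j z) y.snd = 0 := fun z =>
      (Submodule.mem_orthogonal _ _).1 hy _ ⟨z, rfl⟩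
    -- Orthogonality of y to the range says precisely that ((y.fst, 0), (0, y.snd)) belongs to the
    -- relation, with ξ = 0. The weak equation for this pair is the orthogonality to be shown.
    have h1 := hueq (WithLp.toLp 2 (y.fst, 0), WithLp.toLp 2 (0, y.snd))
      ⟨0, by simp, by simp, fun z => by simpa using hy' z⟩ t ht
    simp only [WithLp.prod_inner_apply, inner_zero_left, add_zero, zero_add] at h1
    change inner ℂ y.fst (u t).fst = inner ℂ y.fst φ₀ -
      ∫ s in (0 : ℝ)..t, inner ℂ y.snd (u s).snd at h1
    rw [WithLp.prod_inner_apply]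
    change inner ℂ y.fst ((u t).fst - φ₀) + inner ℂ y.snd (∫ s in (0 : ℝ)..t, (u s).snd) = 0
    have h2 : ∫ s in (0 : ℝ)..t, inner ℂ y.snd (u s).snd =
        inner ℂ y.snd (∫ s in (0 : ℝ)..t, (u s).snd) :=
      (innerSL ℂ y.snd).intervalIntegral_comp_comm (hint hsnd t ht)
    rw [← h2, inner_sub_right]
    linear_combination h1
  choose! w hw using hrange
  have hw1 : ∀ t ∈ Icc (0 : ℝ) 1, i (w t) = (u t).fst - φ₀ := fun t ht =>
    congrArg WithLp.fst (hw t ht)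
  have hw2 : ∀ t ∈ Icc (0 : ℝ) 1, j (w t) = ∫ s in (0 : ℝ)..t, (u s).snd := fun t ht =>
    congrArg WithLp.snd (hw t ht)
  refine ⟨w, fun t => (u t).snd, ?_, hsnd, fun t ht => ⟨hw2 t ht, ?_, fun z => ?_⟩⟩
  · rw [h.isClosedEmbedding_graphMap.isInducing.continuousOn_iff]
    have : ContinuousOn (fun t => WithLp.toLp 2 ((u t).fst - φ₀, ∫ s in (0 : ℝ)..t, (u s).snd))
        (Icc (0 : ℝ) 1) := by
      refine (WithLp.prod_continuous_toLp 2 V H).comp_continuousOn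
        ((hfst.sub continuousOn_const).prodMk ?_)
      have := intervalIntegral.continuousOn_primitive_interval (a := 0) (b := 1) (μ := volume)
        (f := fun s => (u s).snd) (by
          rw [uIcc_of_le zero_le_one]; exact hsnd.integrableOn_Icc)
      rwa [uIcc_of_le zero_le_one] at this
    exact this.congr hw
  · have h1 := hule t ht
    have h2 : ‖u t‖ ^ 2 ≤ ‖(WithLp.toLp 2 (φ₀, ψ₁) : WithLp 2 (V × H))‖ ^ 2 := by gcongr
    rw [WithLp.prod_norm_sq_eq_of_L2, WithLp.prod_norm_sq_eq_of_L2] at h2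
    rw [hw1 t ht, add_sub_cancel]
    refine h2.trans ?_
    change ‖φ₀‖ ^ 2 + ‖ψ₁‖ ^ 2 ≤ _
    gcongr
  -- This pair lies in the relation with ξ = z, by the symmetry of N against j. The conjugation in
  -- the first slot of the inner product turns -2ic into 2ic.
  · have h1 := hueq (WithLp.toLp 2 (0, j z), WithLp.toLp 2 (i z, -(2 * Complex.I * c) • N z))
      ⟨z, rfl, rfl, fun z' => ?_⟩ t ht
    · simp only [WithLp.prod_inner_apply, inner_zero_left, zero_add, inner_smul_left] at h1
      change inner ℂ (j z) (u t).snd = inner ℂ (j z) ψ₁ - ∫ s in (0 : ℝ)..t,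
        (inner ℂ (i z) (u s).fst + conj (-(2 * Complex.I * c)) * inner ℂ (N z) (u s).snd) at h1
      rw [h1, hψ₁j]
      congr 1
      refine intervalIntegral.integral_congr fun s hs => ?_
      rw [uIcc_of_le ht.1] at hs
      simp only [hw1 s ⟨hs.1, hs.2.trans ht.2⟩, add_sub_cancel, map_neg, map_mul, Complex.conj_I,
        Complex.conj_ofReal, map_ofNat]
      ring
    · change inner ℂ (i z') (0 : V) + 2 * Complex.I * c * inner ℂ (N z') (j z) +
        inner ℂ (j z') (-(2 * Complex.I * c) • N z) = 0
      rw [inner_zero_right, inner_smul_right, h.symm]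
      ring

omit [CompleteSpace W] in
/-- Uniqueness for the abstract wave equation, in a form that is integrated in time. -/
theorem wave_unique (h : IsWaveSystem i j N) (c : ℝ) {φ : ℝ → V} {ψ : ℝ → H} {a b : ℝ}
    (hφ : Integrable φ) (hψ : Integrable ψ)
    (h1 : ∀ t ∈ Icc a b, ∃ w : W, (i w = ∫ s in a..t, φ s) ∧
      j w = ∫ s in a..t, ∫ r in a..s, ψ r)
    (h2 : ∀ z : W, ∀ᵐ t, t ∈ Icc a b → (inner ℂ (j z) (ψ t) : ℂ) =
      -∫ s in a..t, ((inner ℂ (i z) (φ s) : ℂ) + 2 * Complex.I * c * inner ℂ (N z) (ψ s))) :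
    ∀ t ∈ Ioo a b, (∫ s in a..t, φ s) = 0 ∧ ∫ s in a..t, ψ s = 0 := by
  set F : ℝ → V := fun t => ∫ s in a..t, φ s with hF
  set P : ℝ → H := fun t => ∫ s in a..t, ψ s with hP
  have hFc : Continuous F := intervalIntegral.continuous_primitive (fun _ _ => hφ.intervalIntegrable) a
  have hPc : Continuous P := intervalIntegral.continuous_primitive (fun _ _ => hψ.intervalIntegrable) a
  set F₂ : ℝ → V := fun t => ∫ s in a..t, F s with hF₂
  set P₂ : ℝ → H := fun t => ∫ s in a..t, P s with hP₂
  have hF₂d : ∀ t, HasDerivAt F₂ (F t) t := fun t =>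
    intervalIntegral.integral_hasDerivAt_right (hFc.intervalIntegrable _ _)
      (hFc.stronglyMeasurableAtFilter _ _) hFc.continuousAt
  have hP₂d : ∀ t, HasDerivAt P₂ (P t) t := fun t =>
    intervalIntegral.integral_hasDerivAt_right (hPc.intervalIntegrable _ _)
      (hPc.stronglyMeasurableAtFilter _ _) hPc.continuousAt
  -- The equation integrated once more in time: P replaces ψ, and both force terms involve the twice
  -- integrated functions F₂ and P₂.
  have hweak : ∀ z : W, ∀ t ∈ Icc a b, (inner ℂ (j z) (P t) : ℂ) =
      -((inner ℂ (i z) (F₂ t) : ℂ) + 2 * Complex.I * c * inner ℂ (N z) (P₂ t)) := by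
    intro z t ht
    have e1 : inner ℂ (j z) (P t) = ∫ s in a..t, inner ℂ (j z) (ψ s) :=
      ((innerSL ℂ (j z)).intervalIntegral_comp_comm hψ.intervalIntegrable).symm
    have e2 : ∀ s, ∫ r in a..s, ((inner ℂ (i z) (φ r) : ℂ) +
        2 * Complex.I * c * inner ℂ (N z) (ψ r)) =
        inner ℂ (i z) (F s) + 2 * Complex.I * c * inner ℂ (N z) (P s) := by
      intro s
      rw [intervalIntegral.integral_add, intervalIntegral.integral_const_mul]
      · congr 1
        · exact (innerSL ℂ (i z)).intervalIntegral_comp_comm hφ.intervalIntegrable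
        · congr 1
          exact (innerSL ℂ (N z)).intervalIntegral_comp_comm hψ.intervalIntegrable
      · exact ((innerSL ℂ (i z)).integrable_comp hφ).intervalIntegrable
      · exact (((innerSL ℂ (N z)).integrable_comp hψ).const_mul _).intervalIntegrable
    have e3 : ∫ s in a..t, inner ℂ (j z) (ψ s) = ∫ s in a..t,
        -(inner ℂ (i z) (F s) + 2 * Complex.I * c * inner ℂ (N z) (P s)) := by
      refine intervalIntegral.integral_congr_ae ?_
      filter_upwards [h2 z] with s hs hst
      rw [uIoc_of_le ht.1] at hst
      rw [hs ⟨hst.1.le, hst.2.trans ht.2⟩, e2]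
    rw [e1, e3, intervalIntegral.integral_neg, intervalIntegral.integral_add,
      intervalIntegral.integral_const_mul]
    · congr 2
      · exact (innerSL ℂ (i z)).intervalIntegral_comp_comm (hFc.intervalIntegrable _ _)
      · congr 1
        exact (innerSL ℂ (N z)).intervalIntegral_comp_comm (hPc.intervalIntegrable _ _)
    · exact (continuous_const.inner hFc).intervalIntegrable _ _
    · exact (continuous_const.mul (continuous_const.inner hPc)).intervalIntegrable _ _
  -- This is the energy of the twice integrated solution. Its derivative involves F and P₂, the two
  -- images of an element w of W by hypothesis `h1`, so w is an admissible test vector and the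
  -- derivative vanishes.
  set E : ℝ → ℝ := fun t => ‖F₂ t‖ ^ 2 + ‖P₂ t‖ ^ 2 with hE
  have hEd : ∀ t, HasDerivAt E
      (2 * (inner ℂ (F₂ t) (F t)).re + 2 * (inner ℂ (P₂ t) (P t)).re) t := fun t =>
    (hasDerivAt_norm_sq (hF₂d t)).add (hasDerivAt_norm_sq (hP₂d t))
  have hE0 : ∀ t ∈ Icc a b,
      2 * (inner ℂ (F₂ t) (F t)).re + 2 * (inner ℂ (P₂ t) (P t)).re = 0 := by
    intro t ht
    obtain ⟨w, hw1, hw2⟩ := h1 t ht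
    have h3 := hweak w t ht
    change i w = F t at hw1
    change j w = P₂ t at hw2
    have h4 := h.re_I_mul_inner c w
    rw [hw2] at h4
    rw [hw1, hw2] at h3
    have h5 := congrArg Complex.re h3
    rw [Complex.neg_re, Complex.add_re, h4] at h5
    have h6 : (inner ℂ (F t) (F₂ t)).re = (inner ℂ (F₂ t) (F t)).re := inner_re_symm (𝕜 := ℂ) _ _
    linarith
  have hEzero : ∀ t ∈ Icc a b, E t = 0 := by
    intro t ht
    have h3 := constant_of_has_deriv_right_zero
      (f := E) (a := a) (b := b) (fun s _ => (hEd s).continuousAt.continuousWithinAt)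
      (fun s hs => by
        have := (hEd s).hasDerivWithinAt (s := Ici s)
        rwa [hE0 s ⟨hs.1, hs.2.le⟩] at this) t ht
    rw [h3]
    simp [hE, hF₂, hP₂]
  have hzero : ∀ t ∈ Icc a b, F₂ t = 0 ∧ P₂ t = 0 := by
    intro t ht
    have h3 : ‖F₂ t‖ ^ 2 + ‖P₂ t‖ ^ 2 = 0 := hEzero t ht
    have h4 : ‖F₂ t‖ ^ 2 = 0 := by nlinarith [sq_nonneg ‖F₂ t‖, sq_nonneg ‖P₂ t‖]
    have h5 : ‖P₂ t‖ ^ 2 = 0 := by nlinarith [sq_nonneg ‖F₂ t‖, sq_nonneg ‖P₂ t‖]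
    exact ⟨norm_eq_zero.1 (pow_eq_zero_iff two_ne_zero |>.1 h4),
      norm_eq_zero.1 (pow_eq_zero_iff two_ne_zero |>.1 h5)⟩
  intro t ht
  have hnhds : Icc a b ∈ 𝓝 t := Icc_mem_nhds ht.1 ht.2
  constructor
  · exact ((hF₂d t).congr_of_eventuallyEq (f₁ := fun _ => 0)
      (Filter.eventuallyEq_of_mem hnhds fun s hs => (hzero s hs).1.symm)).unique
      (hasDerivAt_const t 0)
  · exact ((hP₂d t).congr_of_eventuallyEq (f₁ := fun _ => 0)
      (Filter.eventuallyEq_of_mem hnhds fun s hs => (hzero s hs).2.symm)).unique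
      (hasDerivAt_const t 0)

end IsWaveSystem
end AbstractWave

/-! ### Weak derivatives in time and initial values -/

section WeakTimeDerivative

instance isFiniteMeasure_timeMeasure : IsFiniteMeasure timeMeasure := by
  unfold timeMeasure; infer_instance

lemma ae_timeMeasure_iff {p : ℝ → Prop} :
    (∀ᵐ T ∂timeMeasure, p T) ↔ ∀ᵐ T, T ∈ Icc (-1 : ℝ) 0 → p T :=
  ae_restrict_iff' measurableSet_Icc

lemma ae_mem_Icc : ∀ᵐ T ∂timeMeasure, T ∈ Icc (-1 : ℝ) 0 := ae_restrict_mem measurableSet_Icc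

lemma integral_timeMeasure {E : Type*} [NormedAddCommGroup E] [NormedSpace ℝ E] (f : ℝ → E) :
    ∫ T, f T ∂timeMeasure = ∫ T in (-1 : ℝ)..0, f T := by
  rw [intervalIntegral.integral_of_le (by norm_num), timeMeasure, integral_Icc_eq_integral_Ioc]

lemma IsTimeTest.eq_zero {η : ℝ → ℝ} (hη : IsTimeTest η) {T : ℝ} (hT : T ∉ Ioo (-1 : ℝ) 0) :
    η T = 0 :=
  image_eq_zero_of_notMem_tsupport fun h => hT (hη.2.2 h)

lemma IsTimeTest.continuous_deriv {η : ℝ → ℝ} (hη : IsTimeTest η) : Continuous (deriv η) :=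
  hη.1.continuous_deriv (by simp)

lemma IsTimeTest.hasDerivAt {η : ℝ → ℝ} (hη : IsTimeTest η) (T : ℝ) :
    HasDerivAt η (deriv η T) T :=
  ((hη.1.differentiable (by simp)) T).hasDerivAt

lemma integrable_ofReal_mul {a : ℝ → ℝ} (ha : Continuous a) {g : ℝ → ℂ}
    (hg : Integrable g timeMeasure) : Integrable (fun T => (a T : ℂ) * g T) timeMeasure := by
  obtain ⟨C, hC⟩ := isCompact_Icc.exists_bound_of_continuousOn (s := Icc (-1 : ℝ) 0) ha.continuousOn
  refine hg.bdd_mul (c := C) (Complex.continuous_ofReal.comp ha).aestronglyMeasurable ?_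
  filter_upwards [ae_mem_Icc] with T hT
  rw [Complex.norm_real]
  exact hC T hT

/-- Integration by parts against the primitive of an integrable function. -/
lemma IsTimeTest.integral_deriv_mul_primitive {η : ℝ → ℝ} (hη : IsTimeTest η) {h : ℝ → ℂ}
    (hh : Integrable h timeMeasure) :
    ∫ T, ((deriv η T : ℝ) : ℂ) * (∫ s in (-1 : ℝ)..T, h s) ∂timeMeasure =
      -∫ T, (η T : ℂ) * h T ∂timeMeasure := by
  have hη' := hη.continuous_deriv
  have hprod : Integrable (fun p : ℝ × ℝ => ((deriv η p.1 : ℝ) : ℂ) * h p.2)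
      (timeMeasure.prod timeMeasure) := by
    have h1 : Integrable (fun T => ((deriv η T : ℝ) : ℂ)) timeMeasure := by
      simpa using integrable_ofReal_mul hη' (integrable_const (1 : ℂ))
    exact h1.mul_prod hh
  -- Fubini on the triangle s ≤ T; the inner integral of η' from s to 0 is -η(s).
  have hind : Integrable (Function.uncurry fun T s : ℝ =>
      {p : ℝ × ℝ | p.2 ≤ p.1}.indicator (fun p => ((deriv η p.1 : ℝ) : ℂ) * h p.2) (T, s))
      (timeMeasure.prod timeMeasure) :=
    hprod.indicator (measurableSet_le measurable_snd measurable_fst)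
  have h1 : ∀ T ∈ Icc (-1 : ℝ) 0, ((deriv η T : ℝ) : ℂ) * (∫ s in (-1 : ℝ)..T, h s) =
      ∫ s, {p : ℝ × ℝ | p.2 ≤ p.1}.indicator (fun p => ((deriv η p.1 : ℝ) : ℂ) * h p.2) (T, s)
        ∂timeMeasure := by
    intro T hT
    have h2 : ∀ s, {p : ℝ × ℝ | p.2 ≤ p.1}.indicator (fun p => ((deriv η p.1 : ℝ) : ℂ) * h p.2) (T, s) =
        ((deriv η T : ℝ) : ℂ) * (Iic T).indicator h s := by
      intro s
      by_cases hs : s ≤ T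
      · simp [indicator, hs]
      · simp [indicator, hs]
    simp only [h2]
    rw [integral_const_mul, integral_indicator measurableSet_Iic, timeMeasure,
      Measure.restrict_restrict measurableSet_Iic, intervalIntegral.integral_of_le hT.1,
      ← integral_Icc_eq_integral_Ioc]
    congr 3
    ext s
    simp only [mem_Icc, mem_inter_iff, mem_Iic]
    constructor
    · rintro ⟨h3, h4⟩; exact ⟨h4, h3, h4.trans hT.2⟩
    · rintro ⟨h3, h4, _⟩; exact ⟨h4, h3⟩
  have h2 : ∀ s ∈ Icc (-1 : ℝ) 0,
      ∫ T, {p : ℝ × ℝ | p.2 ≤ p.1}.indicator (fun p => ((deriv η p.1 : ℝ) : ℂ) * h p.2) (T, s)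
        ∂timeMeasure = -((η s : ℂ) * h s) := by
    intro s hs
    have h3 : ∀ T, {p : ℝ × ℝ | p.2 ≤ p.1}.indicator (fun p => ((deriv η p.1 : ℝ) : ℂ) * h p.2) (T, s) =
        (Ici s).indicator (fun T => ((deriv η T : ℝ) : ℂ)) T * h s := by
      intro T
      by_cases hT : s ≤ T
      · simp [indicator, hT]
      · simp [indicator, hT]
    simp only [h3]
    rw [integral_mul_const, integral_indicator measurableSet_Ici, timeMeasure,
      Measure.restrict_restrict measurableSet_Ici]
    have h4 : Ici s ∩ Icc (-1) 0 = Icc s 0 := by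
      ext T
      simp only [mem_Icc, mem_inter_iff, mem_Ici]
      constructor
      · rintro ⟨h3, _, h4⟩; exact ⟨h3, h4⟩
      · rintro ⟨h3, h4⟩; exact ⟨h3, hs.1.trans h3, h4⟩
    rw [h4, integral_Icc_eq_integral_Ioc, ← intervalIntegral.integral_of_le hs.2,
      intervalIntegral.integral_ofReal, intervalIntegral.integral_eq_sub_of_hasDerivAt
        (fun T _ => hη.hasDerivAt T) (hη'.intervalIntegrable _ _),
      hη.eq_zero (T := 0) (by simp)]
    push_cast
    ring
  rw [← integral_neg]
  calc _ = ∫ T, ∫ s, {p : ℝ × ℝ | p.2 ≤ p.1}.indicator (fun p => ((deriv η p.1 : ℝ) : ℂ) * h p.2) (T, s)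
        ∂timeMeasure ∂timeMeasure := by
        apply integral_congr_ae
        filter_upwards [ae_mem_Icc] with T hT using h1 T hT
    _ = _ := integral_integral_swap hind
    _ = _ := by
        apply integral_congr_ae
        filter_upwards [ae_mem_Icc] with s hs using h2 s hs

lemma exists_isTimeTest_integral_eq_one : ∃ ρ, IsTimeTest ρ ∧ ∫ T, ρ T ∂timeMeasure = 1 := by
  let b : ContDiffBump (-1 / 2 : ℝ) := ⟨1 / 8, 1 / 4, by norm_num, by norm_num⟩
  have hsupp : tsupport (b.normed volume) ⊆ Ioo (-1) 0 := by
    rw [b.tsupport_normed_eq, Real.closedBall_eq_Icc]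
    intro x hx
    have h1 : (-1 / 2 : ℝ) - 1 / 4 ≤ x := hx.1
    have h2 : x ≤ (-1 / 2 : ℝ) + 1 / 4 := hx.2
    constructor <;> linarith
  refine ⟨b.normed volume, ⟨b.contDiff_normed, b.hasCompactSupport_normed, hsupp⟩, ?_⟩
  rw [timeMeasure, setIntegral_eq_integral_of_forall_compl_eq_zero, b.integral_normed]
  intro x hx
  exact image_eq_zero_of_notMem_tsupport fun h => hx (Ioo_subset_Icc_self (hsupp h))

/-- A test function with zero mean is the derivative of a test function. -/
lemma IsTimeTest.exists_deriv_eq {ζ : ℝ → ℝ} (hζ : IsTimeTest ζ)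
    (h0 : ∫ T, ζ T ∂timeMeasure = 0) : ∃ η, IsTimeTest η ∧ deriv η = ζ := by
  have hc := hζ.1.continuous
  have hd : ∀ T, HasDerivAt (fun T => ∫ s in (-1 : ℝ)..T, ζ s) (ζ T) T := fun T =>
    intervalIntegral.integral_hasDerivAt_right (hc.intervalIntegrable _ _)
      (hc.stronglyMeasurableAtFilter _ _) hc.continuousAt
  have hderiv : deriv (fun T => ∫ s in (-1 : ℝ)..T, ζ s) = ζ := funext fun T => (hd T).deriv
  obtain ⟨a, b, ha, hb, hab⟩ : ∃ a b : ℝ, -1 < a ∧ b < 0 ∧ tsupport ζ ⊆ Icc a b := by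
    rcases (tsupport ζ).eq_empty_or_nonempty with he | hne
    · exact ⟨-1 / 2, -1 / 2, by norm_num, by norm_num, by simp [he]⟩
    · have hcomp : IsCompact (tsupport ζ) := hζ.2.1
      obtain ⟨x, hx, hx'⟩ := hcomp.exists_isLeast hne
      obtain ⟨y, hy, hy'⟩ := hcomp.exists_isGreatest hne
      exact ⟨x, y, (hζ.2.2 hx).1, (hζ.2.2 hy).2, fun z hz => ⟨hx' hz, hy' hz⟩⟩
  have hz : ∀ s ∉ Icc a b, ζ s = 0 := fun s hs =>
    image_eq_zero_of_notMem_tsupport fun h => hs (hab h)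
  have hzero : ∀ T ∉ Icc a b, ∫ s in (-1 : ℝ)..T, ζ s = 0 := by
    intro T hT
    rw [mem_Icc, not_and_or, not_le, not_le] at hT
    rcases hT with hT | hT
    · refine intervalIntegral.integral_zero_ae (Eventually.of_forall fun s hs => hz s fun h => ?_)
      have := (uIoc_subset_uIcc hs).2
      have h2 : max (-1) T < a := max_lt ha hT
      exact absurd (h.1.trans this) (not_le.2 h2)
    -- To the right of the support the primitive equals the total integral, which is zero by
    -- assumption.
    · rw [integral_timeMeasure] at h0
      rw [← intervalIntegral.integral_add_adjacent_intervals (b := 0) (hc.intervalIntegrable _ _)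
        (hc.intervalIntegrable _ _), h0, zero_add]
      refine intervalIntegral.integral_zero_ae (Eventually.of_forall fun s hs => hz s fun h => ?_)
      have := hs.1
      have h2 : b < min 0 T := lt_min hb hT
      exact absurd h.2 (not_le.2 (h2.trans this))
  have hsub : tsupport (fun T => ∫ s in (-1 : ℝ)..T, ζ s) ⊆ Icc a b :=
    closure_minimal (fun T hT => by_contra fun h => hT (hzero T h)) isClosed_Icc
  refine ⟨fun T => ∫ s in (-1 : ℝ)..T, ζ s, ⟨?_, ?_, hsub.trans fun x hx => ?_⟩, hderiv⟩
  · rw [contDiff_infty_iff_deriv, hderiv]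
    exact ⟨fun T => (hd T).differentiableAt, hζ.1⟩
  · exact isCompact_Icc.of_isClosed_subset (isClosed_tsupport _) hsub
  · exact ⟨ha.trans_le hx.1, hx.2.trans_lt hb⟩

/-- The lemma of du Bois-Reymond. -/
lemma exists_ae_eq_const {k : ℝ → ℂ} (hk : Integrable k timeMeasure)
    (h : ∀ η, IsTimeTest η → ∫ T, ((deriv η T : ℝ) : ℂ) * k T ∂timeMeasure = 0) :
    ∃ c : ℂ, ∀ᵐ T ∂timeMeasure, k T = c := by
  obtain ⟨ρ, hρ, hρ1⟩ := exists_isTimeTest_integral_eq_one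
  set c : ℂ := ∫ T, (ρ T : ℂ) * k T ∂timeMeasure with hc
  have hr : ∀ {a : ℝ → ℝ}, Continuous a → Integrable a timeMeasure := fun ha =>
    ha.integrableOn_Icc
  have key : ∀ θ, IsTimeTest θ → ∫ T, (θ T : ℂ) * (k T - c) ∂timeMeasure = 0 := by
    intro θ hθ
    set m : ℝ := ∫ T, θ T ∂timeMeasure with hm
    -- Subtracting m ρ makes the mean zero, so the result is the derivative of a test function and
    -- the hypothesis on k applies. The constant c is the ρ-average of k.
    have hζ : IsTimeTest (fun T => θ T - m * ρ T) := by
      have hsub : tsupport (fun T => θ T - m * ρ T) ⊆ tsupport θ ∪ tsupport ρ := by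
        refine closure_minimal (fun T hT => by_contra fun hn => hT ?_)
          ((isClosed_tsupport _).union (isClosed_tsupport _))
        rw [mem_union, not_or] at hn
        simp [image_eq_zero_of_notMem_tsupport hn.1, image_eq_zero_of_notMem_tsupport hn.2]
      refine ⟨hθ.1.sub (contDiff_const.mul hρ.1), ?_,
        hsub.trans (union_subset hθ.2.2 hρ.2.2)⟩
      exact (hθ.2.1.isCompact.union hρ.2.1.isCompact).of_isClosed_subset (isClosed_tsupport _) hsub
    obtain ⟨η, hη, hη'⟩ := hζ.exists_deriv_eq (by
      rw [integral_sub (hr hθ.1.continuous) ((hr hρ.1.continuous).const_mul m), integral_const_mul,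
        hρ1, mul_one, ← hm, sub_self])
    have h1 := h η hη
    have h2 : ∀ T, ((deriv η T : ℝ) : ℂ) * k T = (θ T : ℂ) * k T - (m : ℂ) * ((ρ T : ℂ) * k T) := by
      intro T
      rw [hη']
      push_cast
      ring
    simp only [h2] at h1
    have hθk := integrable_ofReal_mul hθ.1.continuous hk
    rw [integral_sub hθk ((integrable_ofReal_mul hρ.1.continuous hk).const_mul _),
      integral_const_mul, ← hc] at h1
    simp only [mul_sub]
    rw [integral_sub hθk (integrable_ofReal_mul hθ.1.continuous (integrable_const c)),
      integral_mul_const, integral_complex_ofReal, ← hm]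
    exact h1
  have hint : Integrable (fun T => k T - c) timeMeasure := hk.sub (integrable_const c)
  have hloc : LocallyIntegrableOn (fun T => k T - c) (Ioo (-1 : ℝ) 0) volume := by
    have : IntegrableOn (fun T => k T - c) (Icc (-1 : ℝ) 0) volume := hint
    exact (this.mono_set Ioo_subset_Icc_self).locallyIntegrableOn
  have h1 := isOpen_Ioo.ae_eq_zero_of_integral_contDiff_smul_eq_zero hloc fun g hg hg' hs => by
    have h2 := key g ⟨hg, hg', hs⟩
    rw [timeMeasure, setIntegral_eq_integral_of_forall_compl_eq_zero] at h2
    · simpa using h2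
    · intro x hx
      rw [image_eq_zero_of_notMem_tsupport fun h => hx (Ioo_subset_Icc_self (hs h))]
      simp
  refine ⟨c, ?_⟩
  rw [timeMeasure, ← Measure.restrict_congr_set Ioo_ae_eq_Icc, ae_restrict_iff' measurableSet_Ioo]
  filter_upwards [h1] with T hT hT' using sub_eq_zero.1 (hT hT')

lemma continuousOn_primitive {E : Type*} [NormedAddCommGroup E] [NormedSpace ℝ E] {h : ℝ → E}
    (hh : Integrable h timeMeasure) :
    ContinuousOn (fun T => ∫ s in (-1 : ℝ)..T, h s) (Icc (-1) 0) := by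
  have hu : uIcc (-1 : ℝ) 0 = Icc (-1) 0 := uIcc_of_le (by norm_num)
  have h1 := intervalIntegral.continuousOn_primitive_interval (a := (-1 : ℝ)) (b := 0)
    (μ := volume) (f := h) (by rw [hu]; exact hh)
  rwa [hu] at h1

lemma integrable_primitive {h : ℝ → ℂ} (hh : Integrable h timeMeasure) :
    Integrable (fun T => ∫ s in (-1 : ℝ)..T, h s) timeMeasure :=
  (continuousOn_primitive hh).integrableOn_Icc

/-- A function with an integrable weak derivative is a primitive of it. -/
lemma exists_ae_eq_const_add_integral {g h : ℝ → ℂ} (hg : Integrable g timeMeasure)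
    (hh : Integrable h timeMeasure)
    (hw : ∀ η, IsTimeTest η → ∫ T, ((deriv η T : ℝ) : ℂ) * g T ∂timeMeasure =
      -∫ T, (η T : ℂ) * h T ∂timeMeasure) :
    ∃ c : ℂ, ∀ᵐ T ∂timeMeasure, g T = c + ∫ s in (-1 : ℝ)..T, h s := by
  obtain ⟨c, hc⟩ := exists_ae_eq_const (hg.sub (integrable_primitive hh)) fun η hη => by
    simp only [Pi.sub_apply, mul_sub]
    rw [integral_sub (integrable_ofReal_mul hη.continuous_deriv hg)
      (integrable_ofReal_mul hη.continuous_deriv (integrable_primitive hh)), hw η hη,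
      hη.integral_deriv_mul_primitive hh, sub_self]
  refine ⟨c, ?_⟩
  filter_upwards [hc] with T hT
  rw [← hT, Pi.sub_apply, sub_add_cancel]

/-- Every neighbourhood of -1 meets [-1,0] in positive measure. Essential limits are therefore
unique, which identifies the constant of integration with the initial value. -/
instance neBot_initialTime : initialTime.NeBot := by
  rw [initialTime, inf_neBot_iff]
  intro s hs t ht
  obtain ⟨ε, hε, hs'⟩ := Metric.mem_nhds_iff.1 hs
  have h1 : ∀ᵐ T, T ∈ Icc (-1 : ℝ) 0 → T ∈ t := ae_timeMeasure_iff.1 ht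
  have h2 : (volume : Measure ℝ) (Ioo (-1 : ℝ) (min 0 (-1 + ε))) ≠ 0 := by
    have h3 : (-1 : ℝ) < min 0 (-1 + ε) := lt_min (by norm_num) (by linarith)
    rw [Real.volume_Ioo, ENNReal.ofReal_ne_zero_iff]
    exact sub_pos.2 h3
  obtain ⟨T, hT, hT'⟩ := (frequently_ae_mem_iff.2 h2 |>.and_eventually h1).exists
  have h3 : T < 0 := hT.2.trans_le (min_le_left _ _)
  have h4 : T < -1 + ε := hT.2.trans_le (min_le_right _ _)
  refine ⟨T, hs' ?_, hT' ⟨hT.1.le, h3.le⟩⟩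
  rw [Metric.mem_ball, Real.dist_eq, abs_lt]
  constructor <;> linarith [hT.1]

lemma initialTime_le_nhdsWithin : initialTime ≤ 𝓝[Icc (-1) 0] (-1) := by
  rw [initialTime, nhdsWithin]
  exact inf_le_inf_left _ (le_principal_iff.2 ae_mem_Icc)

lemma tendsto_primitive_initialTime {E : Type*} [NormedAddCommGroup E] [NormedSpace ℝ E]
    {h : ℝ → E} (hh : Integrable h timeMeasure) :
    Tendsto (fun T => ∫ s in (-1 : ℝ)..T, h s) initialTime (𝓝 0) := by
  have h2 := continuousOn_primitive hh (-1) ⟨le_rfl, by norm_num⟩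
  rw [ContinuousWithinAt, intervalIntegral.integral_same] at h2
  exact h2.mono_left initialTime_le_nhdsWithin

/-- A converse of `exists_ae_eq_const_add_integral`: it verifies the weak derivatives of the
constructed solution. -/
lemma IsTimeTest.integral_deriv_mul_of_eq {η : ℝ → ℝ} (hη : IsTimeTest η) {g h : ℝ → ℂ} {c : ℂ}
    (hh : Integrable h timeMeasure)
    (hg : ∀ᵐ T ∂timeMeasure, g T = c + ∫ s in (-1 : ℝ)..T, h s) :
    ∫ T, ((deriv η T : ℝ) : ℂ) * g T ∂timeMeasure = -∫ T, (η T : ℂ) * h T ∂timeMeasure := by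
  rw [← hη.integral_deriv_mul_primitive hh]
  have h0 : ∫ T, ((deriv η T : ℝ) : ℂ) * c ∂timeMeasure = 0 := by
    rw [integral_mul_const, integral_timeMeasure, intervalIntegral.integral_ofReal,
      intervalIntegral.integral_eq_sub_of_hasDerivAt (fun T _ => hη.hasDerivAt T)
        (hη.continuous_deriv.intervalIntegrable _ _), hη.eq_zero (T := 0) (by simp),
      hη.eq_zero (T := -1) (by simp)]
    simp
  have h1 : ∫ T, ((deriv η T : ℝ) : ℂ) * g T ∂timeMeasure = ∫ T, (((deriv η T : ℝ) : ℂ) * c +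
      ((deriv η T : ℝ) : ℂ) * ∫ s in (-1 : ℝ)..T, h s) ∂timeMeasure := by
    apply integral_congr_ae
    filter_upwards [hg] with T hT
    rw [hT, mul_add]
  rw [h1, integral_add (integrable_ofReal_mul hη.continuous_deriv (integrable_const c))
    (integrable_ofReal_mul hη.continuous_deriv (integrable_primitive hh)), h0, zero_add]

/-- A function with an integrable weak derivative is its initial value plus the primitive of its
derivative. -/
lemma ae_eq_add_integral_of_tendsto {g h : ℝ → ℂ} {c₀ : ℂ} (hg : Integrable g timeMeasure)
    (hh : Integrable h timeMeasure)
    (hw : ∀ η, IsTimeTest η → ∫ T, ((deriv η T : ℝ) : ℂ) * g T ∂timeMeasure =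
      -∫ T, (η T : ℂ) * h T ∂timeMeasure) (h0 : Tendsto g initialTime (𝓝 c₀)) :
    ∀ᵐ T ∂timeMeasure, g T = c₀ + ∫ s in (-1 : ℝ)..T, h s := by
  obtain ⟨c, hc⟩ := exists_ae_eq_const_add_integral hg hh hw
  have h1 : Tendsto g initialTime (𝓝 (c + 0)) := by
    refine (tendsto_const_nhds.add (tendsto_primitive_initialTime hh)).congr' ?_
    have : ∀ᶠ T in initialTime, g T = c + ∫ s in (-1 : ℝ)..T, h s := by
      rw [initialTime]
      exact Filter.Eventually.filter_mono inf_le_right hc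
    filter_upwards [this] with T hT using hT.symm
  have h2 := tendsto_nhds_unique h1 h0
  rw [add_zero] at h2
  rwa [← h2]

end WeakTimeDerivative

/-! ### Test functions on the slice and their density in L² -/

section TestFunctions

lemma isOpen_positive : IsOpen (Ioi (0 : ℝ) ×ˢ (univ : Set S2)) := isOpen_Ioi.prod isOpen_univ

lemma IsTest.add {v w : Slice → ℂ} (hv : IsTest v) (hw : IsTest w) : IsTest (v + w) :=
  ⟨hv.1.add hw.1, hv.2.1.add hw.2.1,
    (tsupport_add v w).trans (union_subset hv.2.2 hw.2.2)⟩

lemma IsTest.const_mul {v : Slice → ℂ} (hv : IsTest v) (c : ℂ) : IsTest (fun p => c * v p) := by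
  have hsub : tsupport (fun p => c * v p) ⊆ tsupport v :=
    closure_mono fun p hp hv => hp (by simp [hv])
  refine ⟨?_, hv.2.1.of_isClosed_subset (isClosed_tsupport _) hsub, hsub.trans hv.2.2⟩
  have : ContDiff ℝ ∞ fun z : ℂ => c * z := contDiff_const.mul contDiff_id
  exact this.contMDiff.comp hv.1

lemma isTest_zero : IsTest 0 :=
  ⟨contMDiff_const, HasCompactSupport.zero, by simp⟩

lemma isTest_ofReal {g : Slice → ℝ} (hg : ContMDiff (𝓘(ℝ, ℝ).prod (𝓡 2)) 𝓘(ℝ, ℝ) ∞ g)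
    (hc : HasCompactSupport g) (hs : tsupport g ⊆ Ioi 0 ×ˢ univ) :
    IsTest fun p => (g p : ℂ) := by
  have hsub : tsupport (fun p => (g p : ℂ)) ⊆ tsupport g :=
    closure_mono fun p hp hg => hp (by simp [hg])
  refine ⟨?_, hc.of_isClosed_subset (isClosed_tsupport _) hsub, hsub.trans hs⟩
  exact (Complex.ofRealCLM.contDiff (n := ∞)).contMDiff.comp hg

/-- The fundamental lemma of the calculus of variations on `(0,∞) × S²`. -/
lemma ae_eq_zero_of_forall_isTest {f : Slice → ℂ} (hf : LocallyIntegrable f sliceMeasure)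
    (h : ∀ v, IsTest v → ∫ p, f p * conj (v p) ∂sliceMeasure = 0) :
    f =ᵐ[sliceMeasure] 0 := by
  have h1 := isOpen_positive.ae_eq_zero_of_integral_contMDiff_smul_eq_zero
    (𝓘(ℝ, ℝ).prod (𝓡 2)) (hf.locallyIntegrableOn _) fun g hg hc hs => by
      rw [← h _ (isTest_ofReal hg hc hs)]
      refine integral_congr_ae (Eventually.of_forall fun p => ?_)
      simp [mul_comm]
  filter_upwards [h1, ae_pos] with p hp hp' using hp ⟨hp', mem_univ _⟩

lemma integral_mul_conj_eq_inner (a : L2) {g : Slice → ℂ} (hg : MemLp g 2 sliceMeasure) :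
    ∫ p, a p * conj (g p) ∂sliceMeasure = inner ℂ (hg.toLp g) a := by
  rw [L2.inner_def]
  refine integral_congr_ae ?_
  filter_upwards [hg.coeFn_toLp] with p hp
  rw [hp, RCLike.inner_apply]

/-- Test functions, as elements of `L²(Σ)`. -/
def testSubmodule : Submodule ℂ L2 where
  carrier := {x | ∃ v, IsTest v ∧ x =ᵐ[sliceMeasure] v}
  zero_mem' := ⟨0, isTest_zero, Lp.coeFn_zero _ _ _⟩
  add_mem' := by
    rintro x y ⟨v, hv, hxv⟩ ⟨w, hw, hyw⟩
    exact ⟨v + w, hv.add hw, (Lp.coeFn_add x y).trans (hxv.add hyw)⟩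
  smul_mem' := by
    rintro c x ⟨v, hv, hxv⟩
    refine ⟨fun p => c * v p, hv.const_mul c, ?_⟩
    filter_upwards [Lp.coeFn_smul c x, hxv] with p h1 h2
    rw [h1, Pi.smul_apply, h2, smul_eq_mul]

lemma IsTest.toLp_mem {v : Slice → ℂ} (hv : IsTest v) : hv.memLp.toLp v ∈ testSubmodule :=
  ⟨v, hv, hv.memLp.coeFn_toLp⟩

lemma exists_isTest_of_mem {x : L2} (hx : x ∈ testSubmodule) :
    ∃ v, ∃ hv : IsTest v, x = hv.memLp.toLp v := by
  obtain ⟨v, hv, h⟩ := hx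
  exact ⟨v, hv, Lp.ext (h.trans hv.memLp.coeFn_toLp.symm)⟩

/-- A vector orthogonal to all test functions vanishes by the fundamental lemma of the calculus of
variations. -/
lemma testSubmodule_topologicalClosure : testSubmodule.topologicalClosure = ⊤ := by
  rw [Submodule.topologicalClosure_eq_top_iff, Submodule.eq_bot_iff]
  intro x hx
  rw [Lp.eq_zero_iff_ae_eq_zero]
  refine ae_eq_zero_of_forall_isTest ((Lp.memLp x).locallyIntegrable one_le_two) fun v hv => ?_
  rw [integral_mul_conj_eq_inner x hv.memLp]
  exact (Submodule.mem_orthogonal _ _).1 hx _ hv.toLp_mem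

lemma dense_testSubmodule : Dense (testSubmodule : Set L2) :=
  Submodule.dense_iff_topologicalClosure_eq_top.2 testSubmodule_topologicalClosure

lemma continuous_ofReal_fst : Continuous fun p : Slice => (p.1 : ℂ) :=
  Complex.continuous_ofReal.comp continuous_fst

lemma IsTest.memLp_fst_mul {v : Slice → ℂ} (hv : IsTest v) :
    MemLp (fun p => (p.1 : ℂ) * v p) 2 sliceMeasure :=
  memLp_of_tsupport hv.2.1 hv.2.2
    (fun _ _ => (continuous_ofReal_fst.mul hv.1.continuous).continuousAt)
    (fun p hp => by simp [image_eq_zero_of_notMem_tsupport hp])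

lemma IsTest.memLp_fst_mul_twistedDeriv {v : Slice → ℂ} (hv : IsTest v) (α : ℝ) :
    MemLp (fun p => (p.1 : ℂ) * twistedDeriv α v p) 2 sliceMeasure := by
  set g : Slice → ℂ := fun p =>
    (p.1 : ℂ) * deriv (fun R : ℝ => v (R, p.2)) p.1 + (α : ℂ) * v p with hg
  have hmem : MemLp g 2 sliceMeasure := by
    refine memLp_of_tsupport hv.2.1 hv.2.2 (fun p hp => ?_) (fun p hp => ?_)
    · exact ((continuous_ofReal_fst.mul (continuous_radialDeriv hv.1)).add
        (continuous_const.mul hv.1.continuous)).continuousAt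
    · have h1 : v p = 0 := image_eq_zero_of_notMem_tsupport hp
      simp [hg, h1, IsTest.deriv_eq_zero hp]
  refine hmem.ae_eq ?_
  filter_upwards [ae_pos] with p hp
  have hp' : (p.1 : ℂ) ≠ 0 := by exact_mod_cast hp.ne'
  rw [twistedDeriv_eq hv.1 α hp, hg]
  push_cast
  field_simp

lemma locallyIntegrable_fst_mul (a : L2) :
    LocallyIntegrable (fun p => (p.1 : ℂ) * a p) sliceMeasure := by
  have h := (Lp.memLp a).locallyIntegrable one_le_two
  rw [← locallyIntegrableOn_univ] at h ⊢
  exact h.continuousOn_mul continuous_ofReal_fst.continuousOn isOpen_univ.isLocallyClosed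

lemma integral_fst_mul_mul_conj (a : L2) {g : Slice → ℂ}
    (hg : MemLp (fun p => (p.1 : ℂ) * g p) 2 sliceMeasure) :
    ∫ p, (p.1 : ℂ) * a p * conj (g p) ∂sliceMeasure =
      inner ℂ (hg.toLp fun p => (p.1 : ℂ) * g p) a := by
  rw [← integral_mul_conj_eq_inner]
  refine integral_congr_ae (Eventually.of_forall fun p => ?_)
  simp only [map_mul, Complex.conj_ofReal]
  ring

/-- The relation `R a = h` between elements of `L²(Σ)`, tested against test functions. -/
lemma ae_fst_mul_eq_iff (a h : L2) :
    (fun p => (p.1 : ℂ) * a p) =ᵐ[sliceMeasure] h ↔ ∀ v, ∀ hv : IsTest v,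
      (inner ℂ (hv.memLp_fst_mul.toLp fun p => (p.1 : ℂ) * v p) a : ℂ) =
        inner ℂ (hv.memLp.toLp v) h := by
  have key : ∀ v, ∀ hv : IsTest v, ∫ p, ((p.1 : ℂ) * a p - h p) * conj (v p) ∂sliceMeasure =
      (inner ℂ (hv.memLp_fst_mul.toLp fun p => (p.1 : ℂ) * v p) a : ℂ) -
        inner ℂ (hv.memLp.toLp v) h := by
    intro v hv
    rw [← integral_fst_mul_mul_conj, ← integral_mul_conj_eq_inner, ← integral_sub]
    · simp only [sub_mul]
    · refine ((Lp.memLp a).integrable_mul hv.memLp_fst_mul.star).congr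
        (Eventually.of_forall fun p => ?_)
      simp only [Pi.mul_apply, Pi.star_apply, RCLike.star_def, map_mul, Complex.conj_ofReal]
      ring
    · exact hv.integrable_mul h
  constructor
  · intro heq v hv
    rw [← sub_eq_zero, ← key v hv]
    apply integral_eq_zero_of_ae
    filter_upwards [heq] with p hp
    simp [hp]
  · intro heq
    have h1 := ae_eq_zero_of_forall_isTest
      ((locallyIntegrable_fst_mul a).sub ((Lp.memLp h).locallyIntegrable one_le_two))
      fun v hv => (key v hv).trans (sub_eq_zero.2 (heq v hv))
    filter_upwards [h1] with p hp using sub_eq_zero.1 hp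

end TestFunctions

/-! ### Completeness of H¹ -/

section Completeness

/-- A convergent sequence in L² has a subsequence converging almost everywhere. -/
lemma isClosed_setOf_ae_mem {α E : Type*} [MeasurableSpace α] {μ : Measure α}
    [NormedAddCommGroup E] {P : α → Set E} (hP : ∀ p, IsClosed (P p)) :
    IsClosed {f : Lp E 2 μ | ∀ᵐ p ∂μ, f p ∈ P p} := by
  refine IsSeqClosed.isClosed fun f g hf hfg => ?_
  obtain ⟨ns, -, hns⟩ := (tendstoInMeasure_of_tendsto_Lp hfg).exists_seq_tendsto_ae
  have h1 : ∀ᵐ p ∂μ, ∀ n, f n p ∈ P p := ae_all_iff.2 hf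
  filter_upwards [hns, h1] with p hp hp'
  exact (hP p).mem_of_tendsto hp (Eventually.of_forall fun n => hp' _)

lemma IsTestField.memLp_fst_smul {X : Slice → EuclideanSpace ℂ (Fin 3)} (hX : IsTestField X) :
    MemLp (fun p => (p.1 : ℂ) • X p) 2 sliceMeasure :=
  memLp_of_tsupport hX.2.1 hX.2.2.1
    (fun _ _ => (continuous_ofReal_fst.smul hX.1.continuous).continuousAt)
    (fun p hp => by simp [image_eq_zero_of_notMem_tsupport hp])

lemma IsTestField.memLp_fst_mul_sphereDiv {X : Slice → EuclideanSpace ℂ (Fin 3)}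
    (hX : IsTestField X) : MemLp (fun p : Slice => (p.1 : ℂ) * sphereDiv X p) 2 sliceMeasure :=
  memLp_of_tsupport hX.2.1 hX.2.2.1
    (fun _ _ => (continuous_ofReal_fst.mul (continuous_sphereDiv hX)).continuousAt)
    (fun p hp => by simp [sphereDiv_eq_zero hp])

lemma IsTestField.integral_eq_inner {X : Slice → EuclideanSpace ℂ (Fin 3)} (hX : IsTestField X)
    (G : L2Field) : ∫ p, ∑ k, ((p.1 : ℂ) • G p) k * conj (X p k) ∂sliceMeasure =
      inner ℂ (hX.memLp_fst_smul.toLp fun p => (p.1 : ℂ) • X p) G := by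
  rw [L2.inner_def]
  refine integral_congr_ae ?_
  filter_upwards [hX.memLp_fst_smul.coeFn_toLp] with p hp
  rw [hp, PiLp.inner_apply]
  refine Finset.sum_congr rfl fun k _ => ?_
  simp only [RCLike.inner_apply, PiLp.smul_apply, smul_eq_mul, map_mul, Complex.conj_ofReal]
  ring

/-- Each integral condition equates continuous functionals of the triple, namely inner products with
fixed elements of L²; the factor R is harmless since test objects have compact support. Tangency is
a pointwise closed condition. -/
lemma isClosed_H1 : IsClosed (twistedH1 0 : Set Triple) := by
  have hfst : Continuous fun u : Triple => u.fst := (WithLp.prod_continuous_ofLp 2 _ _).fst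
  have hsnd : Continuous fun u : Triple => u.snd := (WithLp.prod_continuous_ofLp 2 _ _).snd
  have hsf : Continuous fun u : Triple => u.snd.fst :=
    (WithLp.prod_continuous_ofLp 2 _ _).fst.comp hsnd
  have hss : Continuous fun u : Triple => u.snd.snd :=
    (WithLp.prod_continuous_ofLp 2 _ _).snd.comp hsnd
  have h1 : IsClosed {u : Triple |
      IsWeakTwistedDeriv 0 (fun p => (p.1 : ℂ) * u.fst p) u.snd.fst} := by
    simp only [IsWeakTwistedDeriv, Set.ofPred_forall]
    refine isClosed_iInter fun v => isClosed_iInter fun hv => ?_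
    simp only [integral_mul_conj_eq_inner _ hv.memLp,
      integral_fst_mul_mul_conj _ (hv.memLp_fst_mul_twistedDeriv (1 - 0))]
    exact isClosed_eq (continuous_const.inner hsf) (continuous_const.inner hfst).neg
  have h2 : IsClosed {u : Triple |
      ∀ᵐ p ∂sliceMeasure, ∑ k, ((p.2 : E3) k : ℂ) * ((p.1 : ℂ) • u.snd.snd p) k = 0} := by
    have h3 : IsClosed {G : L2Field | ∀ᵐ p ∂sliceMeasure,
        G p ∈ {x : EuclideanSpace ℂ (Fin 3) | ∑ k, ((p.2 : E3) k : ℂ) * ((p.1 : ℂ) • x) k = 0}} :=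
      isClosed_setOf_ae_mem fun p => isClosed_eq (by fun_prop) continuous_const
    exact h3.preimage hss
  have h3 : IsClosed {u : Triple | ∀ X, IsTestField X →
      ∫ p, ∑ k, ((p.1 : ℂ) • u.snd.snd p) k * conj (X p k) ∂sliceMeasure =
        -∫ p, (p.1 : ℂ) * u.fst p * conj (sphereDiv X p) ∂sliceMeasure} := by
    simp only [Set.ofPred_forall]
    refine isClosed_iInter fun X => isClosed_iInter fun hX => ?_
    simp only [hX.integral_eq_inner, integral_fst_mul_mul_conj _ hX.memLp_fst_mul_sphereDiv]
    exact isClosed_eq (continuous_const.inner hss) (continuous_const.inner hfst).neg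
  exact h1.inter (h2.inter h3)

instance completeSpace_H1 : CompleteSpace H1 := isClosed_H1.completeSpace_coe

end Completeness

/-! ### The unitary group of dilations -/

section Dilation

/-- The dilation `(R, ω) ↦ (c R, ω)`. -/
def dilation {c : ℝ} (hc : c ≠ 0) : Slice ≃ₜ Slice :=
  (Homeomorph.mulLeft₀ c hc).prodCongr (Homeomorph.refl S2)

lemma dilation_apply {c : ℝ} (hc : c ≠ 0) (p : Slice) : dilation hc p = (c * p.1, p.2) := rfl

lemma radialMeasure_eq : radialMeasure = volume.withDensity fun R => ENNReal.ofReal R := by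
  rw [radialMeasure, ← restrict_withDensity measurableSet_Ioi]
  refine Measure.restrict_eq_self_of_ae_mem ?_
  rw [ae_withDensity_iff ENNReal.measurable_ofReal]
  refine Eventually.of_forall fun R hR => ?_
  rwa [ne_eq, ENNReal.ofReal_eq_zero, not_le] at hR

/-- One factor c⁻¹ comes from dR and one from the weight R. -/
lemma map_mul_radialMeasure {c : ℝ} (hc : 0 < c) :
    radialMeasure.map (c * ·) = ENNReal.ofReal (c⁻¹ ^ 2) • radialMeasure := by
  have hm : Measurable fun R : ℝ => c * R := measurable_const_mul c
  ext A hA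
  rw [Measure.map_apply hm hA, Measure.smul_apply, radialMeasure_eq,
    withDensity_apply _ (hm hA), withDensity_apply _ hA, ← lintegral_indicator (hm hA),
    ← lintegral_indicator hA]
  have h1 : ∀ R : ℝ, ((fun R => c * R) ⁻¹' A).indicator (fun R => ENNReal.ofReal R) R =
      ENNReal.ofReal c⁻¹ * A.indicator (fun R => ENNReal.ofReal R) (c * R) := by
    intro R
    by_cases hR : c * R ∈ A
    · rw [indicator_of_mem hR, indicator_of_mem (show R ∈ (fun R => c * R) ⁻¹' A from hR),
        ← ENNReal.ofReal_mul (by positivity)]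
      congr 1
      field_simp
    · rw [indicator_of_notMem hR,
        indicator_of_notMem (show R ∉ (fun R => c * R) ⁻¹' A from hR), mul_zero]
  have h2 : Measurable (A.indicator fun R => ENNReal.ofReal R) :=
    ENNReal.measurable_ofReal.indicator hA
  simp only [h1]
  rw [lintegral_const_mul _ (show Measurable fun R => A.indicator (fun R => ENNReal.ofReal R) (c * R)
    from h2.comp hm), ← lintegral_map h2 hm, Real.map_volume_mul_left hc.ne',
    lintegral_smul_measure, abs_of_pos (inv_pos.2 hc), smul_eq_mul, smul_eq_mul, ← mul_assoc,
    ← ENNReal.ofReal_mul (by positivity), sq]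

lemma map_dilation {c : ℝ} (hc : 0 < c) :
    sliceMeasure.map (dilation hc.ne') = ENNReal.ofReal (c⁻¹ ^ 2) • sliceMeasure := by
  have h1 : (dilation hc.ne' : Slice → Slice) = Prod.map (c * ·) id := rfl
  rw [h1, sliceMeasure, ← Measure.map_prod_map _ _ (measurable_const_mul c) measurable_id,
    Measure.map_id, map_mul_radialMeasure hc, Measure.prod_smul_left]

lemma integral_comp_dilation {c : ℝ} (hc : 0 < c) (f : Slice → ℂ) :
    ∫ p, f (dilation hc.ne' p) ∂sliceMeasure = (c⁻¹ ^ 2 : ℝ) • ∫ p, f p ∂sliceMeasure := by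
  rw [← (dilation hc.ne').measurableEmbedding.integral_map, map_dilation hc,
    integral_smul_measure, ENNReal.toReal_ofReal (by positivity)]

/-- The unitary dilation `f ↦ c f(c R, ω)` of `L²(Σ)`. -/
def dilate (c : ℝ) (f : Slice → ℂ) (p : Slice) : ℂ := (c : ℂ) * f (c * p.1, p.2)

/-- The prefactor c in `dilate` cancels the square root of the Jacobian c⁻². -/
lemma eLpNorm_dilate {c : ℝ} (hc : 0 < c) (f : Slice → ℂ) :
    eLpNorm (dilate c f) 2 sliceMeasure = eLpNorm f 2 sliceMeasure := by
  have h1 : dilate c f = (c : ℂ) • (f ∘ dilation hc.ne') := rfl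
  have h0 : ENNReal.ofReal (c⁻¹ ^ 2) ≠ 0 := by
    rw [ENNReal.ofReal_ne_zero_iff]; positivity
  rw [h1, eLpNorm_const_smul,
    ← (dilation hc.ne').measurableEmbedding.eLpNorm_map_measure, map_dilation hc,
    eLpNorm_smul_measure_of_ne_zero h0, smul_eq_mul, ← mul_assoc]
  have h2 : ‖(c : ℂ)‖ₑ * ENNReal.ofReal (c⁻¹ ^ 2) ^ (1 / (2 : ℝ≥0∞)).toReal = 1 := by
    rw [← ofReal_norm, Complex.norm_of_nonneg hc.le, ENNReal.ofReal_rpow_of_nonneg (by positivity)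
      (by positivity), ← ENNReal.ofReal_mul hc.le]
    have h3 : (1 / (2 : ℝ≥0∞)).toReal = (1 / 2 : ℝ) := by simp
    rw [h3, ← Real.sqrt_eq_rpow, Real.sqrt_sq (by positivity), mul_inv_cancel₀ hc.ne',
      ENNReal.ofReal_one]
  rw [h2, one_mul]

lemma memLp_dilate {c : ℝ} (hc : 0 < c) {f : Slice → ℂ} (hf : MemLp f 2 sliceMeasure) :
    MemLp (dilate c f) 2 sliceMeasure := by
  refine ⟨?_, (eLpNorm_dilate hc f).trans_lt hf.2⟩
  have h1 : AEStronglyMeasurable (f ∘ dilation hc.ne') sliceMeasure := by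
    refine AEStronglyMeasurable.comp_aemeasurable ?_ (dilation hc.ne').measurable.aemeasurable
    rw [map_dilation hc]
    exact hf.1.smul_measure _
  exact h1.const_smul (c : ℂ)

lemma integral_dilate_mul_conj {c : ℝ} (hc : 0 < c) (f v : Slice → ℂ) :
    ∫ p, dilate c f p * conj (v p) ∂sliceMeasure =
      ∫ p, f p * conj (dilate c⁻¹ v p) ∂sliceMeasure := by
  have h1 := integral_comp_dilation hc fun p => (c : ℂ) ^ 2 * (f p * conj (dilate c⁻¹ v p))
  rw [integral_const_mul _ (fun p => f p * conj (dilate c⁻¹ v p)), Complex.real_smul,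
    ← mul_assoc] at h1
  have hc' : (c : ℂ) ≠ 0 := by exact_mod_cast hc.ne'
  have h2 : ((c⁻¹ ^ 2 : ℝ) : ℂ) * (c : ℂ) ^ 2 = 1 := by
    push_cast
    field_simp
  rw [h2, one_mul] at h1
  rw [← h1]
  refine integral_congr_ae (Eventually.of_forall fun p => ?_)
  simp only [dilate, dilation_apply, map_mul, map_inv₀, Complex.conj_ofReal,
    Complex.ofReal_inv]
  rw [inv_mul_cancel_left₀ hc.ne']
  field_simp

lemma isTest_dilate {v : Slice → ℂ} (hv : IsTest v) {c : ℝ} (hc : 0 < c) :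
    IsTest (dilate c v) := by
  suffices h : IsTest (v ∘ dilation hc.ne') from h.const_mul c
  have hd : ContMDiff (𝓘(ℝ, ℝ).prod (𝓡 2)) (𝓘(ℝ, ℝ).prod (𝓡 2)) ∞ (dilation hc.ne') := by
    have h1 : ContMDiff 𝓘(ℝ, ℝ) 𝓘(ℝ, ℝ) ∞ fun R : ℝ => c * R :=
      (contDiff_const.mul contDiff_id).contMDiff
    exact (h1.comp contMDiff_fst).prodMk contMDiff_snd
  refine ⟨hv.1.comp hd, hv.2.1.comp_homeomorph _, ?_⟩
  rw [tsupport_comp_eq_preimage]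
  intro p hp
  have h2 : 0 < c * p.1 := (hv.2.2 hp).1
  exact ⟨(pos_iff_pos_of_mul_pos h2).1 hc, mem_univ _⟩

/-- The radial derivative. -/
def radialDeriv (v : Slice → ℂ) (p : Slice) : ℂ := deriv (fun R : ℝ => v (R, p.2)) p.1

lemma IsTest.hasDerivAt_radialDeriv {v : Slice → ℂ} (hv : IsTest v) (p : Slice) :
    HasDerivAt (fun R : ℝ => v (R, p.2)) (radialDeriv v p) p.1 :=
  (hasDerivAt_radial hv.1 p).differentiableAt.hasDerivAt

lemma radialDeriv_dilate {v : Slice → ℂ} (hv : IsTest v) (c : ℝ) (p : Slice) :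
    radialDeriv (dilate c v) p = (c : ℂ) * (c • radialDeriv v (c * p.1, p.2)) := by
  have h1 := (hasDerivAt_id p.1).const_mul c
  rw [mul_one] at h1
  have h2 : HasDerivAt (fun R : ℝ => v (c * R, p.2)) (c • radialDeriv v (c * p.1, p.2)) p.1 :=
    (hv.hasDerivAt_radialDeriv (c * p.1, p.2)).scomp p.1 h1
  exact (h2.const_mul _).deriv

/-- The function `v + R ∂_R v`, which generates the dilations. -/
def eulerDeriv (v : Slice → ℂ) (p : Slice) : ℂ := v p + (p.1 : ℂ) * radialDeriv v p

lemma eulerDeriv_dilate {v : Slice → ℂ} (hv : IsTest v) (c : ℝ) (p : Slice) :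
    eulerDeriv (dilate c v) p = dilate c (eulerDeriv v) p := by
  rw [eulerDeriv, radialDeriv_dilate hv, dilate, dilate, eulerDeriv, Complex.real_smul]
  push_cast
  ring

/-- This links dilations to weak derivatives: the weak ∂_R is tested against ∂_R^1 v, and R ∂_R^1 v
is the generator of dilations applied to v. -/
lemma IsTest.eulerDeriv_eq {v : Slice → ℂ} (hv : IsTest v) {p : Slice} (hp : 0 < p.1) :
    eulerDeriv v p = (p.1 : ℂ) * twistedDeriv 1 v p := by
  have hp' : (p.1 : ℂ) ≠ 0 := by exact_mod_cast hp.ne'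
  rw [twistedDeriv_eq hv.1 1 hp, eulerDeriv, radialDeriv]
  push_cast
  field_simp
  ring

lemma IsTest.continuous_eulerDeriv {v : Slice → ℂ} (hv : IsTest v) : Continuous (eulerDeriv v) :=
  hv.1.continuous.add (continuous_ofReal_fst.mul (continuous_radialDeriv hv.1))

lemma IsTest.eulerDeriv_eq_zero {v : Slice → ℂ} {p : Slice} (hp : p ∉ tsupport v) :
    eulerDeriv v p = 0 := by
  simp [eulerDeriv, radialDeriv, image_eq_zero_of_notMem_tsupport hp, IsTest.deriv_eq_zero hp]

lemma IsTest.hasDerivAt_dilate_exp {v : Slice → ℂ} (hv : IsTest v) (p : Slice) (s : ℝ) :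
    HasDerivAt (fun s : ℝ => dilate (Real.exp (-s)) v p)
      (-(dilate (Real.exp (-s)) (eulerDeriv v) p)) s := by
  have h1 : HasDerivAt (fun s : ℝ => Real.exp (-s)) (-Real.exp (-s)) s := by
    have := (Real.hasDerivAt_exp (-s)).comp s (hasDerivAt_neg s)
    rwa [mul_neg_one] at this
  have h2 : HasDerivAt (fun s : ℝ => v (Real.exp (-s) * p.1, p.2))
      ((-Real.exp (-s) * p.1 : ℝ) • radialDeriv v (Real.exp (-s) * p.1, p.2)) s :=
    HasDerivAt.scomp (g₁ := fun R : ℝ => v (R, p.2)) s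
      (hv.hasDerivAt_radialDeriv (Real.exp (-s) * p.1, p.2)) (h1.mul_const p.1)
  refine (h1.ofReal_comp.mul h2).congr_deriv ?_
  rw [dilate, eulerDeriv, Complex.real_smul]
  push_cast
  ring

/-- The derivative of the pairing of an element of `L²(Σ)` with a dilated test function. -/
lemma IsTest.hasDerivAt_integral_dilate {v : Slice → ℂ} (hv : IsTest v) (a : L2) (s₀ : ℝ) :
    HasDerivAt (fun s : ℝ => ∫ p, a p * conj (dilate (Real.exp (-s)) v p) ∂sliceMeasure)
      (∫ p, a p * conj (-(dilate (Real.exp (-s₀)) (eulerDeriv v) p)) ∂sliceMeasure) s₀ := by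
  have hcont : Continuous fun x : ℝ × Slice => dilate (Real.exp (-x.1)) (eulerDeriv v) x.2 := by
    have h1 : Continuous fun x : ℝ × Slice => ((Real.exp (-x.1) * x.2.1, x.2.2) : Slice) := by
      fun_prop
    have h2 : Continuous fun x : ℝ × Slice => (Real.exp (-x.1) : ℂ) := by fun_prop
    exact h2.mul (hv.continuous_eulerDeriv.comp h1)
  -- K is swept out by the supports of the dilated test functions for |s - s₀| ≤ 1. Its compactness
  -- supplies the dominating function.
  set K : Set Slice := (fun x : ℝ × Slice => ((Real.exp x.1 * x.2.1, x.2.2) : Slice)) ''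
    (Icc (s₀ - 1) (s₀ + 1) ×ˢ tsupport v) with hK
  have hKc : IsCompact K := (isCompact_Icc.prod hv.2.1).image (by fun_prop)
  obtain ⟨C, hC⟩ := (isCompact_Icc.prod hKc).exists_bound_of_continuousOn
    (s := Icc (s₀ - 1) (s₀ + 1) ×ˢ K) hcont.continuousOn
  have hzero : ∀ s ∈ Icc (s₀ - 1) (s₀ + 1), ∀ p ∉ K, dilate (Real.exp (-s)) (eulerDeriv v) p = 0 := by
    intro s hs p hp
    have h1 : ((Real.exp (-s) * p.1, p.2) : Slice) ∉ tsupport v := by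
      intro h2
      refine hp ⟨(s, (Real.exp (-s) * p.1, p.2)), ⟨hs, h2⟩, ?_⟩
      have h3 : Real.exp s * (Real.exp (-s) * p.1) = p.1 := by
        rw [← mul_assoc, ← Real.exp_add]
        simp
      simp [h3]
    rw [dilate, IsTest.eulerDeriv_eq_zero h1, mul_zero]
  have hVmem : ∀ s : ℝ, MemLp (dilate (Real.exp (-s)) v) 2 sliceMeasure := fun s =>
    memLp_dilate (Real.exp_pos _) hv.memLp
  have hbound : Integrable (K.indicator fun p => ‖a p‖ * C) sliceMeasure := by
    rw [integrable_indicator_iff hKc.measurableSet]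
    exact (((Lp.memLp a).locallyIntegrable one_le_two).integrableOn_isCompact hKc).norm.mul_const C
  refine (hasDerivAt_integral_of_dominated_loc_of_deriv_le
    (F := fun (s : ℝ) p => a p * conj (dilate (Real.exp (-s)) v p))
    (F' := fun (s : ℝ) p => a p * conj (-(dilate (Real.exp (-s)) (eulerDeriv v) p))) (Metric.ball_mem_nhds s₀ one_pos)
    (Eventually.of_forall fun s => ?_) ?_ ?_ (Eventually.of_forall fun p s hs => ?_) hbound
    (Eventually.of_forall fun p s _ => ?_)).2
  · exact (Lp.aestronglyMeasurable a).mul (hVmem s).star.1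
  · exact (Lp.memLp a).integrable_mul (hVmem s₀).star
  · have h1 : Continuous fun p : Slice => dilate (Real.exp (-s₀)) (eulerDeriv v) p :=
      hcont.comp (continuous_const.prodMk continuous_id)
    exact (Lp.aestronglyMeasurable a).mul
      (Complex.continuous_conj.comp h1.neg).aestronglyMeasurable
  · have hs' : s ∈ Icc (s₀ - 1) (s₀ + 1) := by
      rw [Real.ball_eq_Ioo] at hs
      exact Ioo_subset_Icc_self hs
    by_cases hp : p ∈ K
    · rw [indicator_of_mem hp, norm_mul, RCLike.norm_conj, norm_neg]
      gcongr
      exact hC (s, p) ⟨hs', hp⟩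
    · rw [indicator_of_notMem hp, hzero s hs' p hp]
      simp
  · have h1 := hv.hasDerivAt_dilate_exp p s
    exact h1.star.const_mul (a p)

end Dilation

/-! ### Orthogonality of R⁻¹ f and ∂_R f -/

section Coercivity

/-- If `|⟨v, x⟩| ≤ K ‖v‖` for all test functions `v`, then `‖x‖ ≤ K`. -/
lemma norm_le_of_forall_test {x : L2} {K : ℝ} (hK : 0 ≤ K)
    (h : ∀ v ∈ testSubmodule, ‖(inner ℂ v x : ℂ)‖ ≤ K * ‖v‖) : ‖x‖ ≤ K := by
  have h1 : ∀ y : L2, ‖(inner ℂ y x : ℂ)‖ ≤ K * ‖y‖ := by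
    intro y
    have hcl : IsClosed {y : L2 | ‖(inner ℂ y x : ℂ)‖ ≤ K * ‖y‖} :=
      isClosed_le (continuous_id.inner continuous_const).norm (continuous_const.mul continuous_norm)
    exact hcl.closure_subset_iff.2 h (dense_testSubmodule y)
  have h2 := h1 x
  rw [inner_self_eq_norm_sq_to_K, norm_pow, RCLike.norm_ofReal, abs_norm, sq] at h2
  by_contra hn
  push Not at hn
  nlinarith [norm_nonneg x]

/-- If `g` is the weak derivative `∂_R (R a)` of `R a`, with `a, g ∈ L²(Σ)`, then
`Re ⟨a, g⟩ = 0`: dilations are unitary. -/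
theorem re_inner_eq_zero_of_isWeakTwistedDeriv {a g : L2}
    (h : IsWeakTwistedDeriv 0 (fun p => (p.1 : ℂ) * a p) g) : (inner ℂ a g : ℂ).re = 0 := by
  set b : ℝ → L2 := fun s => (memLp_dilate (Real.exp_pos s) (Lp.memLp a)).toLp _ with hb
  have hbnorm : ∀ s, ‖b s‖ = ‖a‖ := fun s => by
    rw [hb, Lp.norm_toLp, eLpNorm_dilate (Real.exp_pos s), Lp.norm_def]
  have hpair : ∀ v, ∀ hv : IsTest v, ∀ s, (inner ℂ (hv.memLp.toLp v) (b s) : ℂ) =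
      ∫ p, a p * conj (dilate (Real.exp (-s)) v p) ∂sliceMeasure := by
    intro v hv s
    rw [Real.exp_neg, ← integral_dilate_mul_conj (Real.exp_pos s), ← integral_mul_conj_eq_inner]
    refine integral_congr_ae ?_
    filter_upwards [(memLp_dilate (Real.exp_pos s) (Lp.memLp a)).coeFn_toLp] with p hp
    rw [hb]
    simp only [hp]
  have hb0 : b 0 = a := by
    apply Lp.ext
    filter_upwards [(memLp_dilate (Real.exp_pos 0) (Lp.memLp a)).coeFn_toLp] with p hp
    rw [hb]
    simp only [hp]
    simp [dilate]
  have hderiv : ∀ v, ∀ hv : IsTest v, ∀ s, HasDerivAt (fun s => (inner ℂ (hv.memLp.toLp v) (b s) : ℂ))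
      (inner ℂ ((isTest_dilate hv (Real.exp_pos (-s))).memLp.toLp _) g) s := by
    intro v hv s
    simp only [hpair v hv]
    refine (hv.hasDerivAt_integral_dilate a s).congr_deriv ?_
    have hv' := isTest_dilate hv (Real.exp_pos (-s))
    rw [← integral_mul_conj_eq_inner, h _ hv', ← integral_neg]
    refine integral_congr_ae ?_
    filter_upwards [ae_pos] with p hp
    rw [← eulerDeriv_dilate hv, hv'.eulerDeriv_eq hp, sub_zero]
    simp only [map_neg, map_mul, Complex.conj_ofReal]
    ring
  have hdnorm : ∀ v, ∀ hv : IsTest v, ∀ s,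
      ‖(isTest_dilate hv (Real.exp_pos (-s))).memLp.toLp (dilate (Real.exp (-s)) v)‖ =
        ‖hv.memLp.toLp v‖ := fun v hv s => by
    rw [Lp.norm_toLp, Lp.norm_toLp, eLpNorm_dilate (Real.exp_pos _)]
  -- The pairings with test functions have derivative at most ‖v‖ ‖g‖, because dilations preserve
  -- the norm of v; the mean value inequality and density give the Lipschitz bound.
  have hlip : ∀ s, ‖b s - a‖ ≤ |s| * ‖g‖ := by
    intro s
    refine norm_le_of_forall_test (by positivity) fun x hx => ?_
    obtain ⟨v, hv, rfl⟩ := exists_isTest_of_mem hx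
    have h1 := Convex.norm_image_sub_le_of_norm_hasDerivWithin_le (𝕜 := ℝ) (s := univ) (x := 0)
      (y := s) (C := ‖hv.memLp.toLp v‖ * ‖g‖)
      (fun r _ => (hderiv v hv r).hasDerivWithinAt)
      (fun r _ => (norm_inner_le_norm _ _).trans_eq (by rw [hdnorm v hv])) convex_univ
      (mem_univ _) (mem_univ _)
    rw [hb0, ← inner_sub_right, sub_zero, Real.norm_eq_abs] at h1
    exact h1.trans_eq (by ring)
  -- Since ‖b s‖ = ‖a‖, twice this real part is -‖b s - a‖², hence of second order in s.
  have hre : ∀ s, |(inner ℂ a (b s - a) : ℂ).re| ≤ (|s| * ‖g‖) ^ 2 / 2 := by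
    intro s
    have h1 : ‖b s‖ ^ 2 = ‖a‖ ^ 2 + 2 * (inner ℂ a (b s - a) : ℂ).re + ‖b s - a‖ ^ 2 := by
      have := @norm_add_sq ℂ L2 _ _ _ a (b s - a)
      rwa [add_sub_cancel] at this
    rw [hbnorm] at h1
    have h2 : (inner ℂ a (b s - a) : ℂ).re = -(‖b s - a‖ ^ 2 / 2) := by linarith
    rw [h2, abs_neg, abs_of_nonneg (by positivity)]
    have := hlip s
    gcongr
  -- The derivative of ⟨x, b s⟩ at 0 is known to be ⟨x, g⟩ only for test functions x, and a need not
  -- be one. Writing x = a + (x - a), the first part is quadratic in s and the second at most ‖x -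
  -- a‖ |s| ‖g‖.
  have htest : ∀ x ∈ testSubmodule, |(inner ℂ x g : ℂ).re| ≤ ‖x - a‖ * ‖g‖ := by
    intro x hx
    obtain ⟨v, hv, rfl⟩ := exists_isTest_of_mem hx
    set x := hv.memLp.toLp v with hxv
    have h1 := (hderiv v hv 0).tendsto_slope_zero
    have h2 : (isTest_dilate hv (Real.exp_pos (-0))).memLp.toLp _ = x := by
      apply Lp.ext
      filter_upwards [(isTest_dilate hv (Real.exp_pos (-0))).memLp.coeFn_toLp,
        hv.memLp.coeFn_toLp] with p hp hp'
      rw [hp, hp']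
      simp [dilate]
    rw [h2] at h1
    simp only [zero_add, hb0, ← inner_sub_right] at h1
    have h3 : Tendsto (fun s : ℝ => |s| * ‖g‖ ^ 2 / 2 + ‖x - a‖ * ‖g‖) (𝓝[≠] 0)
        (𝓝 (‖x - a‖ * ‖g‖)) := by
      have h4 : Continuous fun s : ℝ => |s| * ‖g‖ ^ 2 / 2 + ‖x - a‖ * ‖g‖ := by fun_prop
      have h5 := h4.tendsto 0
      simp only [abs_zero, zero_mul, zero_div, zero_add] at h5
      exact h5.mono_left nhdsWithin_le_nhds
    have h4 := (Complex.continuous_re.abs.tendsto _).comp h1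
    refine le_of_tendsto_of_tendsto h4 h3 ?_
    filter_upwards [self_mem_nhdsWithin] with s hs
    have hs' : 0 < |s| := abs_pos.2 hs
    have h5 : (inner ℂ x (b s - a) : ℂ) = inner ℂ a (b s - a) + inner ℂ (x - a) (b s - a) := by
      rw [← inner_add_left, add_sub_cancel]
    have h6 : |(inner ℂ x (b s - a) : ℂ).re| ≤ (|s| * ‖g‖) ^ 2 / 2 + ‖x - a‖ * (|s| * ‖g‖) := by
      rw [h5, Complex.add_re]
      refine (abs_add_le _ _).trans (add_le_add (hre s) ?_)
      refine (Complex.abs_re_le_norm _).trans ((norm_inner_le_norm _ _).trans ?_)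
      have := hlip s
      gcongr
    simp only [Function.comp_apply, Complex.real_smul, Complex.re_ofReal_mul, abs_mul, abs_inv]
    rw [inv_mul_le_iff₀ hs']
    refine h6.trans_eq ?_
    ring
  have hall : ∀ x : L2, |(inner ℂ x g : ℂ).re| ≤ ‖x - a‖ * ‖g‖ := by
    intro x
    have hcl : IsClosed {x : L2 | |(inner ℂ x g : ℂ).re| ≤ ‖x - a‖ * ‖g‖} :=
      isClosed_le (Complex.continuous_re.comp (continuous_id.inner continuous_const)).abs
        ((continuous_id.sub continuous_const).norm.mul continuous_const)
    exact hcl.closure_subset_iff.2 htest (dense_testSubmodule x)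
  -- The inequality survives limits in x, unlike the differentiability, so x = a is now allowed.
  have := hall a
  rw [sub_self, norm_zero, zero_mul] at this
  exact abs_nonpos_iff.1 this

lemma H1.re_inner_invR_radial (f : H1) : (inner ℂ f.invR f.radial : ℂ).re = 0 :=
  re_inner_eq_zero_of_isWeakTwistedDeriv f.2.1

lemma H1.norm_sq (f : H1) : ‖f‖ ^ 2 = ‖f.invR‖ ^ 2 + (‖f.radial‖ ^ 2 + ‖f.angular‖ ^ 2) := by
  have h1 := WithLp.prod_norm_sq_eq_of_L2 f.1
  rwa [WithLp.prod_norm_sq_eq_of_L2 f.1.snd] at h1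

/-- The cross term 2α Re ⟨∂_R f, R⁻¹ f⟩ vanishes. The lower order term on the right is what makes
the energy coercive. -/
lemma H1.norm_twisted_sq (α : ℝ) (f : H1) :
    ‖f.twisted α‖ ^ 2 = ‖f.radial‖ ^ 2 + α ^ 2 * ‖f.invR‖ ^ 2 := by
  have h1 : (inner ℂ f.radial f.invR : ℂ).re = 0 := by
    rw [← f.re_inner_invR_radial]
    exact inner_re_symm (𝕜 := ℂ) _ _
  have h2 := @norm_add_sq ℂ L2 _ _ _ f.radial ((α : ℂ) • f.invR)
  have h3 : RCLike.re (inner ℂ f.radial ((α : ℂ) • f.invR) : ℂ) = 0 := by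
    rw [inner_smul_right]
    change ((α : ℂ) * inner ℂ f.radial f.invR).re = 0
    rw [Complex.re_ofReal_mul, h1, mul_zero]
  rw [h3, norm_smul, mul_pow, Complex.norm_real, Real.norm_eq_abs, sq_abs] at h2
  rw [H1.twisted, h2]
  ring

end Coercivity

/-! ### Functions of time with vanishing primitive -/

section TimeIntegrals

variable {F : Type*} [NormedAddCommGroup F] [NormedSpace ℝ F]

lemma integral_indicator_Icc (g : ℝ → F) {T : ℝ} (hT : T ∈ Icc (-1 : ℝ) 0) :
    ∫ s in (-1 : ℝ)..T, (Icc (-1) 0).indicator g s = ∫ s in (-1 : ℝ)..T, g s := by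
  refine intervalIntegral.integral_congr fun s hs => ?_
  rw [uIcc_of_le hT.1] at hs
  have hs' : s ∈ Icc (-1 : ℝ) 0 := ⟨hs.1, hs.2.trans hT.2⟩
  exact indicator_of_mem hs' _

/-- Lebesgue's differentiation theorem, applied to the extension of g by zero. -/
lemma ae_eq_zero_of_integral_eq_zero [CompleteSpace F] {g : ℝ → F} (hg : Integrable g timeMeasure)
    (h : ∀ T ∈ Ioo (-1 : ℝ) 0, ∫ s in (-1 : ℝ)..T, g s = 0) : ∀ᵐ T ∂timeMeasure, g T = 0 := by
  have h1 : Integrable ((Icc (-1 : ℝ) 0).indicator g) :=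
    (integrable_indicator_iff measurableSet_Icc).2 hg
  have h2 := LocallyIntegrable.ae_hasDerivAt_integral h1.locallyIntegrable
  have h3 : timeMeasure = volume.restrict (Ioo (-1 : ℝ) 0) :=
    Measure.restrict_congr_set Ioo_ae_eq_Icc.symm
  rw [h3, ae_restrict_iff' measurableSet_Ioo]
  filter_upwards [h2] with T hT hT'
  have h4 : HasDerivAt (fun T => ∫ s in (-1 : ℝ)..T, (Icc (-1 : ℝ) 0).indicator g s) 0 T := by
    refine (hasDerivAt_const T (0 : F)).congr_of_eventuallyEq ?_
    filter_upwards [isOpen_Ioo.mem_nhds hT'] with s hs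
    rw [integral_indicator_Icc _ (Ioo_subset_Icc_self hs), h s hs]
  have h5 := (hT (-1)).unique h4
  rwa [indicator_of_mem (Ioo_subset_Icc_self hT')] at h5

end TimeIntegrals

/-! ### Abstract wave equations on [-1, 0] with a relation as domain -/

section AbstractOperators

variable {V E H : Type*} [NormedAddCommGroup V] [InnerProductSpace ℂ V] [NormedAddCommGroup E]
  [InnerProductSpace ℂ E] [NormedAddCommGroup H] [InnerProductSpace ℂ H]

/-- The conjugate-linear functional `w ↦ ⟨x, κ w⟩`. -/
def dualOp (κ : V →L[ℂ] E) : E →L[ℂ] (V →SL[starRingEnd ℂ] ℂ) :=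
  LinearMap.mkContinuous
    { toFun := fun x => (innerSLFlip ℂ x).comp κ
      map_add' := fun x y => by ext w; simp
      map_smul' := fun c x => by ext w; simp } ‖κ‖ fun x => by
    refine ContinuousLinearMap.opNorm_le_bound _ (by positivity) fun w => ?_
    change ‖(inner ℂ (κ w) x : ℂ)‖ ≤ _
    refine (norm_inner_le_norm _ _).trans ?_
    calc ‖κ w‖ * ‖x‖ ≤ (‖κ‖ * ‖w‖) * ‖x‖ := by gcongr; exact κ.le_opNorm w
      _ = _ := by ring

lemma norm_dualOp_apply_le (κ : V →L[ℂ] E) (x : E) : ‖dualOp κ x‖ ≤ ‖κ‖ * ‖x‖ :=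
  (dualOp κ).le_of_opNorm_le (LinearMap.mkContinuous_norm_le _ (norm_nonneg _) _) x

/-- The second time derivative determined by the wave equation. -/
def accel (i : V →L[ℂ] E) (n : V →L[ℂ] H) (c : ℝ) (f : V) (ψ : H) : V →SL[starRingEnd ℂ] ℂ :=
  -(dualOp i (i f) + (2 * Complex.I * c) • dualOp n ψ)

variable (i : V →L[ℂ] E) (n : V →L[ℂ] H) (c : ℝ)

lemma accel_apply (f : V) (ψ : H) (w : V) :
    accel i n c f ψ w = -((inner ℂ (i w) (i f) : ℂ) +
      2 * Complex.I * c * inner ℂ (n w) ψ) := rfl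

lemma norm_accel_le (f : V) (ψ : H) :
    ‖accel i n c f ψ‖ ≤ ‖i‖ * ‖i f‖ + 2 * |c| * (‖n‖ * ‖ψ‖) := by
  rw [accel, norm_neg]
  refine (norm_add_le _ _).trans (add_le_add (norm_dualOp_apply_le _ _) ?_)
  rw [norm_smul]
  have : ‖2 * Complex.I * (c : ℂ)‖ = 2 * |c| := by simp
  rw [this]
  gcongr
  exact norm_dualOp_apply_le _ _

lemma continuousOn_accel {f : ℝ → V} {ψ : ℝ → H} {s : Set ℝ} (hf : ContinuousOn f s)
    (hψ : ContinuousOn ψ s) : ContinuousOn (fun T => accel i n c (f T) (ψ T)) s := by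
  have h1 : ContinuousOn (fun T => dualOp i (i (f T))) s :=
    (dualOp i).continuous.comp_continuousOn (i.continuous.comp_continuousOn hf)
  have h2 : ContinuousOn (fun T => dualOp n (ψ T)) s :=
    (dualOp n).continuous.comp_continuousOn hψ
  have h3 : ContinuousOn (fun T => (2 * Complex.I * (c : ℂ)) • dualOp n (ψ T)) s :=
    h2.const_smul (2 * Complex.I * (c : ℂ))
  exact (h1.add h3).neg

variable (V H) in
/-- Linear relations between two Hilbert spaces. -/
abbrev LinRel : Type _ := Submodule ℂ (WithLp 2 (V × H))

variable (S : LinRel V H)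

/-- The first projection of a linear relation. -/
def projFst : S →L[ℂ] V := WithLp.fstL 2 ℂ V H ∘L S.subtypeL

/-- The second projection of a linear relation. -/
def projSnd : S →L[ℂ] H := WithLp.sndL 2 ℂ V H ∘L S.subtypeL

/-- Conditions on a relation `S` between `V` and `H` that make it the domain of an abstract wave
equation. -/
structure IsWaveRelation : Prop where
  isClosed : IsClosed (S : Set (WithLp 2 (V × H)))
  symm : ∀ z ∈ S, ∀ w ∈ S, (inner ℂ (n z.fst) w.snd : ℂ) = inner ℂ z.snd (n w.fst)
  fst_eq_zero : ∀ z ∈ S, z.snd = 0 → z.fst = 0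
  coercive : ∃ κ > 0, ∀ f, κ * ‖f‖ ^ 2 ≤ ‖i f‖ ^ 2

variable {i n S}

/-- The space W is S itself with the norm of V × H. The coercivity of i controls the first component
and j the second, whence the constant `min κ 1`. -/
lemma IsWaveRelation.isWaveSystem (h : IsWaveRelation i n S) :
    IsWaveSystem (i ∘L projFst S) (projSnd S) (n ∘L projFst S) where
  symm z w := h.symm z.1 z.2 w.1 w.2
  injective := by
    rw [injective_iff_map_eq_zero]
    intro z hz
    have h2 := h.fst_eq_zero z.1 z.2 hz
    have h3 : ‖z.1‖ ^ 2 = 0 := by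
      rw [WithLp.prod_norm_sq_eq_of_L2, h2, show z.1.snd = 0 from hz]
      simp
    exact Subtype.ext (norm_eq_zero.1 (pow_eq_zero_iff two_ne_zero |>.1 h3))
  coercive := by
    obtain ⟨κ, hκ, hi⟩ := h.coercive
    refine ⟨min κ 1, lt_min hκ one_pos, fun z => ?_⟩
    rw [show ‖z‖ = ‖z.1‖ from rfl, WithLp.prod_norm_sq_eq_of_L2]
    change min κ 1 * (‖z.1.fst‖ ^ 2 + ‖z.1.snd‖ ^ 2) ≤ ‖i z.1.fst‖ ^ 2 + ‖z.1.snd‖ ^ 2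
    have h1 := hi z.1.fst
    nlinarith [sq_nonneg ‖z.1.snd‖, sq_nonneg ‖z.1.fst‖, min_le_left κ 1, min_le_right κ 1]

lemma IsWaveRelation.eq_zero (h : IsWaveRelation i n S) {f : V} (hf : i f = 0) : f = 0 := by
  obtain ⟨κ, hκ, hi⟩ := h.coercive
  have h1 := hi f
  rw [hf, norm_zero] at h1
  have h2 : ‖f‖ ^ 2 = 0 := by nlinarith [sq_nonneg ‖f‖]
  exact norm_eq_zero.1 (pow_eq_zero_iff two_ne_zero |>.1 h2)

variable [CompleteSpace V] [CompleteSpace E] [CompleteSpace H]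

/-- Existence for a wave equation on the time interval `[-1, 0]`. -/
theorem IsWaveRelation.exists_curve (h : IsWaveRelation i n S) (Φ₀ : V) (ψ₀ : H) :
    ∃ (Φ : ℝ → V) (ψ : ℝ → H), ContinuousOn Φ (Icc (-1) 0) ∧ ContinuousOn ψ (Icc (-1) 0) ∧
      ∀ T ∈ Icc (-1 : ℝ) 0, WithLp.toLp 2 (Φ T - Φ₀, ∫ s in (-1 : ℝ)..T, ψ s) ∈ S ∧
        ‖i (Φ T)‖ ^ 2 + ‖ψ T‖ ^ 2 ≤ ‖i Φ₀‖ ^ 2 + ‖ψ₀‖ ^ 2 ∧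
        ∀ z ∈ S, (inner ℂ z.snd (ψ T) : ℂ) =
          inner ℂ z.snd ψ₀ + ∫ s in (-1 : ℝ)..T, accel i n c (Φ s) (ψ s) z.fst := by
  have : CompleteSpace S := h.isClosed.completeSpace_coe
  obtain ⟨w, ψ, hw, hψ, hall⟩ := h.isWaveSystem.exists_wave c (i Φ₀) ψ₀
  have hmaps : ∀ T ∈ Icc (-1 : ℝ) 0, T + 1 ∈ Icc (0 : ℝ) 1 := fun T hT =>
    ⟨by linarith [hT.1], by linarith [hT.2]⟩
  have hadd : ContinuousOn (fun T : ℝ => T + 1) (Icc (-1) 0) := by fun_prop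
  -- The abstract solution lives on [0, 1] and is shifted to start at T = -1. Only the increment Φ -
  -- Φ₀ lies in S; Φ₀ is an arbitrary element of V.
  refine ⟨fun T => Φ₀ + projFst S (w (T + 1)), fun T => ψ (T + 1),
    continuousOn_const.add ((projFst S).continuous.comp_continuousOn (hw.comp hadd hmaps)),
    hψ.comp hadd hmaps, fun T hT => ?_⟩
  obtain ⟨h1, h2, h3⟩ := hall (T + 1) (hmaps T hT)
  have h0 : (-1 : ℝ) + 1 = 0 := by norm_num
  refine ⟨?_, ?_, fun z hz => ?_⟩
  · have h4 : ∫ s in (-1 : ℝ)..T, ψ (s + 1) = (w (T + 1)).1.snd := by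
      rw [intervalIntegral.integral_comp_add_right, h0, ← h1]
      rfl
    rw [h4, add_sub_cancel_left]
    exact (w (T + 1)).2
  · rw [map_add]
    exact h2
  · have h4 := h3 ⟨z, hz⟩
    rw [sub_eq_add_neg, ← intervalIntegral.integral_neg] at h4
    refine h4.trans ?_
    have h5 := intervalIntegral.integral_comp_add_right (a := -1) (b := T)
      (fun s => accel i n c (Φ₀ + projFst S (w s)) (ψ s) z.fst) 1
    rw [h5, h0]
    congr 1
    refine intervalIntegral.integral_congr fun s _ => ?_
    simp only [accel_apply, map_add]
    rfl

/-- Uniqueness for a wave equation on the time interval `[-1, 0]`. -/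
theorem IsWaveRelation.curve_unique (h : IsWaveRelation i n S)
    {Φ : ℝ → V} {ψ : ℝ → H} (hΦ : Integrable Φ timeMeasure) (hψ : Integrable ψ timeMeasure)
    (h1 : ∀ T ∈ Icc (-1 : ℝ) 0, WithLp.toLp 2 (∫ s in (-1 : ℝ)..T, Φ s,
      ∫ s in (-1 : ℝ)..T, ∫ r in (-1 : ℝ)..s, ψ r) ∈ S)
    (h2 : ∀ z ∈ S, ∀ᵐ T ∂timeMeasure, (inner ℂ z.snd (ψ T) : ℂ) =
      ∫ s in (-1 : ℝ)..T, accel i n c (Φ s) (ψ s) z.fst) :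
    (∀ᵐ T ∂timeMeasure, Φ T = 0) ∧ ∀ᵐ T ∂timeMeasure, ψ T = 0 := by
  have hiΦ : Integrable (fun T => i (Φ T)) timeMeasure := i.integrable_comp hΦ
  have h3 := h.isWaveSystem.wave_unique (a := -1) (b := 0) c
    ((integrable_indicator_iff measurableSet_Icc).2 hiΦ)
    ((integrable_indicator_iff measurableSet_Icc).2 hψ) (fun T hT => ?_) (fun z => ?_)
  · refine ⟨?_, ?_⟩
    · have h4 : ∀ᵐ T ∂timeMeasure, i (Φ T) = 0 := by
        refine ae_eq_zero_of_integral_eq_zero hiΦ fun T hT => ?_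
        rw [← (h3 T hT).1]
        exact (integral_indicator_Icc _ (Ioo_subset_Icc_self hT)).symm
      filter_upwards [h4] with T hT using h.eq_zero hT
    · refine ae_eq_zero_of_integral_eq_zero hψ fun T hT => ?_
      rw [← (h3 T hT).2]
      exact (integral_indicator_Icc _ (Ioo_subset_Icc_self hT)).symm
  · refine ⟨⟨_, h1 T hT⟩, ?_, ?_⟩
    · rw [integral_indicator_Icc _ hT]
      have h4 : IntegrableOn Φ (uIcc (-1) T) := by
        rw [uIcc_of_le hT.1]
        exact IntegrableOn.mono_set (t := Icc (-1) 0) hΦ (Icc_subset_Icc_right hT.2)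
      exact (i.intervalIntegral_comp_comm h4.intervalIntegrable).symm
    · change ∫ s in (-1 : ℝ)..T, ∫ r in (-1 : ℝ)..s, ψ r = _
      refine intervalIntegral.integral_congr fun s hs => ?_
      rw [uIcc_of_le hT.1] at hs
      exact (integral_indicator_Icc _ ⟨hs.1, hs.2.trans hT.2⟩).symm
  · filter_upwards [ae_timeMeasure_iff.1 (h2 z.1 z.2)] with T hT hT'
    rw [indicator_of_mem hT']
    refine (hT hT').trans ?_
    rw [← intervalIntegral.integral_neg]
    refine intervalIntegral.integral_congr fun s hs => ?_
    rw [uIcc_of_le hT'.1] at hs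
    have hs' : s ∈ Icc (-1 : ℝ) 0 := ⟨hs.1, hs.2.trans hT'.2⟩
    simp only [indicator_of_mem hs']
    rfl

end AbstractOperators

/-! ### The operators of the twisted wave equation -/

section Operators

/-- `f ↦ R⁻¹ f` as a bounded operator. -/
def invRL : H1 →L[ℂ] L2 := WithLp.fstL 2 ℂ L2 (WithLp 2 (L2 × L2Field)) ∘L (twistedH1 0).subtypeL

lemma invRL_apply (f : H1) : invRL f = f.invR := rfl

/-- `f ↦ ∂_R f` as a bounded operator. -/
def radialL : H1 →L[ℂ] L2 :=
  WithLp.fstL 2 ℂ L2 L2Field ∘L WithLp.sndL 2 ℂ L2 (WithLp 2 (L2 × L2Field)) ∘L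
    (twistedH1 0).subtypeL

/-- `f ↦ R⁻¹ ∇ f` as a bounded operator. -/
def angularL : H1 →L[ℂ] L2Field :=
  WithLp.sndL 2 ℂ L2 L2Field ∘L WithLp.sndL 2 ℂ L2 (WithLp 2 (L2 × L2Field)) ∘L
    (twistedH1 0).subtypeL

/-- The map `f ↦ (∂_R^α f, R⁻¹ ∇ f)`, whose squared norm is the potential energy. -/
def energyMap (α : ℝ) : H1 →L[ℂ] WithLp 2 (L2 × L2Field) :=
  graphMap (W := H1) (V := L2) (H := L2Field) (radialL + (α : ℂ) • invRL) angularL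

lemma inner_energyMap (α : ℝ) (f w : H1) :
    inner ℂ (energyMap α w) (energyMap α f) = energyForm α f w := by
  rw [WithLp.prod_inner_apply]
  rfl

lemma norm_energyMap_sq (α : ℝ) (f : H1) :
    ‖energyMap α f‖ ^ 2 = ‖f.radial‖ ^ 2 + α ^ 2 * ‖f.invR‖ ^ 2 + ‖f.angular‖ ^ 2 := by
  rw [WithLp.prod_norm_sq_eq_of_L2, ← H1.norm_twisted_sq]
  rfl

/-- Coercivity of B: α² ≤ 1 lets the single factor α² also serve for the radial and angular terms.
-/
lemma le_norm_energyMap_sq {α : ℝ} (hα : α ^ 2 ≤ 1) (f : H1) :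
    α ^ 2 * ‖f‖ ^ 2 ≤ ‖energyMap α f‖ ^ 2 := by
  rw [norm_energyMap_sq, f.norm_sq]
  nlinarith [sq_nonneg ‖f.radial‖, sq_nonneg ‖f.angular‖]

/-- `H¹(Σ) ∩ L²(Σ)`, as pairs `(f, h)` with `f = h` almost everywhere. -/
def H1L2 : LinRel H1 L2 where
  carrier := {p | p.fst.toFun =ᵐ[sliceMeasure] p.snd}
  zero_mem' := by
    filter_upwards [Lp.coeFn_zero ℂ 2 sliceMeasure] with p hp
    change (p.1 : ℂ) * (0 : L2) p = (0 : L2) p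
    rw [hp]
    simp
  add_mem' := by
    intro x y hx hy
    filter_upwards [hx, hy, Lp.coeFn_add x.fst.invR y.fst.invR, Lp.coeFn_add x.snd y.snd]
      with p h1 h2 h3 h4
    change (p.1 : ℂ) * (x.fst.invR + y.fst.invR : L2) p = (x.snd + y.snd : L2) p
    rw [h3, h4, Pi.add_apply, Pi.add_apply, ← h1, ← h2, mul_add]
    rfl
  smul_mem' := by
    intro c x hx
    filter_upwards [hx, Lp.coeFn_smul c x.fst.invR, Lp.coeFn_smul c x.snd] with p h1 h3 h4
    change (p.1 : ℂ) * (c • x.fst.invR : L2) p = (c • x.snd : L2) p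
    rw [h3, h4, Pi.smul_apply, Pi.smul_apply, ← h1, smul_eq_mul, smul_eq_mul, mul_left_comm]
    rfl

lemma mem_H1L2_iff {x : WithLp 2 (H1 × L2)} : x ∈ H1L2 ↔ ∀ v, ∀ hv : IsTest v,
    (inner ℂ (hv.memLp_fst_mul.toLp fun p => (p.1 : ℂ) * v p) (invRL x.fst) : ℂ) =
      inner ℂ (hv.memLp.toLp v) x.snd :=
  ae_fst_mul_eq_iff x.fst.invR x.snd

/-- Multiplication by R is unbounded on L², but the relation f = h can be tested against test
functions, each test being a closed condition. -/
lemma isClosed_H1L2 : IsClosed (H1L2 : Set (WithLp 2 (H1 × L2))) := by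
  have h1 : (H1L2 : Set (WithLp 2 (H1 × L2))) = {x | ∀ v, ∀ hv : IsTest v,
    (inner ℂ (hv.memLp_fst_mul.toLp fun p => (p.1 : ℂ) * v p) (invRL x.fst) : ℂ) =
      inner ℂ (hv.memLp.toLp v) x.snd} := Set.ext fun x => mem_H1L2_iff
  rw [h1]
  simp only [Set.ofPred_forall]
  refine isClosed_iInter fun v => isClosed_iInter fun hv => ?_
  exact isClosed_eq
    (continuous_const.inner (invRL.continuous.comp (WithLp.prod_continuous_ofLp 2 H1 L2).fst))
    (continuous_const.inner (WithLp.prod_continuous_ofLp 2 H1 L2).snd)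

/-- The tangential test field `v (e_k - ω_k ω)`. -/
lemma isTestField_tangential {v : Slice → ℂ} (hv : IsTest v) (k : Fin 3) :
    IsTestField fun p => WithLp.toLp 2 fun l =>
      v p * ((if l = k then 1 else 0) - ((p.2 : E3) k : ℂ) * ((p.2 : E3) l : ℂ)) := by
  have hsub : tsupport (fun p => (WithLp.toLp 2 fun l =>
      v p * ((if l = k then 1 else 0) - ((p.2 : E3) k : ℂ) * ((p.2 : E3) l : ℂ)) :
        EuclideanSpace ℂ (Fin 3))) ⊆ tsupport v := by
    refine closure_mono fun p hp hv => hp ?_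
    ext l
    simp [hv]
  refine ⟨?_, hv.2.1.of_isClosed_subset (isClosed_tsupport _) hsub, hsub.trans hv.2.2,
    fun p => ?_⟩
  · have h1 : ContMDiff (𝓘(ℝ, ℝ).prod (𝓡 2)) 𝓘(ℝ, E3) ∞ fun p : Slice => (p.2 : E3) :=
      contMDiff_coe_sphere.comp contMDiff_snd
    have h2 : ContDiff ℝ ∞ fun x : ℂ × E3 => (WithLp.toLp 2 fun l =>
        x.1 * ((if l = k then 1 else 0) - (x.2 k : ℂ) * (x.2 l : ℂ)) :
          EuclideanSpace ℂ (Fin 3)) := by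
      rw [← contDiffOn_univ, contDiffOn_piLp]
      intro l
      rw [contDiffOn_univ]
      have h3 : ∀ m : Fin 3, ContDiff ℝ ∞ fun x : ℂ × E3 => (x.2 m : ℂ) := fun m =>
        Complex.ofRealCLM.contDiff.comp
          (((EuclideanSpace.proj m : E3 →L[ℝ] ℝ).contDiff).comp contDiff_snd)
      exact contDiff_fst.mul (contDiff_const.sub ((h3 k).mul (h3 l)))
    exact h2.contMDiff.comp (hv.1.prodMk_space h1)
  · have h1 : ∑ l, ((p.2 : E3) l : ℂ) * ((p.2 : E3) l : ℂ) = 1 := by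
      have h2 : ‖(p.2 : E3)‖ = 1 := norm_eq_of_mem_sphere p.2
      have h3 := EuclideanSpace.norm_sq_eq (p.2 : E3)
      rw [h2] at h3
      simp only [Real.norm_eq_abs, sq_abs, one_pow] at h3
      have h4 := congrArg (fun x : ℝ => (x : ℂ)) h3
      simp only [Complex.ofReal_one, Complex.ofReal_sum, Complex.ofReal_pow] at h4
      rw [h4]
      exact Finset.sum_congr rfl fun l _ => (sq _).symm
    have h2 : ∀ l, ((p.2 : E3) l : ℂ) * (v p * ((if l = k then 1 else 0) -
        ((p.2 : E3) k : ℂ) * ((p.2 : E3) l : ℂ))) =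
        (if l = k then ((p.2 : E3) l : ℂ) * v p else 0) -
          v p * ((p.2 : E3) k : ℂ) * (((p.2 : E3) l : ℂ) * ((p.2 : E3) l : ℂ)) := by
      intro l
      split_ifs <;> ring
    simp only [h2]
    rw [Finset.sum_sub_distrib, ← Finset.mul_sum, h1, Finset.sum_ite_eq' Finset.univ k]
    simp only [Finset.mem_univ, if_true]
    ring

/-- The weak derivatives are determined by the function. -/
lemma H1.eq_zero_of_invR {f : H1} (h : f.invR = 0) : f = 0 := by
  have h0 : f.invR =ᵐ[sliceMeasure] 0 := by rw [h]; exact Lp.coeFn_zero _ _ _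
  have hradial : f.radial = 0 := by
    rw [Lp.eq_zero_iff_ae_eq_zero]
    refine ae_eq_zero_of_forall_isTest ((Lp.memLp _).locallyIntegrable one_le_two) fun v hv => ?_
    have h1 : ∫ p, f.radial p * conj (v p) ∂sliceMeasure =
      -∫ p, (p.1 : ℂ) * f.invR p * conj (twistedDeriv (1 - 0) v p) ∂sliceMeasure := f.2.1 v hv
    rw [h1, integral_eq_zero_of_ae, neg_zero]
    filter_upwards [h0] with p hp
    simp [hp]
  have htan : ∀ᵐ p ∂sliceMeasure,
      ∑ l, ((p.2 : E3) l : ℂ) * ((p.1 : ℂ) • f.angular p) l = 0 := f.2.2.1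
  have hangular : f.angular = 0 := by
    rw [Lp.eq_zero_iff_ae_eq_zero]
    have hk : ∀ k, ∀ᵐ p ∂sliceMeasure, f.angular p k = 0 := by
      intro k
      have hmem : MemLp (fun p => f.angular p k) 2 sliceMeasure :=
        (EuclideanSpace.proj k : EuclideanSpace ℂ (Fin 3) →L[ℂ] ℂ).comp_memLp' (Lp.memLp f.angular)
      have hloc : LocallyIntegrable (fun p => (p.1 : ℂ) * f.angular p k) sliceMeasure := by
        refine (locallyIntegrable_fst_mul (hmem.toLp _)).congr ?_
        filter_upwards [hmem.coeFn_toLp] with p hp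
        rw [hp]
      have h1 : (fun p => (p.1 : ℂ) * f.angular p k) =ᵐ[sliceMeasure] 0 := by
        refine ae_eq_zero_of_forall_isTest hloc fun v hv => ?_
        have h2 := f.2.2.2 _ (isTestField_tangential hv k)
        have h3 : ∫ p, f.toFun p * conj (sphereDiv (fun p => WithLp.toLp 2 fun l =>
            v p * ((if l = k then 1 else 0) - ((p.2 : E3) k : ℂ) * ((p.2 : E3) l : ℂ))) p)
            ∂sliceMeasure = 0 := by
          apply integral_eq_zero_of_ae
          filter_upwards [h0] with p hp
          simp [H1.toFun, hp]
        refine Eq.trans ?_ (h2.trans (neg_eq_zero.2 h3))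
        -- As the angular gradient is tangent, the ω_k ω part of the test field pairs to zero and
        -- only the k-th component survives.
        apply integral_congr_ae
        filter_upwards [htan] with p hp
        have h4 : ∀ l, ((p.1 : ℂ) • f.1.snd.snd p) l * conj ((WithLp.toLp 2 fun l => v p *
            ((if l = k then 1 else 0) - ((p.2 : E3) k : ℂ) * ((p.2 : E3) l : ℂ)) :
              EuclideanSpace ℂ (Fin 3)) l) =
            (if l = k then ((p.1 : ℂ) • f.angular p) l * conj (v p) else 0) -
            conj (v p) * ((p.2 : E3) k : ℂ) * (((p.2 : E3) l : ℂ) * ((p.1 : ℂ) • f.angular p) l) := by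
          intro l
          change ((p.1 : ℂ) • f.angular p) l * conj (v p *
            ((if l = k then 1 else 0) - ((p.2 : E3) k : ℂ) * ((p.2 : E3) l : ℂ))) = _
          rw [map_mul, map_sub, map_mul, Complex.conj_ofReal, Complex.conj_ofReal]
          split_ifs <;> simp <;> ring
        simp only [h4]
        rw [Finset.sum_sub_distrib, ← Finset.mul_sum, hp, mul_zero, sub_zero,
          Finset.sum_ite_eq' Finset.univ k]
        simp
      filter_upwards [h1, ae_pos] with p hp hp'
      exact (mul_eq_zero.1 hp).resolve_left (by exact_mod_cast hp'.ne')
    filter_upwards [ae_all_iff.2 hk] with p hp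
    ext l
    exact hp l
  rw [← norm_eq_zero, ← pow_eq_zero_iff two_ne_zero, f.norm_sq, h, hradial, hangular]
  simp

lemma ae_eq_of_mem_H1L2 {z : WithLp 2 (H1 × L2)} (hz : z ∈ H1L2) :
    (fun p => (p.1 : ℂ) * z.fst.invR p) =ᵐ[sliceMeasure] z.snd := hz

/-- The twisted wave equation as an abstract wave equation. -/
theorem isWaveRelation {α : ℝ} (hα : 0 < α) (hα' : α ^ 2 ≤ 1) :
    IsWaveRelation (V := H1) (E := WithLp 2 (L2 × L2Field)) (H := L2) (energyMap α) invRL H1L2 := by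
  have h1 : ∀ z ∈ H1L2, ∀ w ∈ H1L2,
      (inner ℂ (invRL z.fst) w.snd : ℂ) = inner ℂ z.snd (invRL w.fst) := by
    intro z hz w hw
    rw [L2.inner_def, L2.inner_def]
    apply integral_congr_ae
    filter_upwards [ae_eq_of_mem_H1L2 hz, ae_eq_of_mem_H1L2 hw] with p h1 h2
    rw [← h1, ← h2, invRL_apply, invRL_apply]
    simp only [RCLike.inner_apply, map_mul]
    rw [show (starRingEnd ℂ) (p.1 : ℂ) = p.1 from Complex.conj_ofReal _]
    ring
  have h2 : ∀ z ∈ H1L2, z.snd = 0 → z.fst = 0 := by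
    intro z hz hz0
    refine H1.eq_zero_of_invR ?_
    rw [Lp.eq_zero_iff_ae_eq_zero]
    have h2 := ae_eq_of_mem_H1L2 hz
    rw [hz0] at h2
    filter_upwards [h2, Lp.coeFn_zero ℂ 2 sliceMeasure, ae_pos] with p h3 h4 hp
    rw [h4] at h3
    exact (mul_eq_zero.1 h3).resolve_left (by exact_mod_cast hp.ne')
  exact ⟨isClosed_H1L2, h1, h2, α ^ 2, by positivity, le_norm_energyMap_sq hα'⟩

end Operators

/-! ### Bounds by the energy -/

section Bounds

variable {V E H : Type*} [NormedAddCommGroup V] [InnerProductSpace ℂ V] [NormedAddCommGroup E]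
  [InnerProductSpace ℂ E] [NormedAddCommGroup H] [InnerProductSpace ℂ H]
  {i : V →L[ℂ] E} {n : V →L[ℂ] H} {S : LinRel V H}

lemma IsWaveRelation.exists_energy_bound (h : IsWaveRelation i n S) (c : ℝ) :
    ∃ C > 0, ∀ (f₀ f : V) (g₀ g : H), ‖i f‖ ^ 2 + ‖g‖ ^ 2 ≤ ‖i f₀‖ ^ 2 + ‖g₀‖ ^ 2 →
      ‖f‖ + ‖g‖ + ‖accel i n c f g‖ ≤ C * Real.sqrt (‖f₀‖ ^ 2 + ‖g₀‖ ^ 2) := by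
  obtain ⟨κ, hκ, hi⟩ := h.coercive
  have hs : 0 < Real.sqrt κ := Real.sqrt_pos.2 hκ
  -- The initial energy is at most ((‖i‖ + 1) D)², with D the norm of the data. The three summands
  -- bound f by coercivity, g directly, and the acceleration by the operator norms, so the constant
  -- does not depend on the data.
  refine ⟨((Real.sqrt κ)⁻¹ + 1 + (‖i‖ + 2 * |c| * ‖n‖)) * (‖i‖ + 1), by positivity,
    fun f₀ f g₀ g hfg => ?_⟩
  set D := Real.sqrt (‖f₀‖ ^ 2 + ‖g₀‖ ^ 2) with hD
  have hD0 : 0 ≤ D := Real.sqrt_nonneg _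
  have hD2 : D ^ 2 = ‖f₀‖ ^ 2 + ‖g₀‖ ^ 2 := Real.sq_sqrt (by positivity)
  have hM0 : 0 ≤ (‖i‖ + 1) * D := by positivity
  have h1 : ‖i f₀‖ ^ 2 ≤ ‖i‖ ^ 2 * ‖f₀‖ ^ 2 := by
    rw [← mul_pow]
    exact pow_le_pow_left₀ (norm_nonneg _) (i.le_opNorm _) 2
  have hM : ‖i f‖ ^ 2 + ‖g‖ ^ 2 ≤ ((‖i‖ + 1) * D) ^ 2 := by
    rw [mul_pow, hD2]
    have h2 : 0 ≤ ‖i‖ := norm_nonneg i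
    nlinarith [mul_nonneg h2 (sq_nonneg ‖f₀‖), mul_nonneg h2 (sq_nonneg ‖g₀‖),
      mul_nonneg (sq_nonneg ‖i‖) (sq_nonneg ‖g₀‖), sq_nonneg ‖f₀‖]
  have hif : ‖i f‖ ≤ (‖i‖ + 1) * D :=
    le_of_sq_le_sq (by nlinarith [sq_nonneg ‖g‖]) hM0
  have hg : ‖g‖ ≤ (‖i‖ + 1) * D :=
    le_of_sq_le_sq (by nlinarith [sq_nonneg ‖i f‖]) hM0
  have hf : ‖f‖ ≤ (Real.sqrt κ)⁻¹ * ((‖i‖ + 1) * D) := by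
    rw [inv_mul_eq_div, le_div_iff₀ hs]
    refine le_of_sq_le_sq ?_ hM0
    rw [mul_pow, Real.sq_sqrt hκ.le]
    nlinarith [hi f, sq_nonneg ‖g‖]
  have ha : ‖accel i n c f g‖ ≤ (‖i‖ + 2 * |c| * ‖n‖) * ((‖i‖ + 1) * D) := by
    refine (norm_accel_le i n c f g).trans ?_
    calc ‖i‖ * ‖i f‖ + 2 * |c| * (‖n‖ * ‖g‖)
        ≤ ‖i‖ * ((‖i‖ + 1) * D) + 2 * |c| * (‖n‖ * ((‖i‖ + 1) * D)) := by gcongr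
      _ = _ := by ring
  calc _ ≤ (Real.sqrt κ)⁻¹ * ((‖i‖ + 1) * D) + (‖i‖ + 1) * D +
        (‖i‖ + 2 * |c| * ‖n‖) * ((‖i‖ + 1) * D) := by gcongr
    _ = _ := by ring

lemma accel_sub_apply (i : V →L[ℂ] E) (n : V →L[ℂ] H) (c : ℝ) (f f' : V) (g g' : H) (w : V) :
    accel i n c (f - f') (g - g') w = accel i n c f g w - accel i n c f' g' w := by
  simp only [accel_apply, map_sub, inner_sub_right]
  ring

lemma continuousOn_accel_apply (i : V →L[ℂ] E) (n : V →L[ℂ] H) (c : ℝ) {f : ℝ → V} {ψ : ℝ → H}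
    {s : Set ℝ} (hf : ContinuousOn f s) (hψ : ContinuousOn ψ s) (w : V) :
    ContinuousOn (fun T => accel i n c (f T) (ψ T) w) s := by
  simp only [accel_apply]
  exact ((continuousOn_const.inner (i.continuous.comp_continuousOn hf)).add
    (continuousOn_const.mul (continuousOn_const.inner hψ))).neg

end Bounds

/-! ### Existence of weak solutions -/

lemma memLp_top_timeMeasure {F : Type*} [NormedAddCommGroup F] {g : ℝ → F}
    (hg : ContinuousOn g (Icc (-1) 0)) : MemLp g ⊤ timeMeasure := by
  obtain ⟨C, hC⟩ := isCompact_Icc.exists_bound_of_continuousOn hg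
  refine memLp_top_of_bound (hg.aestronglyMeasurable_of_isCompact isCompact_Icc measurableSet_Icc)
    C ?_
  filter_upwards [ae_mem_Icc] with T hT using hC T hT

lemma slicePairing_toFun_test (f : H1) {v : Slice → ℂ} (hv : IsTest v) :
    slicePairing f.toFun v =
      inner ℂ (hv.memLp_fst_mul.toLp fun p => (p.1 : ℂ) * v p) f.invR :=
  integral_fst_mul_mul_conj f.invR hv.memLp_fst_mul

lemma slicePairing_memLp (a : L2) {g : Slice → ℂ} (hg : MemLp g 2 sliceMeasure) :
    slicePairing a g = inner ℂ (hg.toLp g) a :=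
  integral_mul_conj_eq_inner a hg

lemma toLp_mem_H1L2 {w : H1} (hw : MemLp w.toFun 2 sliceMeasure) :
    WithLp.toLp 2 (w, hw.toLp w.toFun) ∈ H1L2 :=
  hw.coeFn_toLp.symm

lemma intervalIntegral_inner {F : Type*} [NormedAddCommGroup F] [InnerProductSpace ℂ F]
    [CompleteSpace F] (x : F) {ψ : ℝ → F} (hψ : Integrable ψ timeMeasure) {T : ℝ}
    (hT : T ∈ Icc (-1 : ℝ) 0) :
    (inner ℂ x (∫ s in (-1 : ℝ)..T, ψ s) : ℂ) = ∫ s in (-1 : ℝ)..T, inner ℂ x (ψ s) := by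
  have h4 : IntegrableOn ψ (uIcc (-1) T) := by
    rw [uIcc_of_le hT.1]
    exact IntegrableOn.mono_set (t := Icc (-1) 0) hψ (Icc_subset_Icc_right hT.2)
  exact ((innerSL ℂ x).intervalIntegral_comp_comm h4.intervalIntegrable).symm

lemma slicePairing_toFun_of_mem_H1L2 {f : H1} {ψ : ℝ → L2} (hψ : Integrable ψ timeMeasure) {T : ℝ}
    (hT : T ∈ Icc (-1 : ℝ) 0) (h : WithLp.toLp 2 (f, ∫ s in (-1 : ℝ)..T, ψ s) ∈ H1L2)
    {v : Slice → ℂ} (hv : IsTest v) :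
    slicePairing f.toFun v = ∫ s in (-1 : ℝ)..T, slicePairing (ψ s) v := by
  rw [slicePairing_toFun_test f hv]
  refine (mem_H1L2_iff.1 h v hv).trans ?_
  simp only [slicePairing_memLp _ hv.memLp]
  exact intervalIntegral_inner _ hψ hT

lemma H1.toFun_sub_ae_eq (f g : H1) :
    (fun p => f.toFun p - g.toFun p) =ᵐ[sliceMeasure] (f - g).toFun := by
  filter_upwards [Lp.coeFn_sub f.invR g.invR] with p hp
  change (p.1 : ℂ) * f.invR p - (p.1 : ℂ) * g.invR p = (p.1 : ℂ) * (f.invR - g.invR : L2) p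
  rw [hp, Pi.sub_apply, mul_sub]

lemma slicePairing_sub_test (f g : H1) {v : Slice → ℂ} (hv : IsTest v) :
    slicePairing (f - g).toFun v = slicePairing f.toFun v - slicePairing g.toFun v := by
  rw [slicePairing_toFun_test _ hv, slicePairing_toFun_test _ hv, slicePairing_toFun_test _ hv,
    ← inner_sub_right]
  rfl

/-- The second time derivative in the twisted wave equation. -/
def waveAccel (α c : ℝ) (f : H1) (g : L2) : Hm1 :=
  accel (V := H1) (E := WithLp 2 (L2 × L2Field)) (H := L2) (energyMap α) invRL c f g

lemma waveAccel_apply (α c : ℝ) (f : H1) (g : L2) (w : H1) :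
    waveAccel α c f g w =
      -(energyForm α f w + l2Pairing ((2 * Complex.I * (c : ℂ)) • g) w.invR) := by
  rw [← inner_energyMap, l2Pairing, inner_smul_right]
  rfl

lemma waveAccel_sub_apply (α c : ℝ) (f f' : H1) (g g' : L2) (w : H1) :
    waveAccel α c (f - f') (g - g') w = waveAccel α c f g w - waveAccel α c f' g' w :=
  accel_sub_apply (V := H1) (E := WithLp 2 (L2 × L2Field)) (H := L2) _ _ c f f' g g' w

lemma exists_waveAccel_bound {α : ℝ} (hα : 0 < α) (hα' : α ^ 2 ≤ 1) (c : ℝ) :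
    ∃ C > 0, ∀ (f₀ f : H1) (g₀ g : L2),
      ‖energyMap α f‖ ^ 2 + ‖g‖ ^ 2 ≤ ‖energyMap α f₀‖ ^ 2 + ‖g₀‖ ^ 2 →
      ‖f‖ + ‖g‖ + ‖waveAccel α c f g‖ ≤ C * dataNorm f₀ g₀ :=
  (isWaveRelation hα hα').exists_energy_bound c

lemma continuousOn_waveAccel (α c : ℝ) {Φ : ℝ → H1} {ψ : ℝ → L2} {s : Set ℝ}
    (hΦ : ContinuousOn Φ s) (hψ : ContinuousOn ψ s) :
    ContinuousOn (fun T => waveAccel α c (Φ T) (ψ T)) s :=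
  continuousOn_accel (V := H1) (E := WithLp 2 (L2 × L2Field)) (H := L2) _ _ c hΦ hψ

lemma continuousOn_waveAccel_apply (α c : ℝ) {Φ : ℝ → H1} {ψ : ℝ → L2} {s : Set ℝ}
    (hΦ : ContinuousOn Φ s) (hψ : ContinuousOn ψ s) (w : H1) :
    ContinuousOn (fun T => waveAccel α c (Φ T) (ψ T) w) s :=
  continuousOn_accel_apply (V := H1) (E := WithLp 2 (L2 × L2Field)) (H := L2) _ _ c hΦ hψ w

lemma toFun_ae_eq {f : H1} {g : L2} (h : WithLp.toLp 2 (f, g) ∈ H1L2) :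
    f.toFun =ᵐ[sliceMeasure] g := h

/-- Classical-in-time solutions of the twisted wave equation. -/
lemma exists_twisted_wave {α : ℝ} (hα : 0 < α) (hα' : α ^ 2 ≤ 1) (c : ℝ) (Φ₀ : H1) (Φ₁ : L2) :
    ∃ (Φ : ℝ → H1) (ψ : ℝ → L2), ContinuousOn Φ (Icc (-1) 0) ∧ ContinuousOn ψ (Icc (-1) 0) ∧
      ∀ T ∈ Icc (-1 : ℝ) 0, WithLp.toLp 2 (Φ T - Φ₀, ∫ s in (-1 : ℝ)..T, ψ s) ∈ H1L2 ∧
        ‖energyMap α (Φ T)‖ ^ 2 + ‖ψ T‖ ^ 2 ≤ ‖energyMap α Φ₀‖ ^ 2 + ‖Φ₁‖ ^ 2 ∧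
        ∀ z ∈ H1L2, (inner ℂ z.snd (ψ T) : ℂ) =
          inner ℂ z.snd Φ₁ + ∫ s in (-1 : ℝ)..T, waveAccel α c (Φ s) (ψ s) z.fst :=
  (isWaveRelation hα hα').exists_curve c Φ₀ Φ₁

lemma twisted_wave_unique {α : ℝ} (hα : 0 < α) (hα' : α ^ 2 ≤ 1) (c : ℝ) {Φ : ℝ → H1} {ψ : ℝ → L2}
    (hΦ : Integrable Φ timeMeasure) (hψ : Integrable ψ timeMeasure)
    (h1 : ∀ T ∈ Icc (-1 : ℝ) 0, WithLp.toLp 2 (∫ s in (-1 : ℝ)..T, Φ s,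
      ∫ s in (-1 : ℝ)..T, ∫ r in (-1 : ℝ)..s, ψ r) ∈ H1L2)
    (h2 : ∀ z ∈ H1L2, ∀ᵐ T ∂timeMeasure, (inner ℂ z.snd (ψ T) : ℂ) =
      ∫ s in (-1 : ℝ)..T, waveAccel α c (Φ s) (ψ s) z.fst) :
    (∀ᵐ T ∂timeMeasure, Φ T = 0) ∧ ∀ᵐ T ∂timeMeasure, ψ T = 0 :=
  (isWaveRelation hα hα').curve_unique c hΦ hψ h1 h2

lemma alphaZero_pos {q e : ℝ} (h : |q * e| < 1 / 2) : 0 < alphaZero q e := by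
  have h1 : (q * e) ^ 2 < (1 / 2) ^ 2 := sq_lt_sq' (by linarith [(abs_lt.1 h).1]) (abs_lt.1 h).2
  exact div_pos (Real.sqrt_pos.2 (by linarith)) two_pos

lemma alphaZero_sq_le_one (q e : ℝ) : alphaZero q e ^ 2 ≤ 1 := by
  have h1 : Real.sqrt (1 - 4 * (q * e) ^ 2) ≤ 1 :=
    Real.sqrt_le_one.2 (by nlinarith [sq_nonneg (q * e)])
  have h2 : 0 ≤ Real.sqrt (1 - 4 * (q * e) ^ 2) := Real.sqrt_nonneg _
  rw [alphaZero]
  nlinarith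

/-- The element of `H¹_sol` given by a solution that is continuous in time. -/
lemma exists_h1Sol {α c : ℝ} {Φ : ℝ → H1} {ψ : ℝ → L2} {Φ₀ : H1} {Φ₁ : L2}
    (hΦ : ContinuousOn Φ (Icc (-1) 0)) (hψ : ContinuousOn ψ (Icc (-1) 0))
    (h1 : ∀ T ∈ Icc (-1 : ℝ) 0, WithLp.toLp 2 (Φ T - Φ₀, ∫ s in (-1 : ℝ)..T, ψ s) ∈ H1L2)
    (h2 : ∀ T ∈ Icc (-1 : ℝ) 0, ∀ z ∈ H1L2, (inner ℂ z.snd (ψ T) : ℂ) =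
      inner ℂ z.snd Φ₁ + ∫ s in (-1 : ℝ)..T, waveAccel α c (Φ s) (ψ s) z.fst) :
    ∃ u : H1Sol, (∀ᵐ T ∂timeMeasure, u.val T = Φ T) ∧ (∀ᵐ T ∂timeMeasure, u.dt T = ψ T) ∧
      ∀ᵐ T ∂timeMeasure, u.dtt T = waveAccel α c (Φ T) (ψ T) := by
  have ha := continuousOn_waveAccel α c hΦ hψ
  have mΦ := memLp_top_timeMeasure hΦ
  have mψ := memLp_top_timeMeasure hψ
  have ma := memLp_top_timeMeasure (F := Hm1) ha
  have iψ : Integrable ψ timeMeasure := hψ.integrableOn_Icc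
  have eΦ := mΦ.coeFn_toLp
  have eψ := mψ.coeFn_toLp
  have ea := ma.coeFn_toLp
  refine ⟨⟨mΦ.toLp Φ, mψ.toLp ψ, ma.toLp _, fun η hη v hv => ?_, fun η hη w hw => ?_⟩, eΦ, eψ, ea⟩
  · have i1 : Integrable (fun T => slicePairing (ψ T) v) timeMeasure := by
      simp only [slicePairing_memLp _ hv.memLp]
      exact iψ.const_inner _
    have h3 : ∀ᵐ T ∂timeMeasure, slicePairing (mΦ.toLp Φ T).toFun v =
        slicePairing Φ₀.toFun v + ∫ s in (-1 : ℝ)..T, slicePairing (ψ s) v := by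
      filter_upwards [eΦ, ae_mem_Icc] with T hT hT'
      rw [hT, ← slicePairing_toFun_of_mem_H1L2 iψ hT' (h1 T hT') hv, slicePairing_sub_test _ _ hv]
      ring
    rw [hη.integral_deriv_mul_of_eq i1 h3]
    congr 1
    apply integral_congr_ae
    filter_upwards [eψ] with T hT
    rw [hT]
  · have i1 : Integrable (fun T => waveAccel α c (Φ T) (ψ T) w) timeMeasure :=
      (continuousOn_waveAccel_apply α c hΦ hψ w).integrableOn_Icc
    have h3 : ∀ᵐ T ∂timeMeasure, slicePairing (mψ.toLp ψ T) w.toFun =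
        inner ℂ (hw.toLp w.toFun) Φ₁ + ∫ s in (-1 : ℝ)..T, waveAccel α c (Φ s) (ψ s) w := by
      filter_upwards [eψ, ae_mem_Icc] with T hT hT'
      rw [hT, slicePairing_memLp _ hw]
      exact h2 T hT' _ (toLp_mem_H1L2 hw)
    rw [hη.integral_deriv_mul_of_eq i1 h3]
    congr 1
    apply integral_congr_ae
    filter_upwards [ea] with T hT
    rw [hT]

/-- The increment Φ - Φ₀ equals the primitive of ψ in L², which tends to zero at T = -1. -/
lemma tendsto_initialTime_val {u : H1Sol} {Φ : ℝ → H1} {ψ : ℝ → L2} {Φ₀ : H1}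
    (iψ : Integrable ψ timeMeasure) (uΦ : ∀ᵐ T ∂timeMeasure, u.val T = Φ T)
    (h1 : ∀ T ∈ Icc (-1 : ℝ) 0, WithLp.toLp 2 (Φ T - Φ₀, ∫ s in (-1 : ℝ)..T, ψ s) ∈ H1L2) :
    Tendsto (fun T => eLpNorm (fun p => (u.val T).toFun p - Φ₀.toFun p) 2 sliceMeasure)
      initialTime (𝓝 0) := by
  have h3 : Tendsto (fun T => ‖∫ s in (-1 : ℝ)..T, ψ s‖ₑ) initialTime (𝓝 0) := by
    have h4 := (tendsto_primitive_initialTime iψ).enorm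
    rwa [enorm_zero] at h4
  refine h3.congr' ?_
  have h4 : ∀ᵐ T ∂timeMeasure, ‖∫ s in (-1 : ℝ)..T, ψ s‖ₑ =
      eLpNorm (fun p => (u.val T).toFun p - Φ₀.toFun p) 2 sliceMeasure := by
    filter_upwards [uΦ, ae_mem_Icc] with T hT hT'
    rw [hT, Lp.enorm_def]
    exact eLpNorm_congr_ae
      ((H1.toFun_sub_ae_eq (Φ T) Φ₀).trans (toFun_ae_eq (h1 T hT'))).symm
  exact h4.filter_mono inf_le_right

lemma eventually_initialTime_dt {u : H1Sol} {a : ℝ → Hm1} {ψ : ℝ → L2} {Φ₁ : L2} {K : ℝ}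
    (hD : 0 ≤ K) (uψ : ∀ᵐ T ∂timeMeasure, u.dt T = ψ T)
    (h2 : ∀ T ∈ Icc (-1 : ℝ) 0, ∀ z ∈ H1L2, (inner ℂ z.snd (ψ T) : ℂ) =
      inner ℂ z.snd Φ₁ + ∫ s in (-1 : ℝ)..T, a s z.fst)
    (hb : ∀ T ∈ Icc (-1 : ℝ) 0, ‖a T‖ ≤ K) {ε : ℝ} (hε : 0 < ε) :
    ∀ᶠ T in initialTime, ∀ w : H1, MemLp w.toFun 2 sliceMeasure →
      ‖slicePairing (u.dt T - Φ₁ : L2) w.toFun‖ ≤ ε * ‖w‖ := by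
  -- In H⁻¹ the velocity changes by at most K (T + 1); K + 1 in the denominator allows K = 0.
  have h3 : ∀ᶠ T in initialTime, T < -1 + ε / (K + 1) := by
    refine (eventually_lt_nhds ?_).filter_mono inf_le_left
    have : 0 < ε / (K + 1) := by positivity
    linarith
  have h4 : ∀ᵐ T ∂timeMeasure, T ∈ Icc (-1 : ℝ) 0 ∧ u.dt T = ψ T := ae_mem_Icc.and uψ
  filter_upwards [h3, h4.filter_mono inf_le_right] with T hT hT' w hw
  obtain ⟨hT', hT''⟩ := hT'
  rw [hT'', slicePairing_memLp _ hw, inner_sub_right]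
  have h5 := h2 T hT' _ (toLp_mem_H1L2 hw)
  have h6 : (inner ℂ (hw.toLp w.toFun) (ψ T) : ℂ) - inner ℂ (hw.toLp w.toFun) Φ₁ =
      ∫ s in (-1 : ℝ)..T, a s w :=
    sub_eq_iff_eq_add'.2 h5
  rw [h6]
  have h7 : ∀ s ∈ uIoc (-1 : ℝ) T,
      ‖a s w‖ ≤ K * ‖w‖ := by
    intro s hs
    rw [uIoc_of_le hT'.1] at hs
    refine (ContinuousLinearMap.le_opNorm _ w).trans ?_
    gcongr
    exact hb s ⟨hs.1.le, hs.2.trans hT'.2⟩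
  refine (intervalIntegral.norm_integral_le_of_norm_le_const h7).trans ?_
  rw [abs_of_nonneg (by linarith [hT'.1])]
  have h9 : (T + 1) * (K + 1) ≤ ε := by
    rw [← le_div_iff₀ (by positivity)]
    linarith
  have h10 : K * (T - -1) ≤ ε := by nlinarith [hT'.1]
  calc K * ‖w‖ * (T - -1) = K * (T - -1) * ‖w‖ := by ring
    _ ≤ ε * ‖w‖ := by gcongr

/-- Here Φ is Φ₀ plus the primitive of ψ, and both are bounded in L² once Φ₀ is square integrable.
-/
lemma H1Sol.isBoundedInL2_of_integral {u : H1Sol} {Φ : ℝ → H1} {ψ : ℝ → L2} {Φ₀ : H1}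
    (iψ : Integrable ψ timeMeasure) (uΦ : ∀ᵐ T ∂timeMeasure, u.val T = Φ T)
    (h1 : ∀ T ∈ Icc (-1 : ℝ) 0, WithLp.toLp 2 (Φ T - Φ₀, ∫ s in (-1 : ℝ)..T, ψ s) ∈ H1L2)
    (h0 : MemLp Φ₀.toFun 2 sliceMeasure) : u.IsBoundedInL2 := by
  have hc : ContinuousOn (fun T => h0.toLp Φ₀.toFun + ∫ s in (-1 : ℝ)..T, ψ s) (Icc (-1) 0) :=
    continuousOn_const.add (continuousOn_primitive iψ)
  refine ⟨(memLp_top_timeMeasure hc).toLp _, ?_⟩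
  filter_upwards [(memLp_top_timeMeasure hc).coeFn_toLp, uΦ, ae_mem_Icc] with T h3 h4 hT
  rw [h3, h4]
  filter_upwards [Lp.coeFn_add (h0.toLp Φ₀.toFun) (∫ s in (-1 : ℝ)..T, ψ s), h0.coeFn_toLp,
    H1.toFun_sub_ae_eq (Φ T) Φ₀, toFun_ae_eq (h1 T hT)] with p h5 h6 h7 h8
  rw [h5, Pi.add_apply, h6, ← h8, ← h7]
  ring

/-- The constant is chosen before the data: it comes from the coercivity constant and operator norms
for α₀ and qe. -/
lemma exists_isWeakSolution {q e : ℝ} (hqe : |q * e| < 1 / 2) : ∃ C > 0, ∀ (Φ₀ : H1) (Φ₁ : L2),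
    ∃ u : H1Sol, IsWeakSolution q e Φ₀ Φ₁ u ∧ u.norm ≤ ENNReal.ofReal (C * dataNorm Φ₀ Φ₁) ∧
      (MemLp Φ₀.toFun 2 sliceMeasure → u.IsBoundedInL2) := by
  obtain ⟨C, hC, hbound⟩ :=
    exists_waveAccel_bound (alphaZero_pos hqe) (alphaZero_sq_le_one q e) (q * e)
  refine ⟨C, hC, fun Φ₀ Φ₁ => ?_⟩
  obtain ⟨Φ, ψ, hΦ, hψ, h⟩ :=
    exists_twisted_wave (alphaZero_pos hqe) (alphaZero_sq_le_one q e) (q * e) Φ₀ Φ₁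
  have h1 := fun T hT => (h T hT).1
  have h2 := fun T hT => (h T hT).2.2
  have hb := fun T hT => hbound Φ₀ (Φ T) Φ₁ (ψ T) (h T hT).2.1
  obtain ⟨u, uΦ, uψ, ua⟩ := exists_h1Sol hΦ hψ h1 h2
  have iψ : Integrable ψ timeMeasure := hψ.integrableOn_Icc
  have hD : 0 ≤ C * dataNorm Φ₀ Φ₁ := mul_nonneg hC.le (Real.sqrt_nonneg _)
  have hb' : ∀ T ∈ Icc (-1 : ℝ) 0,
      ‖waveAccel (alphaZero q e) (q * e) (Φ T) (ψ T)‖ ≤ C * dataNorm Φ₀ Φ₁ := fun T hT => by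
    linarith [hb T hT, norm_nonneg (Φ T), norm_nonneg (ψ T)]
  refine ⟨u, ⟨fun w => ?_, tendsto_initialTime_val iψ uΦ h1,
    fun ε hε => eventually_initialTime_dt hD uψ h2 hb' hε⟩, ?_,
    fun h0 => H1Sol.isBoundedInL2_of_integral iψ uΦ h1 h0⟩
  · filter_upwards [uΦ, uψ, ua] with T hT hT' hT''
    rw [hT, hT', hT'', waveAccel_apply]
    ring
  · refine essSup_le_of_ae_le _ ?_
    filter_upwards [uΦ, uψ, ua, ae_mem_Icc] with T h3 h4 h5 hT
    rw [h3, h4, h5, ← ofReal_norm, ← ofReal_norm, ← ofReal_norm,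
      ← ENNReal.ofReal_add (norm_nonneg _) (norm_nonneg _),
      ← ENNReal.ofReal_add (by positivity) (norm_nonneg _)]
    exact ENNReal.ofReal_le_ofReal (hb T hT)

/-! ### Uniqueness of weak solutions -/

lemma integrable_of_top {F : Type*} [NormedAddCommGroup F] (f : Lp F ⊤ timeMeasure) :
    Integrable f timeMeasure :=
  (Lp.memLp f).integrable le_top

lemma intervalIntegrable_of_timeMeasure {F : Type*} [NormedAddCommGroup F] {f : ℝ → F}
    (hf : Integrable f timeMeasure) {T : ℝ} (hT : T ∈ Icc (-1 : ℝ) 0) :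
    IntervalIntegrable f volume (-1) T := by
  have h4 : IntegrableOn f (uIcc (-1) T) := by
    rw [uIcc_of_le hT.1]
    exact IntegrableOn.mono_set (t := Icc (-1) 0) hf (Icc_subset_Icc_right hT.2)
  exact h4.intervalIntegrable

lemma integral_congr_of_ae_timeMeasure {F : Type*} [NormedAddCommGroup F] [NormedSpace ℝ F]
    {f g : ℝ → F} (h : ∀ᵐ T ∂timeMeasure, f T = g T) {T : ℝ} (hT : T ∈ Icc (-1 : ℝ) 0) :
    ∫ s in (-1 : ℝ)..T, f s = ∫ s in (-1 : ℝ)..T, g s := by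
  refine intervalIntegral.integral_congr_ae ?_
  filter_upwards [ae_timeMeasure_iff.1 h] with s hs hs'
  rw [uIoc_of_le hT.1] at hs'
  exact hs ⟨hs'.1.le, hs'.2.trans hT.2⟩

section AntiDual

variable {V : Type*} [NormedAddCommGroup V] [InnerProductSpace ℂ V]

lemma integrable_apply {a : ℝ → V →SL[starRingEnd ℂ] ℂ} (ha : Integrable a timeMeasure) (w : V) :
    Integrable (fun T => a T w) timeMeasure :=
  (ContinuousLinearMap.apply' ℂ (starRingEnd ℂ) w).integrable_comp ha

/-- The null set may depend on w. The Bochner primitive of a - b vanishes at every w, hence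
vanishes, and differentiating it yields one null set without any separability assumption. -/
lemma ae_eq_of_forall_apply {a b : ℝ → V →SL[starRingEnd ℂ] ℂ} (ha : Integrable a timeMeasure)
    (hb : Integrable b timeMeasure) (h : ∀ w, ∀ᵐ T ∂timeMeasure, a T w = b T w) :
    ∀ᵐ T ∂timeMeasure, a T = b T := by
  have h1 : ∀ᵐ T ∂timeMeasure, a T - b T = 0 := by
    refine ae_eq_zero_of_integral_eq_zero (ha.sub hb) fun T hT => ?_
    ext w
    have h2 := (ContinuousLinearMap.apply' ℂ (starRingEnd ℂ) w).intervalIntegral_comp_comm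
      (intervalIntegrable_of_timeMeasure (ha.sub hb) (Ioo_subset_Icc_self hT))
    refine h2.symm.trans ?_
    rw [integral_congr_of_ae_timeMeasure (g := fun _ => (0 : ℂ)) ?_ (Ioo_subset_Icc_self hT)]
    · simp
    · filter_upwards [h w] with s hs
      exact sub_eq_zero.2 hs
  filter_upwards [h1] with T hT using sub_eq_zero.1 hT

end AntiDual

lemma integrable_dtt (u : H1Sol) (w : H1) : Integrable (fun T => u.dtt T w) timeMeasure :=
  integrable_apply (V := H1) (integrable_of_top (F := Hm1) u.dtt) w

lemma tendsto_slicePairing_val {u : H1Sol} {Φ₀ : H1}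
    (h : Tendsto (fun T => eLpNorm (fun p => (u.val T).toFun p - Φ₀.toFun p) 2 sliceMeasure)
      initialTime (𝓝 0)) {v : Slice → ℂ} (hv : IsTest v) :
    Tendsto (fun T => slicePairing (u.val T).toFun v) initialTime
      (𝓝 (slicePairing Φ₀.toFun v)) := by
  rw [← tendsto_sub_nhds_zero_iff, tendsto_zero_iff_enorm_tendsto_zero]
  have h1 : Tendsto (fun T => ‖hv.memLp.toLp v‖ₑ *
      eLpNorm (fun p => (u.val T).toFun p - Φ₀.toFun p) 2 sliceMeasure) initialTime (𝓝 0) := by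
    simpa using ENNReal.Tendsto.const_mul h (Or.inr (enorm_ne_top (x := hv.memLp.toLp v)))
  refine tendsto_of_tendsto_of_tendsto_of_le_of_le' tendsto_const_nhds h1
    (Eventually.of_forall fun _ => zero_le) ?_
  -- Near the initial time the difference from Φ₀ has finite norm and so is an element of L²;
  -- Cauchy-Schwarz requires this, since elements of H¹ need not be square integrable.
  filter_upwards [h.eventually_lt_const (ENNReal.zero_lt_top)] with T hT
  have h2 := H1.toFun_sub_ae_eq (u.val T) Φ₀
  rw [← slicePairing_sub_test _ _ hv, eLpNorm_congr_ae h2]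
  have h3 : MemLp (u.val T - Φ₀).toFun 2 sliceMeasure := by
    refine ⟨?_, ?_⟩
    · exact (continuous_ofReal_fst.aestronglyMeasurable).mul (Lp.aestronglyMeasurable _)
    · rwa [eLpNorm_congr_ae h2] at hT
  have h4 : slicePairing (u.val T - Φ₀).toFun v =
      inner ℂ (hv.memLp.toLp v) (h3.toLp (u.val T - Φ₀).toFun) := by
    rw [← slicePairing_memLp]
    apply integral_congr_ae
    filter_upwards [h3.coeFn_toLp] with p hp
    rw [hp]
  rw [h4, ← Lp.enorm_toLp (f := (u.val T - Φ₀).toFun) h3, ← ofReal_norm, ← ofReal_norm,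
    ← ofReal_norm, ← ENNReal.ofReal_mul (norm_nonneg _)]
  exact ENNReal.ofReal_le_ofReal (norm_inner_le_norm _ _)

/-- The value of a solution at time `T` is recovered from its initial value and its weak time
derivative. -/
lemma H1Sol.slicePairing_val_eq {u : H1Sol} {Φ₀ : H1} {Φ₁ : L2} (h : HasInitialData u Φ₀ Φ₁)
    {v : Slice → ℂ} (hv : IsTest v) : ∀ᵐ T ∂timeMeasure, slicePairing (u.val T).toFun v =
      slicePairing Φ₀.toFun v + ∫ s in (-1 : ℝ)..T, slicePairing (u.dt s) v := by
  refine ae_eq_add_integral_of_tendsto ?_ ?_ (fun η hη => u.hasWeakDeriv_val η hη v hv)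
    (tendsto_slicePairing_val h.1 hv)
  · simp only [slicePairing_toFun_test _ hv]
    exact (invRL.integrable_comp (integrable_of_top u.val)).const_inner _
  · simp only [slicePairing_memLp _ hv.memLp]
    exact (integrable_of_top u.dt).const_inner _

/-- The counterpart of `H1Sol.slicePairing_val_eq` for the velocity. The H⁻¹ limit at T = -1, tested
on a fixed w in H¹ ∩ L², supplies the integration constant. -/
lemma H1Sol.slicePairing_dt_eq {u : H1Sol} {Φ₀ : H1} {Φ₁ : L2} (h : HasInitialData u Φ₀ Φ₁)
    {w : H1} (hw : MemLp w.toFun 2 sliceMeasure) :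
    ∀ᵐ T ∂timeMeasure, slicePairing (u.dt T) w.toFun =
      slicePairing Φ₁ w.toFun + ∫ s in (-1 : ℝ)..T, u.dtt s w := by
  refine ae_eq_add_integral_of_tendsto ?_ ?_ (fun η hη => u.hasWeakDeriv_dt η hη w hw) ?_
  · simp only [slicePairing_memLp _ hw]
    exact (integrable_of_top u.dt).const_inner _
  · exact integrable_dtt u w
  · rw [← tendsto_sub_nhds_zero_iff, Metric.tendsto_nhds]
    intro ε hε
    have h1 : 0 < ε / (‖w‖ + 1) := by positivity
    filter_upwards [h.2 _ h1] with T hT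
    rw [dist_zero_right]
    have h2 := hT w hw
    rw [slicePairing_memLp _ hw, inner_sub_right, ← slicePairing_memLp, ← slicePairing_memLp] at h2
    refine h2.trans_lt ?_
    rw [div_mul_eq_mul_div, div_lt_iff₀ (by positivity)]
    nlinarith [norm_nonneg w]

lemma IsWeakSolution.dtt_eq {q e : ℝ} {u : H1Sol} {Φ₀ : H1} {Φ₁ : L2}
    (h : IsWeakSolution q e Φ₀ Φ₁ u) (w : H1) : ∀ᵐ T ∂timeMeasure,
      u.dtt T w = waveAccel (alphaZero q e) (q * e) (u.val T) (u.dt T) w := by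
  filter_upwards [h.1 w] with T hT
  rw [waveAccel_apply]
  linear_combination hT

theorem IsWeakSolution.unique {q e : ℝ} (hqe : |q * e| < 1 / 2) {Φ₀ : H1} {Φ₁ : L2} {u u' : H1Sol}
    (h : IsWeakSolution q e Φ₀ Φ₁ u) (h' : IsWeakSolution q e Φ₀ Φ₁ u') : u = u' := by
  have iΦ : Integrable (fun T => u.val T - u'.val T) timeMeasure :=
    (integrable_of_top u.val).sub (integrable_of_top u'.val)
  have iψ : Integrable (fun T => u.dt T - u'.dt T) timeMeasure :=
    (integrable_of_top u.dt).sub (integrable_of_top u'.dt)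
  have iψ' : Integrable (fun T => ∫ s in (-1 : ℝ)..T, (u.dt s - u'.dt s)) timeMeasure :=
    (continuousOn_primitive iψ).integrableOn_Icc
  -- With common initial data, the difference of the solutions is the primitive of the difference of
  -- the velocities when paired with test functions. Integrating in time puts the primitive of the
  -- difference in H¹ ∩ L², as the energy argument requires.
  have key1 : ∀ T ∈ Icc (-1 : ℝ) 0, WithLp.toLp 2 (∫ s in (-1 : ℝ)..T, (u.val s - u'.val s),
      ∫ s in (-1 : ℝ)..T, ∫ r in (-1 : ℝ)..s, (u.dt r - u'.dt r)) ∈ H1L2 := by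
    intro T hT
    refine mem_H1L2_iff.2 fun v hv => ?_
    have h1 : (inner ℂ (hv.memLp.toLp v)
        (∫ s in (-1 : ℝ)..T, ∫ r in (-1 : ℝ)..s, (u.dt r - u'.dt r)) : ℂ) =
        ∫ s in (-1 : ℝ)..T,
          inner ℂ (hv.memLp.toLp v) (∫ r in (-1 : ℝ)..s, (u.dt r - u'.dt r)) :=
      intervalIntegral_inner _ iψ' hT
    have h2 : invRL (∫ s in (-1 : ℝ)..T, (u.val s - u'.val s)) =
        ∫ s in (-1 : ℝ)..T, invRL (u.val s - u'.val s) :=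
      (invRL.intervalIntegral_comp_comm (intervalIntegrable_of_timeMeasure iΦ hT)).symm
    change inner ℂ _ (invRL (∫ s in (-1 : ℝ)..T, (u.val s - u'.val s))) = inner ℂ _
      (∫ s in (-1 : ℝ)..T, ∫ r in (-1 : ℝ)..s, (u.dt r - u'.dt r))
    rw [h1, h2]
    refine (intervalIntegral_inner _ (invRL.integrable_comp iΦ) hT).trans ?_
    refine integral_congr_of_ae_timeMeasure ?_ hT
    filter_upwards [H1Sol.slicePairing_val_eq h.2 hv, H1Sol.slicePairing_val_eq h'.2 hv,
      ae_mem_Icc] with s h3 h4 hs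
    have h5 := slicePairing_sub_test (u.val s) (u'.val s) hv
    rw [h3, h4, add_sub_add_left_eq_sub, slicePairing_toFun_test _ hv] at h5
    refine h5.trans ?_
    refine Eq.trans ?_ (intervalIntegral_inner (hv.memLp.toLp v) iψ hs).symm
    simp only [slicePairing_memLp _ hv.memLp, inner_sub_right]
    exact (intervalIntegral.integral_sub
      (intervalIntegrable_of_timeMeasure ((integrable_of_top u.dt).const_inner _) hs)
      (intervalIntegrable_of_timeMeasure ((integrable_of_top u'.dt).const_inner _) hs)).symm
  have key2 : ∀ z ∈ H1L2, ∀ᵐ T ∂timeMeasure, (inner ℂ z.snd (u.dt T - u'.dt T) : ℂ) =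
      ∫ s in (-1 : ℝ)..T,
        waveAccel (alphaZero q e) (q * e) (u.val s - u'.val s) (u.dt s - u'.dt s) z.fst := by
    intro z hz
    have hae : z.fst.toFun =ᵐ[sliceMeasure] z.snd := hz
    have hw : MemLp z.fst.toFun 2 sliceMeasure := (memLp_congr_ae hae).2 (Lp.memLp z.snd)
    have hsnd : hw.toLp z.fst.toFun = z.snd := Lp.ext (hw.coeFn_toLp.trans hae)
    filter_upwards [H1Sol.slicePairing_dt_eq h.2 hw, H1Sol.slicePairing_dt_eq h'.2 hw,
      ae_mem_Icc] with T h3 h4 hT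
    rw [slicePairing_memLp _ hw, slicePairing_memLp _ hw, hsnd] at h3 h4
    rw [inner_sub_right, h3, h4, add_sub_add_left_eq_sub, ← intervalIntegral.integral_sub
      (intervalIntegrable_of_timeMeasure (integrable_dtt u z.fst) hT)
      (intervalIntegrable_of_timeMeasure (integrable_dtt u' z.fst) hT)]
    refine integral_congr_of_ae_timeMeasure ?_ hT
    filter_upwards [h.dtt_eq z.fst, h'.dtt_eq z.fst] with s h5 h6
    rw [h5, h6, waveAccel_sub_apply]
  obtain ⟨hΦ, hψ⟩ := twisted_wave_unique (alphaZero_pos hqe) (alphaZero_sq_le_one q e) (q * e)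
    iΦ iψ key1 key2
  have e1 : ∀ᵐ T ∂timeMeasure, u.val T = u'.val T := by
    filter_upwards [hΦ] with T hT using sub_eq_zero.1 hT
  have e2 : ∀ᵐ T ∂timeMeasure, u.dt T = u'.dt T := by
    filter_upwards [hψ] with T hT using sub_eq_zero.1 hT
  refine H1Sol.ext (Lp.ext e1) (Lp.ext e2) (Lp.ext ?_)
  -- The functions and their velocities agree, so the equation forces the second derivatives to
  -- agree on each w.
  refine ae_eq_of_forall_apply (V := H1) (integrable_of_top (F := Hm1) u.dtt)
    (integrable_of_top (F := Hm1) u'.dtt) fun w => ?_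
  filter_upwards [e1, e2, h.dtt_eq w, h'.dtt_eq w] with T h1 h2 h3 h4
  rw [h3, h4, h1, h2]

end TwistedWave

end


theorem proposition3p3 (q e : ℝ) (hqe : |q * e| < 1 / 2) :
    ∃ C : ℝ, 0 < C ∧ ∀ (Φ₀ : TwistedWave.H1) (Φ₁ : TwistedWave.L2),
      (∃! Φ : TwistedWave.H1Sol, TwistedWave.IsWeakSolution q e Φ₀ Φ₁ Φ) ∧
      ∀ Φ : TwistedWave.H1Sol, TwistedWave.IsWeakSolution q e Φ₀ Φ₁ Φ →
        Φ.norm ≤ ENNReal.ofReal (C * TwistedWave.dataNorm Φ₀ Φ₁) ∧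
        (MemLp Φ₀.toFun 2 TwistedWave.sliceMeasure → Φ.IsBoundedInL2) := by
  obtain ⟨C, hC, h⟩ := TwistedWave.exists_isWeakSolution hqe
  refine ⟨C, hC, fun Φ₀ Φ₁ => ?_⟩
  obtain ⟨u, hu, hbound, hL2⟩ := h Φ₀ Φ₁
  refine ⟨⟨u, hu, fun u' hu' => hu'.unique hqe hu⟩, fun u' hu' => ?_⟩
  -- Uniqueness transfers the bounds of the constructed solution to an arbitrary weak solution.
  rw [hu'.unique hqe hu]
  exact ⟨hbound, hL2⟩
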